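/- **Setting.** Let $\mathbb{C}^2_\times=\mathbb{C}^2\setminus\{0\}$ be the space of nonzero spinors $\kappa=(\xi,\eta)$, on which $SL(2,\mathbb{C})$ acts by matrix multiplication. *Flags.* Let $\mathcal{H}$ be the space of Hermitian $2\times2$ matrices and $\mathcal{H}_0^+\subset\mathcal{H}$ the set of singular ones with positive trace; let $\mathbb{R}^{1,3}$ be Minkowski space with coordinates $(T,X,Y,Z)$ and form $\langle\cdot,\cdot\rangle$ of signature $(+,-,-,-)$, and $L^+$ its positive light cone. The linear isomorphism $\mathbf g:\mathcal H\to\mathbb R^{1,3}$, $\mathbf g\begin{pmatrix}a&b+ci\\ b-ci&d\end{pmatrix}=(a+d,2b,2c,a-d)$, takes $\mathcal H_0^+$ to $L^+$. A pointed oriented null flag (in $\mathcal H$ or in $\mathbb{R}^{1,3}$) is a triple $(p,V,o)$ with $p$ in the cone $\mathcal{H}_0^+$, resp. $L^+$, $V\ni p$ a 2-plane in the tangent space of the cone at $p$, and $o$ an orientation of $V/\mathbb Rp$; $[[p,v]]$ denotes the flag with $V=\langle p,v\rangle$ and $V/\mathbb Rp$ oriented by $v$. Put $\mathbf f(\kappa)=\kappa\kappa^*$,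 $\mathcal Z(\xi,\eta)=(i\bar\eta,-i\bar\xi)$, $\mathbf F(\kappa)=[[\mathbf f(\kappa),D_\kappa\mathbf f(\mathcal Z(\kappa))]]$, and $\mathbf G(p,V,o)=(\mathbf g(p),\mathbf g(V),\mathbf g(o))$. Spin flags are the points of the connected double covers of the two spaces of flags (each homeomorphic to $SO(3)\times\mathbb R$). *Decorated horospheres.* Let $\mathbb H=\{x\in\mathbb R^{1,3}:\langle x,x\rangle=1,\ T>0\}$, $\mathbb D$ and $\mathbb U=\{(z,t)\in\mathbb{C}\times\mathbb{R}:t>0\}$ be the hyperboloid, conformal disc and upper half space models of hyperbolic 3-space. A decoration on a horosphere is a parallel oriented tangent line field, i.e. one that is invariant under the parabolic isometries preserving the horosphere. The map $\mathbf H$ sends a flag $(p,V,o)$ in $\mathbb{R}^{1,3}$ to the horosphere $\{x\in\mathbb H:\langle x,p\rangle=1\}$ with the line field $V\cap T_q$ (where $T_q$ is the tangent plane of the horosphere at $q$), oriented by $o$. The isometries $\mathbb H\to\mathbb D$, $(T,X,Y,Z)\mapsto (X,Y,Z)/(1+T)$, and $\mathbb D\to\mathbb U$, extending stereographic projection $(x,y,z)\mapsto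 (x+iy)/(1-z)$ of the unit sphere to $\mathbb C\cup\{\infty\}$, induce maps $\mathbf I,\mathbf J$ of decorated horospheres. Put $\mathbf K=\mathbf J\circ\mathbf I\circ\mathbf H\circ\mathbf G\circ\mathbf F$. *Spin decorations.* Let $\mathrm{Fr}$ be the bundle of right-handed orthonormal frames of hyperbolic 3-space and $\mathrm{Spin}\to\mathrm{Fr}$ its connected double cover. On a horosphere, let $N^{out}$ be the unit normal pointing to its centre and $N^{in}=-N^{out}$. An outward (inward) spin decoration is a continuous lift to $\mathrm{Spin}$ of the frame field $(N,V,N\times V)$ with $N=N^{out}$ (resp. $N^{in}$) and $V$ a unit parallel tangent vector field. A spin-decorated horosphere is a horosphere with a pair $(W^{in},W^{out})$ of an inward and an outward spin decoration, where $W^{in}$ is obtained from $W^{out}$ by rotating every frame by $\pi$ about its second vector (through a path in $\mathrm{Spin}$), and $W^{out}$ from $W^{in}$ by rotation by $-\pi$. It projects to the horosphere decorated by the direction of $V$. The space $\mathfrak H_D^S$ of spin-decorated horospheres carries the quotient topology from $\mathrm{Spin}$ (a spin frame $\mapsto$ the spin-decorated horosphere with $W^{out}$ through it), and the smooth structure for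 which the projection to the space of decorated horospheres (identified with $UTS^2\times\mathbb R$ by centre, direction, and position of the horosphere) is a local diffeomorphism. $SL(2,\mathbb C)$ acts on $\mathcal{H}$ by $S\mapsto ASA^*$, hence through $\mathbf{g}$ and the isometries above on all three models by isometries; by lifting paths from $1\in SL(2,\mathbb{C})$ it acts on $\mathrm{Spin}$, hence on $\mathfrak H_D^S$. **Theorem.** The maps $\mathbf F,\mathbf G,\mathbf H,\mathbf I,\mathbf J$ have continuous lifts $\widetilde{\mathbf F},\widetilde{\mathbf G},\widetilde{\mathbf H},\widetilde{\mathbf I},\widetilde{\mathbf J}$ to maps between nonzero spinors, spin flags and spin-decorated horospheres. For any such lifts the composite $$\widetilde{\mathbf K}=\widetilde{\mathbf J}\circ\widetilde{\mathbf I}\circ\widetilde{\mathbf H}\circ\widetilde{\mathbf G}\circ\widetilde{\mathbf F}:\ \mathbb C^2_\times\to\mathfrak H_D^S(\mathbb U)$$ is a diffeomorphism and is $SL(2,\mathbb C)$-equivariant. For each spinor $\kappa=(\xi,\eta)$, the spin-decorated horosphere $\widetilde{\mathbf K}(\kappa)$ projects to the decorated horosphere $\mathbf K(\kappa)$, which is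 the following one. If $\eta\neq0$, it is the horosphere centred at $\xi/\eta$ of Euclidean diameter $|\eta|^{-2}$, whose decoration at its highest point is in the direction $i\eta^{-2}\in\mathbb C$. If $\eta=0$, it is the horosphere centred at $\infty$ at Euclidean height $|\xi|^2$, decorated in the direction $i\xi^2\in\mathbb C$ at each point. -/

import Mathlib

open scoped Matrix Manifold ContDiff

noncomputable section

namespace SpinorHoro

/-! ### Spinors, matrices, Minkowski space -/

/-- Complex `2 × 2` matrices. -/
abbrev Mat := Matrix (Fin 2) (Fin 2) ℂ

/-- The group `SL(2, ℂ)`. -/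
abbrev SL2C := Matrix.SpecialLinearGroup (Fin 2) ℂ

/-- `SU(2) = Spin(3)`. -/
abbrev SU2 := Matrix.specialUnitaryGroup (Fin 2) ℂ

/-- Minkowski space `ℝ^{1,3}`, with coordinates `(T, X, Y, Z)`. -/
abbrev Mink := Fin 4 → ℝ

/-- Three-dimensional coordinate space (all Euclidean expressions in it are written out with
the dot product). -/
abbrev R3 := Fin 3 → ℝ

/-- The nonzero spinors `ℂ² ∖ {0}`, an open subset of `ℂ²`. -/
def nonzeroSpinors : TopologicalSpace.Opens (Fin 2 → ℂ) := ⟨{0}ᶜ, isOpen_compl_singleton⟩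

/-- `SL(2, ℂ)` acts on nonzero spinors by matrix-vector multiplication. -/
def spinorAct (A : SL2C) (κ : nonzeroSpinors) : nonzeroSpinors :=
  ⟨(A : Mat) *ᵥ (κ : Fin 2 → ℂ), by
    intro h
    have h0 : (A : Mat) *ᵥ (κ : Fin 2 → ℂ) = 0 := h
    apply κ.2
    have h1 : ((A⁻¹ : SL2C) : Mat) *ᵥ ((A : Mat) *ᵥ (κ : Fin 2 → ℂ)) = 0 := by
      rw [h0, Matrix.mulVec_zero]
    rw [Matrix.mulVec_mulVec, ← Matrix.SpecialLinearGroup.coe_mul, inv_mul_cancel,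
      Matrix.SpecialLinearGroup.coe_one, Matrix.one_mulVec] at h1
    exact h1⟩

/-- The Pauli matrices `σ_X, σ_Y, σ_Z`, with the sign convention
`σ_Y = ((0, i), (-i, 0))`. -/
def pauli : Fin 3 → Mat :=
  ![!![0, 1; 1, 0], !![0, Complex.I; -Complex.I, 0], !![1, 0; 0, -1]]

/-- The Minkowski inner product `TT' - XX' - YY' - ZZ'`. -/
def mink (p q : Mink) : ℝ := p 0 * q 0 - p 1 * q 1 - p 2 * q 2 - p 3 * q 3

/-- The positive light cone `L⁺`. -/
def lightCone : Set Mink := {p | mink p p = 0 ∧ 0 < p 0}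

/-- Singular Hermitian matrices of positive trace, `ℋ₀⁺`. -/
def hermCone : Set Mat := {S | S.IsHermitian ∧ S.det = 0 ∧ 0 < S.trace.re}

/-- The map `f(κ) = κ κ^*`. -/
def fMap (κ : Fin 2 → ℂ) : Mat := Matrix.vecMulVec κ (star κ)

/-- The real directional derivative `D_κ f(ν) = d/ds f(κ + sν)` at `s = 0`, entry by entry. -/
def dfMap (κ ν : Fin 2 → ℂ) : Mat :=
  Matrix.of fun i j => deriv (fun s : ℝ => fMap (κ + (s : ℂ) • ν) i j) 0

/-- The map `𝒵(α, β) = (i β̄, -i ᾱ)`. -/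
def zMap (κ : Fin 2 → ℂ) : Fin 2 → ℂ :=
  ![Complex.I * star (κ 1), -Complex.I * star (κ 0)]

/-- The map `g` with `g ((a, b + ci), (b - ci, d)) = (a + d, 2b, 2c, a - d)`, written as a real
linear map on all matrices (only its values on Hermitian matrices matter). -/
def gMap : Mat →ₗ[ℝ] Mink where
  toFun S := ![(S 0 0).re + (S 1 1).re, 2 * (S 0 1).re, 2 * (S 0 1).im, (S 0 0).re - (S 1 1).re]
  map_add' S S' := by
    ext i; fin_cases i <;> simp <;> ring
  map_smul' c S := by
    ext i; fin_cases i <;> simp <;> ring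

/-- The inverse of `g`, from Minkowski space to Hermitian matrices. -/
def gInv (p : Mink) : Mat :=
  (1 / 2 : ℂ) • !![(p 0 + p 3 : ℂ), p 1 + p 2 * Complex.I; p 1 - p 2 * Complex.I, p 0 - p 3]

/-! ### Pointed oriented null flags -/

/-- The data `(p, V, o)` of a pointed oriented flag in `E`: a point, a plane through it, and an
orientation of `V / ℝp`, given as the open half-plane `{v ∈ V : v + ℝp is positive}`. -/
@[ext] structure FlagData (E : Type) [AddCommGroup E] [Module ℝ E] where
  /-- the base point `p` -/
  pt : E
  /-- the 2-plane `V` -/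
  plane : Submodule ℝ E
  /-- the positive side of `ℝp` in `V` -/
  pos : Set E

/-- `[[p, v]]`: the plane spanned by `p, v`, with `V / ℝp` oriented by `v`. -/
def bracket {E : Type} [AddCommGroup E] [Module ℝ E] (p v : E) : FlagData E where
  pt := p
  plane := Submodule.span ℝ {p, v}
  pos := {w | ∃ a b : ℝ, 0 < b ∧ w = a • p + b • v}

/-- Pointed oriented null flags in `ℋ`. The tangent space to `ℋ₀⁺` at `S` consists of the
Hermitian `U` annihilated by the differential `U ↦ tr (adj(S) U)` of `det` at `S`. -/
def IsHermFlag (φ : FlagData Mat) : Prop :=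
  φ.pt ∈ hermCone ∧ ∃ U : Mat, U.IsHermitian ∧ (φ.pt.adjugate * U).trace = 0 ∧
    LinearIndependent ℝ ![φ.pt, U] ∧ φ = bracket φ.pt U

/-- Pointed oriented null flags in `ℝ^{1,3}`. The tangent space to `L⁺` at `p` is `p^⊥`. -/
def IsMinkFlag (φ : FlagData Mink) : Prop :=
  φ.pt ∈ lightCone ∧ ∃ v : Mink, mink φ.pt v = 0 ∧
    LinearIndependent ℝ ![φ.pt, v] ∧ φ = bracket φ.pt v

/-- The map `F(κ) = [[f(κ), D_κ f(𝒵(κ))]]`. -/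
def FMap (κ : Fin 2 → ℂ) : FlagData Mat := bracket (fMap κ) (dfMap κ (zMap κ))

/-- The map `G(S, V, o) = (g(S), g(V), g(o))`. -/
def GMap (φ : FlagData Mat) : FlagData Mink where
  pt := gMap φ.pt
  plane := φ.plane.map gMap
  pos := gMap '' φ.pos

/-- Spin flags in `ℋ`: the double cover of the space of pointed oriented null flags pulled back
from `SU(2) → SO(3)`. A flag `(S, V, o)` determines the unit vector `n` with `S` a positive multiple
of `1 + n·σ`, and the unit vector `e ⊥ n` with `e·σ` in the positive half of `V`; this is a point
`(n, e)` of `UT S² ≅ SO(3)` (the frame `(n, e, n × e)`). A spin flag is a flag together with one of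
the two lifts `u ∈ SU(2)` of this frame, i.e. `n·σ = u σ_X u^*` and `e·σ = u σ_Y u^*`. -/
@[ext] structure HermSpinFlag where
  /-- the underlying flag -/
  flag : FlagData Mat
  /-- the spin lift -/
  lift : SU2
  isFlag : IsHermFlag flag
  ray : ∃ c : ℝ, 0 < c ∧ (lift : Mat) * (1 + pauli 0) * (lift : Mat)ᴴ = c • flag.pt
  half : (lift : Mat) * pauli 1 * (lift : Mat)ᴴ ∈ flag.pos

/-- Spin flags in `ℝ^{1,3}`, in the same way. -/
@[ext] structure MinkSpinFlag where
  /-- the underlying flag -/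
  flag : FlagData Mink
  /-- the spin lift -/
  lift : SU2
  isFlag : IsMinkFlag flag
  ray : ∃ c : ℝ, 0 < c ∧ gMap ((lift : Mat) * (1 + pauli 0) * (lift : Mat)ᴴ) = c • flag.pt
  half : gMap ((lift : Mat) * pauli 1 * (lift : Mat)ᴴ) ∈ flag.pos

/-- A spin flag is determined by its base point and its spin lift; these give the topology. -/
instance : TopologicalSpace HermSpinFlag :=
  TopologicalSpace.induced (fun x => (x.flag.pt, x.lift)) inferInstance

instance : TopologicalSpace MinkSpinFlag :=
  TopologicalSpace.induced (fun x => (x.flag.pt, x.lift)) inferInstance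

/-! ### Models of hyperbolic 3-space -/

/-- The data of a model of hyperbolic 3-space inside a real vector space `E`. It is used for the
three models `hyperboloid`, `disc`, `upper` defined below only. -/
structure HypModel (E : Type) where
  /-- the underlying set -/
  carrier : Set E
  /-- the tangent space at a point -/
  tangent : E → Set E
  /-- the Riemannian metric -/
  metric : E → E → E → ℝ
  /-- a global right-handed orthonormal frame field; it fixes the orientation, and it trivialises
  the frame bundle -/
  std : E → Fin 3 → E
  /-- the horospheres are the sets `{β = 0}` in the model, for `β` in this set of functions; the
  horoball bounded by `{β = 0}` is `{β < 0}` -/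
  horoFun : Set (E → ℝ)
  /-- the action of `SL(2, ℂ)` by isometries -/
  act : SL2C → E → E

/-- Action of `A ∈ SL(2, ℂ)` on Minkowski space, `p ↦ g(A g⁻¹(p) A^*)`. -/
def minkAct (A : SL2C) (p : Mink) : Mink := gMap ((A : Mat) * gInv p * (A : Mat)ᴴ)

/-- The isometry from the hyperboloid model to the disc model. -/
def iMap (x : Mink) : R3 := fun k => x k.succ / (1 + x 0)

/-- The inverse of `iMap`. -/
def iInv (v : R3) : Mink :=
  Fin.cons ((1 + v ⬝ᵥ v) / (1 - v ⬝ᵥ v)) fun k => 2 * v k / (1 - v ⬝ᵥ v)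

/-- The isometry from the disc model to the upper half space model which extends stereographic
projection `(x, y, z) ↦ (x + iy) / (1 - z)` of the unit sphere (note that
`v ⬝ᵥ v - 2 * v 2 + 1 = |v - (0, 0, 1)|²`). -/
def jMap (v : R3) : ℂ × ℝ :=
  (((2 / (v ⬝ᵥ v - 2 * v 2 + 1) : ℝ) : ℂ) * (v 0 + v 1 * Complex.I),
    (1 - v ⬝ᵥ v) / (v ⬝ᵥ v - 2 * v 2 + 1))

/-- The inverse of `jMap`. -/
def jInv (q : ℂ × ℝ) : R3 :=
  (Complex.normSq q.1 + (q.2 + 1) ^ 2)⁻¹ •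
    ![2 * q.1.re, 2 * q.1.im, Complex.normSq q.1 + q.2 ^ 2 - 1]

/-- Action of `SL(2, ℂ)` on the disc model. -/
def discAct (A : SL2C) (v : R3) : R3 := iMap (minkAct A (iInv v))

/-- Action of `SL(2, ℂ)` on the upper half space model. -/
def upperAct (A : SL2C) (q : ℂ × ℝ) : ℂ × ℝ := jMap (discAct A (jInv q))

/-- The hyperboloid model `ℍ`. Horospheres are the (non-empty) intersections with lightlike
3-planes `⟨x, n⟩ = c`, `n ∈ L⁺`, `c > 0`, with centre the ray of `n`. The global frame field is the
image of the frame `(∂_X, ∂_Y, ∂_Z)` at `(1, 0, 0, 0)` under pure boosts. -/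
def hyperboloid : HypModel Mink where
  carrier := {x | mink x x = 1 ∧ 0 < x 0}
  tangent q := {v | mink q v = 0}
  metric _ v w := -mink v w
  std q k := Pi.single k.succ 1 + (q k.succ / (1 + q 0)) • (q + Pi.single 0 1)
  horoFun := {β | ∃ n ∈ lightCone, ∃ c : ℝ, 0 < c ∧ β = fun x => mink x n - c}
  act := minkAct

/-- The function vanishing on the horosphere of the disc model with centre `n` (`|n| = 1`) through
the point `s n` (`-1 < s < 1`), i.e. on the Euclidean sphere with diameter from `s n` to `n`. -/
def discHoroFun (n : R3) (s : ℝ) (v : R3) : ℝ :=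
  (v - ((1 + s) / 2) • n) ⬝ᵥ (v - ((1 + s) / 2) • n) - ((1 - s) / 2) ^ 2

/-- The disc model `𝔻`. Horospheres are Euclidean spheres tangent to the unit sphere. -/
def disc : HypModel R3 where
  carrier := {v | v ⬝ᵥ v < 1}
  tangent _ := Set.univ
  metric q v w := 4 * (v ⬝ᵥ w) / (1 - q ⬝ᵥ q) ^ 2
  std q k := ((1 - q ⬝ᵥ q) / 2) • Pi.single k 1
  horoFun := {β | ∃ (n : R3) (s : ℝ), n ⬝ᵥ n = 1 ∧ -1 < s ∧ s < 1 ∧ β = discHoroFun n s}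
  act := discAct

/-- The function vanishing on the horosphere of the upper half space with centre `c ∈ ℂ` and
Euclidean diameter `d`, i.e. on the sphere `|z - c|² + (t - d/2)² = (d/2)²`. -/
def upperSphereFun (c : ℂ) (d : ℝ) (q : ℂ × ℝ) : ℝ :=
  Complex.normSq (q.1 - c) + (q.2 - d / 2) ^ 2 - (d / 2) ^ 2

/-- The function vanishing on the horosphere of the upper half space with centre `∞` at height
`a`; the horoball is the region above it. -/
def upperPlaneFun (a : ℝ) (q : ℂ × ℝ) : ℝ := a - q.2

/-- The upper half space model `𝕌`, as a subset of `ℂ × ℝ`. -/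
def upper : HypModel (ℂ × ℝ) where
  carrier := {q | 0 < q.2}
  tangent _ := Set.univ
  metric q v w := (v.1.re * w.1.re + v.1.im * w.1.im + v.2 * w.2) / q.2 ^ 2
  std q := ![((q.2 : ℂ), 0), ((q.2 : ℂ) * Complex.I, 0), (0, q.2)]
  horoFun := {β | (∃ (c : ℂ) (d : ℝ), 0 < d ∧ β = upperSphereFun c d) ∨
    ∃ a : ℝ, 0 < a ∧ β = upperPlaneFun a}
  act := upperAct

namespace HypModel

variable {E : Type} [NormedAddCommGroup E] [NormedSpace ℝ E] (M : HypModel E)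

/-- The horosphere `{β = 0}`. -/
def horosphere (β : E → ℝ) : Set E := {q | q ∈ M.carrier ∧ β q = 0}

/-- `v` is tangent at `q` to the horosphere `{β = 0}`. -/
def TangentTo (β : E → ℝ) (q v : E) : Prop := v ∈ M.tangent q ∧ fderiv ℝ β q v = 0

/-- `A` is a parabolic element which preserves the set `h`. -/
def ParabolicFixing (h : Set E) (A : SL2C) : Prop :=
  ((A : Mat).trace = 2 ∨ (A : Mat).trace = -2) ∧ M.act A '' h = h

/-- `v` is a unit vector at `q` normal to the horosphere `{β = 0}`. -/
def UnitNormal (β : E → ℝ) (q v : E) : Prop :=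
  v ∈ M.tangent q ∧ M.metric q v v = 1 ∧ ∀ w, M.TangentTo β q w → M.metric q v w = 0

/-- `v = N^out`: the unit normal into the horoball, i.e. towards the centre of the horosphere. -/
def OutwardNormal (β : E → ℝ) (q v : E) : Prop := M.UnitNormal β q v ∧ fderiv ℝ β q v < 0

/-- `v = N^in`: the unit normal away from the centre of the horosphere. -/
def InwardNormal (β : E → ℝ) (q v : E) : Prop := M.UnitNormal β q v ∧ 0 < fderiv ℝ β q v

/-- `V` is a unit parallel vector field on the horosphere `{β = 0}`: tangent, of unit length, and
invariant under the parabolic isometries that preserve the horosphere. -/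
def UnitParallel (β : E → ℝ) (V : E → E) : Prop :=
  (∀ q ∈ M.horosphere β, M.TangentTo β q (V q) ∧ M.metric q (V q) (V q) = 1) ∧
  ∀ A, M.ParabolicFixing (M.horosphere β) A →
    ∀ q ∈ M.horosphere β, fderiv ℝ (M.act A) q (V q) = V (M.act A q)

end HypModel

/-! ### Decorated horospheres -/

/-- A subset of `E` with an oriented line field on it, the latter given as the set of all `(q, v)`
such that `v` is a positively directed nonzero vector of the oriented line at `q`. -/
@[ext] structure DecData (E : Type) where
  /-- the horosphere -/
  hor : Set E
  /-- the oriented line field -/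
  line : Set (E × E)

/-- Transport by a map and its derivative. -/
def DecData.push {E E' : Type} [NormedAddCommGroup E] [NormedSpace ℝ E] [NormedAddCommGroup E']
    [NormedSpace ℝ E'] (φ : E → E') (d : DecData E) : DecData E' where
  hor := φ '' d.hor
  line := (fun z : E × E => (φ z.1, fderiv ℝ φ z.1 z.2)) '' d.line

/-- Decorated horospheres: horospheres with a tangent oriented line field which is parallel, i.e.
invariant under the parabolic isometries that preserve the horosphere. -/
def IsDecorated {E : Type} [NormedAddCommGroup E] [NormedSpace ℝ E] (M : HypModel E)
    (d : DecData E) : Prop :=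
  ∃ β ∈ M.horoFun, d.hor = M.horosphere β ∧
    (∀ z ∈ d.line, z.1 ∈ d.hor) ∧
    (∀ q ∈ d.hor, ∃ v, v ≠ 0 ∧ M.TangentTo β q v ∧
      {w | (q, w) ∈ d.line} = {w | ∃ c : ℝ, 0 < c ∧ w = c • v}) ∧
    ∀ A, M.ParabolicFixing d.hor A → (d.push (M.act A)).line = d.line

/-- The map `H(p, V, o) = (h(p), V ∩ T h(p))`, where `h(p) = {x ∈ ℍ : ⟨x, p⟩ = 1}`; the line
`V ∩ T_q h(p) = V ∩ q^⊥` is oriented by the positive half of `V`. -/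
def HMap (φ : FlagData Mink) : DecData Mink where
  hor := {x | x ∈ hyperboloid.carrier ∧ mink x φ.pt = 1}
  line := {z | (z.1 ∈ hyperboloid.carrier ∧ mink z.1 φ.pt = 1) ∧ z.2 ∈ φ.pos ∧ mink z.1 z.2 = 0}

/-- The map `I`, given by the isometry `iMap` and its derivative. -/
def IMap (d : DecData Mink) : DecData R3 := d.push iMap

/-- The map `J`, given by the isometry `jMap` and its derivative. -/
def JMap (d : DecData R3) : DecData (ℂ × ℝ) := d.push jMap

/-- The composite `K = J ∘ I ∘ H ∘ G ∘ F`. -/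
def KMap (κ : Fin 2 → ℂ) : DecData (ℂ × ℝ) := JMap (IMap (HMap (GMap (FMap κ))))

/-! ### Spin frames and spin decorations -/

/-- Spin frames: the double cover of the bundle of right-handed orthonormal frames, with structure
group `Spin(3) = SU(2)`. A spin frame is a right-handed orthonormal frame `(f_1, f_2, f_3)` at a
point, with one of the two elements `u` of `SU(2)` over the rotation that takes the global frame
field to `(f_1, f_2, f_3)`. Here `u` lies over the rotation matrix `R` if
`u σ_j u^* = ∑ i, R i j • σ_i`. -/
@[ext] structure SpinFrame {E : Type} [NormedAddCommGroup E] [NormedSpace ℝ E]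
    (M : HypModel E) where
  /-- the base point -/
  pt : E
  /-- the frame -/
  vec : Fin 3 → E
  /-- the spin lift -/
  lift : SU2
  pt_mem : pt ∈ M.carrier
  vec_mem : ∀ j, vec j ∈ M.tangent pt
  orthonormal : ∀ i j, M.metric pt (vec i) (vec j) = if i = j then 1 else 0
  rightHanded : 0 < (Matrix.of fun i j => M.metric pt (M.std pt i) (vec j)).det
  lift_spec : ∀ j, (lift : Mat) * pauli j * (lift : Mat)ᴴ =
    ∑ i, M.metric pt (M.std pt i) (vec j) • pauli i

section Spin

variable {E : Type} [NormedAddCommGroup E] [NormedSpace ℝ E] (M : HypModel E)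

instance : TopologicalSpace (SpinFrame M) :=
  TopologicalSpace.induced (fun s => (s.pt, s.vec, s.lift)) inferInstance

/-- The lift to `SU(2)` of the right-handed rotation by `θ` about the second axis; it is the end of
the path in `SU(2)` from `1` over the rotations by angles from `0` to `θ`. -/
def spinRot (θ : ℝ) : Mat :=
  !![(Real.cos (θ / 2) : ℂ), -(Real.sin (θ / 2) : ℂ); (Real.sin (θ / 2) : ℂ), Real.cos (θ / 2)]

/-- The set of spin frames obtained from those in `W` by right-handed rotation by the angle `θ`
about the second vector of the frame. -/
def rotated (θ : ℝ) (W : Set (SpinFrame M)) : Set (SpinFrame M) :=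
  {s' | ∃ s ∈ W, s'.pt = s.pt ∧ (s'.lift : Mat) = (s.lift : Mat) * spinRot θ}

/-- `W` is (the image of) an outward spin decoration on the horosphere `{β = 0}`: a continuous
section of the spin frames over the horosphere, lifting the frame field `(N^out, V, N^out × V)` of
a unit parallel vector field `V` (the third vector is determined by right-handedness). -/
def IsOutward (β : E → ℝ) (W : Set (SpinFrame M)) : Prop :=
  ∃ V : E → E, M.UnitParallel β V ∧ ∃ w : M.horosphere β → SpinFrame M, Continuous w ∧
    (∀ q, (w q).pt = q ∧ M.OutwardNormal β q ((w q).vec 0) ∧ (w q).vec 1 = V q) ∧ W = Set.range w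

/-- Inward spin decorations, with `(N^in, V, N^in × V)` in place of `(N^out, V, N^out × V)`. -/
def IsInward (β : E → ℝ) (W : Set (SpinFrame M)) : Prop :=
  ∃ V : E → E, M.UnitParallel β V ∧ ∃ w : M.horosphere β → SpinFrame M, Continuous w ∧
    (∀ q, (w q).pt = q ∧ M.InwardNormal β q ((w q).vec 0) ∧ (w q).vec 1 = V q) ∧ W = Set.range w

/-- Spin-decorated horospheres: a horosphere with an inward and an outward spin decoration, each
associated to the other. -/
@[ext] structure SpinDecHorosphere where
  /-- the horosphere -/
  hor : Set E
  /-- the inward spin decoration -/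
  Win : Set (SpinFrame M)
  /-- the outward spin decoration -/
  Wout : Set (SpinFrame M)
  isSpinDec : ∃ β ∈ M.horoFun, hor = M.horosphere β ∧ IsInward M β Win ∧ IsOutward M β Wout
  in_of_out : Win = rotated M Real.pi Wout
  out_of_in : Wout = rotated M (-Real.pi) Win

/-- The topology on spin-decorated horospheres: the quotient topology of the space of spin frames,
under the map which takes a spin frame to the spin-decorated horosphere whose outward spin
decoration contains it. -/
instance : TopologicalSpace (SpinDecHorosphere M) :=
  TopologicalSpace.coinduced
    (fun z : {z : SpinDecHorosphere M × SpinFrame M // z.2 ∈ z.1.Wout} => z.1.1)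
    (TopologicalSpace.induced
      (fun z : {z : SpinDecHorosphere M × SpinFrame M // z.2 ∈ z.1.Wout} => z.1.2) inferInstance)

variable {M}

/-- The projection from spin-decorated to decorated horospheres: the oriented line field directed by
the unit parallel vector field of the spin decoration. -/
def SpinDecHorosphere.toDec (x : SpinDecHorosphere M) : DecData E where
  hor := x.hor
  line := {z | ∃ s ∈ x.Wout, ∃ c : ℝ, 0 < c ∧ z = (s.pt, c • s.vec 1)}

/-- `s' = A · s`: the action of `SL(2, ℂ)` on spin frames, which lifts the action of isometries and
their derivatives on frames. A path in `SL(2, ℂ)` from `1` to `A` moves the frame of `s`, and `A · s`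
is the end of the lift of this path of frames to a path of spin frames that starts at `s`. -/
def SpinAct (A : SL2C) (s s' : SpinFrame M) : Prop :=
  ∃ (γ : Path (1 : SL2C) A) (σ : Path s s'), ∀ t,
    (σ t).pt = M.act (γ t) s.pt ∧ ∀ j, (σ t).vec j = fderiv ℝ (M.act (γ t)) s.pt (s.vec j)

/-- `y = A · x`: the action of `SL(2, ℂ)` on spin-decorated horospheres. -/
def HoroAct (A : SL2C) (x y : SpinDecHorosphere M) : Prop :=
  y.hor = M.act A '' x.hor ∧ y.Win = {s' | ∃ s ∈ x.Win, SpinAct A s s'} ∧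
    y.Wout = {s' | ∃ s ∈ x.Wout, SpinAct A s s'}

end Spin

/-! ### Lifts to the spin spaces -/

/-- `Ft, Gt, Ht, It, Jt` are continuous lifts of the maps `F, G, H, I, J` to the double covers. -/
structure AreSpinLifts (Ft : nonzeroSpinors → HermSpinFlag) (Gt : HermSpinFlag → MinkSpinFlag)
    (Ht : MinkSpinFlag → SpinDecHorosphere hyperboloid)
    (It : SpinDecHorosphere hyperboloid → SpinDecHorosphere disc)
    (Jt : SpinDecHorosphere disc → SpinDecHorosphere upper) : Prop where
  contF : Continuous Ft
  contG : Continuous Gt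
  contH : Continuous Ht
  contI : Continuous It
  contJ : Continuous Jt
  liftF : ∀ κ, (Ft κ).flag = FMap κ
  liftG : ∀ x, (Gt x).flag = GMap x.flag
  liftH : ∀ x, (Ht x).toDec = HMap x.flag
  liftI : ∀ x, (It x).toDec = IMap x.toDec
  liftJ : ∀ x, (Jt x).toDec = JMap x.toDec

/-! ### The smooth structure on spin-decorated horospheres -/

/-- Decorated horospheres are identified with `UT S² × ℝ`: `(n, e, s)` with `|n| = |e| = 1`,
`e ⊥ n` and `-1 < s < 1` are the coordinates of the decorated horosphere of `𝕌` which corresponds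
under `J` to the horosphere in `𝔻` with centre `n ∈ S² = ∂𝔻` through the point `s n`, with the
decoration that points in the direction `e` at `s n` (the tangent plane there is
`n^⊥ = T_n S²`). -/
def IsCoord (y : DecData (ℂ × ℝ)) (a : R3 × R3 × ℝ) : Prop :=
  a.1 ⬝ᵥ a.1 = 1 ∧ a.2.1 ⬝ᵥ a.2.1 = 1 ∧ -1 < a.2.2 ∧ a.2.2 < 1 ∧
  ∃ d : DecData R3, IsDecorated disc d ∧ JMap d = y ∧
    d.hor = disc.horosphere (discHoroFun a.1 a.2.2) ∧ (a.2.2 • a.1, a.2.1) ∈ d.line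

/-- A charted space structure on the (topological) space of spin-decorated horospheres in `𝕌` is
the smooth structure of this space if it is a smooth 4-manifold structure for which the projection
to decorated horospheres, identified with the 4-dimensional submanifold `UT S² × (-1, 1)` of
`ℝ³ × ℝ³ × ℝ`, is smooth with injective differentials (thus a local diffeomorphism). There is
exactly one such maximal atlas, as the projection is a covering map. -/
def IsSmoothStructure [ChartedSpace (EuclideanSpace ℝ (Fin 4)) (SpinDecHorosphere upper)] : Prop :=
  IsManifold 𝓘(ℝ, EuclideanSpace ℝ (Fin 4)) ∞ (SpinDecHorosphere upper) ∧
  ∃ Θ : SpinDecHorosphere upper → R3 × R3 × ℝ, (∀ x, IsCoord x.toDec (Θ x)) ∧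
    ContMDiff 𝓘(ℝ, EuclideanSpace ℝ (Fin 4)) 𝓘(ℝ, R3 × R3 × ℝ) ∞ Θ ∧
    ∀ x, Function.Injective
      (mfderiv 𝓘(ℝ, EuclideanSpace ℝ (Fin 4)) 𝓘(ℝ, R3 × R3 × ℝ) Θ x)

/-! ### The explicit description -/

/-- `d` is the decorated horosphere of `𝕌` described by the spinor `(ξ, η)`. If `η ≠ 0`, it is the
sphere tangent to `ℂ` at `ξ/η` with Euclidean diameter `|η|⁻²`, with decoration directed by
`i η⁻²` at its north pole. If `η = 0`, it is the horizontal plane (centred at `∞`) at height `|ξ|²`,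
with decoration directed by `i ξ²` at each point. -/
def IsDescribedBy (ξ η : ℂ) (d : DecData (ℂ × ℝ)) : Prop :=
  IsDecorated upper d ∧
  (η ≠ 0 → d.hor = upper.horosphere (upperSphereFun (ξ / η) (‖η‖ ^ 2)⁻¹) ∧
    ((ξ / η, (‖η‖ ^ 2)⁻¹), (Complex.I * (η ^ 2)⁻¹, (0 : ℝ))) ∈ d.line) ∧
  (η = 0 → d.hor = upper.horosphere (upperPlaneFun (‖ξ‖ ^ 2)) ∧
    ∀ z : ℂ, ((z, ‖ξ‖ ^ 2), (Complex.I * ξ ^ 2, (0 : ℝ))) ∈ d.line)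

end SpinorHoro

end

open SpinorHoro

noncomputable section

namespace SpinorHoro

/-! ### Spinors and the special linear group -/

/-! Write κ₀ for `baseSpinor` = (1, 1)/√2. Then f(κ₀) = (1 + σ_X)/2 and the flag of κ₀ is directed
by σ_Y, so the first two vectors of the standard frame at the origin are the outward normal and the
decoration belonging to κ₀. The group `SL2C` acts simply transitively on spin frames of hyperbolic
space: `B` corresponds to the image under `B` of the standard frame, and ±`B` are the two spin lifts
of one frame.

The stabiliser of κ₀ is the unipotent group `unip`, isomorphic to ℂ. Hence the set `fibre κ` = {B :
B κ₀ = κ} is one of its cosets, and its frames sweep out the horosphere of κ once, forming an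
outward spin decoration. Conversely, an outward spin decoration is a continuous field of frames
which, by invariance under parabolics, agrees up to sign with such a coset; the sign is constant
because a horosphere is connected (`exists_eq_of_isOutward`). Spin-decorated horospheres are
therefore the points of SL(2, ℂ)/ℂ, which is the space of nonzero spinors, topologically
(`spinDecHomeo`) and equivariantly, as the action is left multiplication (`horoAct_spinDec`).

All of this uses only the abstract data of a `Framing`. Each of the three models obtains one from a
`ModelChart`, an isometry with the hyperboloid. There ⟨B·o, f(κ)⟩ = |B⁻¹κ|², where o = (1, 0, 0, 0),
so the horosphere of κ is |B⁻¹κ| = 1.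

The standard map `spinDec` projects to `KMap` (`toDec_upper`), and a decorated horosphere determines
its spinor up to sign (`eq_or_eq_neg_of_toDec`). The space of nonzero spinors is connected, so a
composite of arbitrary continuous lifts is `spinDec` or `spinDec` after κ ↦ -κ (`eq_spinDec_comp`);
negation is a diffeomorphism commuting with SL(2, ℂ). Existence of lifts comes from polar
coordinates: a spin flag is a positive scale with an element of SU(2), hence a spinor.

For smoothness, the coordinates of the decorated horosphere of κ form an explicit immersion
`spinorCoord`. Both this immersion and the projection of the given smooth structure have smooth
local left inverses, which makes the homeomorphism smooth in both directions. The explicit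
description results from moving the frame at (0, 1) by upper triangular matrices
(`isDescribedBy_spinDec`). -/

/-- The square root of one half. -/
def sqrtHalf : ℝ := Real.sqrt (1 / 2)

lemma sqrtHalf_mul_self : sqrtHalf * sqrtHalf = 1 / 2 :=
  Real.mul_self_sqrt (by norm_num)

lemma sqrtHalf_ne_zero : sqrtHalf ≠ 0 := by
  intro h
  have := sqrtHalf_mul_self
  rw [h] at this
  norm_num at this

/-- The unit spinor `(1, 1) / √2`, whose flag is the standard frame at the origin. -/
def baseSpinor : Fin 2 → ℂ := ![(sqrtHalf : ℂ), (sqrtHalf : ℂ)]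

/-- The squared norm of a spinor. -/
def spinorNormSq (κ : Fin 2 → ℂ) : ℝ := Complex.normSq (κ 0) + Complex.normSq (κ 1)

lemma spinorNormSq_pos {κ : Fin 2 → ℂ} (h : κ ≠ 0) : 0 < spinorNormSq κ := by
  by_contra hn
  apply h
  have h0 := Complex.normSq_nonneg (κ 0)
  have h1 := Complex.normSq_nonneg (κ 1)
  unfold spinorNormSq at hn
  have e0 : Complex.normSq (κ 0) = 0 := by linarith
  have e1 : Complex.normSq (κ 1) = 0 := by linarith
  ext i
  fin_cases i
  · simpa using e0
  · simpa using e1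

lemma ne_zero_of_spinorNormSq {κ : Fin 2 → ℂ} (h : spinorNormSq κ ≠ 0) : κ ≠ 0 := by
  rintro rfl
  simp [spinorNormSq] at h

lemma baseSpinor_normSq : spinorNormSq baseSpinor = 1 := by
  simp [spinorNormSq, baseSpinor, sqrtHalf_mul_self]
  norm_num

lemma baseSpinor_ne_zero : baseSpinor ≠ 0 :=
  ne_zero_of_spinorNormSq (by rw [baseSpinor_normSq]; norm_num)

/-- The matrix of determinant one which takes `baseSpinor` to `κ` and preserves the orthogonality
of the standard basis adapted to `baseSpinor`. -/
def slMat (κ : Fin 2 → ℂ) : Mat :=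
  (sqrtHalf : ℂ) • !![κ 0 + star (κ 1) / (spinorNormSq κ : ℂ), κ 0 - star (κ 1) / (spinorNormSq κ : ℂ);
    κ 1 - star (κ 0) / (spinorNormSq κ : ℂ), κ 1 + star (κ 0) / (spinorNormSq κ : ℂ)]

lemma sqrtHalf_mul_self_complex : (sqrtHalf : ℂ) * sqrtHalf = 1 / 2 := by
  rw [← Complex.ofReal_mul, sqrtHalf_mul_self]; norm_num

lemma spinorNormSq_complex (κ : Fin 2 → ℂ) :
    (spinorNormSq κ : ℂ) = κ 0 * star (κ 0) + κ 1 * star (κ 1) := by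
  simp [spinorNormSq, Complex.mul_conj]

lemma det_slMat {κ : Fin 2 → ℂ} (h : κ ≠ 0) : (slMat κ).det = 1 := by
  have hN : (spinorNormSq κ : ℂ) ≠ 0 := by exact_mod_cast (spinorNormSq_pos h).ne'
  have h2 := sqrtHalf_mul_self_complex
  have hs := spinorNormSq_complex κ
  rw [Matrix.det_fin_two]
  simp only [slMat, Matrix.smul_apply, smul_eq_mul, Matrix.of_apply, Matrix.cons_val', Matrix.cons_val_zero,
    Matrix.cons_val_one, Matrix.cons_val_fin_one]
  field_simp
  linear_combination (2 * spinorNormSq κ) * (κ 0 * star (κ 0) + κ 1 * star (κ 1)) * h2 - spinorNormSq κ * hs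

lemma slMat_mulVec (κ : Fin 2 → ℂ) : slMat κ *ᵥ baseSpinor = κ := by
  have h2 := sqrtHalf_mul_self_complex
  ext i
  fin_cases i <;>
  simp [slMat, baseSpinor, Matrix.mulVec, dotProduct, Fin.sum_univ_two]
  · linear_combination 2 * κ 0 * h2
  · linear_combination 2 * κ 1 * h2

/-- The orthonormal basis (1, 1)/√2, (1, -1)/√2 goes to κ and (κ̄₁, -κ̄₀)/|κ|², which is again
orthonormal when |κ| = 1. -/
lemma slMat_mem_unitary {κ : Fin 2 → ℂ} (h : spinorNormSq κ = 1) :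
    slMat κ ∈ Matrix.specialUnitaryGroup (Fin 2) ℂ := by
  rw [Matrix.mem_specialUnitaryGroup_iff, Matrix.mem_unitaryGroup_iff]
  refine ⟨?_, det_slMat (ne_zero_of_spinorNormSq (by rw [h]; norm_num))⟩
  have h2 := sqrtHalf_mul_self_complex
  have hs := spinorNormSq_complex κ
  rw [h] at hs
  ext i j
  fin_cases i <;> fin_cases j <;>
  simp [slMat, h, Matrix.mul_apply, Fin.sum_univ_two, Matrix.star_apply] <;>
  simp only [← starRingEnd_apply, Complex.ofReal_one] at hs ⊢
  · linear_combination 2 * ((κ 0) * (starRingEnd ℂ) (κ 0) + (κ 1) * (starRingEnd ℂ) (κ 1)) * h2 - hs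
  · ring
  · ring
  · linear_combination 2 * ((κ 0) * (starRingEnd ℂ) (κ 0) + (κ 1) * (starRingEnd ℂ) (κ 1)) * h2 - hs

/-- The section `slMat` of `B ↦ B baseSpinor`, as a map to `SL(2, ℂ)`. -/
def slOf (κ : nonzeroSpinors) : SL2C := ⟨slMat κ, det_slMat κ.2⟩

/-- The inclusion of `SU(2)` in `SL(2, ℂ)`. -/
def toSL : SU2 →* SL2C where
  toFun u := ⟨u, (Matrix.mem_specialUnitaryGroup_iff.1 u.2).2⟩
  map_one' := rfl
  map_mul' _ _ := rfl

@[simp] lemma coe_toSL (u : SU2) : ((toSL u : SL2C) : Mat) = (u : Mat) := rfl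

lemma toSL_injective : Function.Injective toSL := fun u v h => by
  apply Subtype.ext
  exact congrArg (fun B : SL2C => (B : Mat)) h

lemma continuous_toSL : Continuous toSL :=
  continuous_induced_rng.2 continuous_subtype_val

/-- Matrix-vector multiplication for `SL(2, ℂ)`. -/
def mv (B : SL2C) (κ : Fin 2 → ℂ) : Fin 2 → ℂ := (B : Mat) *ᵥ κ

@[simp] lemma mv_one (κ : Fin 2 → ℂ) : mv 1 κ = κ := by simp [mv]

lemma mv_mul (A B : SL2C) (κ : Fin 2 → ℂ) : mv (A * B) κ = mv A (mv B κ) := by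
  rw [mv, Matrix.SpecialLinearGroup.coe_mul, ← Matrix.mulVec_mulVec]; rfl

@[simp] lemma mv_inv_mv (A : SL2C) (κ : Fin 2 → ℂ) : mv A⁻¹ (mv A κ) = κ := by
  rw [← mv_mul]; simp

@[simp] lemma mv_mv_inv (A : SL2C) (κ : Fin 2 → ℂ) : mv A (mv A⁻¹ κ) = κ := by
  rw [← mv_mul]; simp

lemma mv_smul (A : SL2C) (c : ℂ) (κ : Fin 2 → ℂ) : mv A (c • κ) = c • mv A κ := by
  simp [mv, Matrix.mulVec_smul]

lemma mv_slOf (κ : nonzeroSpinors) : mv (slOf κ) baseSpinor = κ := slMat_mulVec κ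

lemma mv_ne_zero (A : SL2C) {κ : Fin 2 → ℂ} (h : κ ≠ 0) : mv A κ ≠ 0 := by
  intro h0
  apply h
  rw [← mv_inv_mv A κ, h0]
  simp [mv]

lemma continuous_mv {X : Type*} [TopologicalSpace X] {f : X → SL2C} {k : X → Fin 2 → ℂ}
    (hf : Continuous f) (hk : Continuous k) : Continuous fun x => mv (f x) (k x) := by
  unfold mv
  exact (continuous_subtype_val.comp hf).matrix_mulVec hk

lemma continuous_slOf : Continuous slOf := by
  refine continuous_induced_rng.2 ?_
  have hN : ∀ κ : nonzeroSpinors, (spinorNormSq κ : ℂ) ≠ 0 := fun κ => by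
    exact_mod_cast (spinorNormSq_pos κ.2).ne'
  have h0 : Continuous fun κ : nonzeroSpinors => (κ : Fin 2 → ℂ) 0 :=
    (continuous_apply 0).comp continuous_subtype_val
  have h1 : Continuous fun κ : nonzeroSpinors => (κ : Fin 2 → ℂ) 1 :=
    (continuous_apply 1).comp continuous_subtype_val
  have hc : Continuous fun κ : nonzeroSpinors => (spinorNormSq κ : ℂ) :=
    Complex.continuous_ofReal.comp
      ((Complex.continuous_normSq.comp h0).add (Complex.continuous_normSq.comp h1))
  have d0 : Continuous fun κ : nonzeroSpinors => star ((κ : Fin 2 → ℂ) 0) / (spinorNormSq κ : ℂ) :=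
    h0.star.div hc hN
  have d1 : Continuous fun κ : nonzeroSpinors => star ((κ : Fin 2 → ℂ) 1) / (spinorNormSq κ : ℂ) :=
    h1.star.div hc hN
  refine continuous_matrix fun i j => ?_
  fin_cases i <;> fin_cases j <;>
  simp only [slMat, slOf, Function.comp, Matrix.smul_apply, Matrix.of_apply, Matrix.cons_val',
    Matrix.cons_val_zero, Matrix.cons_val_one, Matrix.cons_val_fin_one, Fin.mk_one, Fin.zero_eta,
    Fin.isValue]
  · exact (continuous_const (y := (sqrtHalf : ℂ))).mul (h0.add d1)
  · exact (continuous_const (y := (sqrtHalf : ℂ))).mul (h0.sub d1)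
  · exact (continuous_const (y := (sqrtHalf : ℂ))).mul (h1.sub d0)
  · exact (continuous_const (y := (sqrtHalf : ℂ))).mul (h1.add d0)

/-- The unipotent matrices which fix `baseSpinor`. -/
def unip (c : ℂ) : SL2C := ⟨!![1 + c, -c; c, 1 - c], by rw [Matrix.det_fin_two_of]; ring⟩

lemma mv_unip (c : ℂ) : mv (unip c) baseSpinor = baseSpinor := by
  ext i
  fin_cases i <;> simp [mv, unip, baseSpinor, Matrix.mulVec, dotProduct, Fin.sum_univ_two] <;> ring

/-- Fixing (1, 1) means that both row sums are 1; determinant one then leaves the lower left entry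
as the only parameter. -/
lemma exists_unip {B : SL2C} (h : mv B baseSpinor = baseSpinor) : ∃ c, B = unip c := by
  have hr : (sqrtHalf : ℂ) ≠ 0 := by exact_mod_cast sqrtHalf_ne_zero
  have h0 := congrFun h 0
  have h1 := congrFun h 1
  simp [mv, baseSpinor, Matrix.mulVec, dotProduct, Fin.sum_univ_two, ← add_mul, hr] at h0 h1
  have hd := B.2
  rw [Matrix.det_fin_two] at hd
  refine ⟨(B : Mat) 1 0, Subtype.ext ?_⟩
  ext i j
  fin_cases i <;> fin_cases j <;> simp [unip]
  · linear_combination hd - (B : Mat) 0 0 * h1 + (B : Mat) 1 0 * h0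
  · linear_combination h0 - hd + (B : Mat) 0 0 * h1 - (B : Mat) 1 0 * h0
  · linear_combination h1

lemma continuous_unip : Continuous unip := by
  refine continuous_induced_rng.2 (continuous_matrix fun i j => ?_)
  fin_cases i <;> fin_cases j <;> simp [unip] <;> fun_prop

lemma isPathConnected_nonzeroSpinors : IsPathConnected ({0}ᶜ : Set (Fin 2 → ℂ)) := by
  apply isPathConnected_compl_singleton_of_one_lt_rank
  rw [← Module.finrank_eq_rank]
  have : Module.finrank ℝ (Fin 2 → ℂ) = 4 := by
    rw [Module.finrank_pi_fintype]; simp [Complex.finrank_real_complex]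
  rw [this]
  norm_num

instance : PathConnectedSpace nonzeroSpinors :=
  isPathConnected_iff_pathConnectedSpace.1 isPathConnected_nonzeroSpinors

/-- The section `slOf` trivialises the bundle B ↦ B κ₀ with fibre ℂ, so SL(2, ℂ) is the image of the
path connected product of the nonzero spinors and ℂ. -/
instance : PathConnectedSpace SL2C := by
  refine Function.Surjective.pathConnectedSpace
    (f := fun x : nonzeroSpinors × ℂ => slOf x.1 * unip x.2) ?_ ?_
  · intro B
    let κ : nonzeroSpinors := ⟨mv B baseSpinor, mv_ne_zero B baseSpinor_ne_zero⟩
    obtain ⟨c, hc⟩ : ∃ c, (slOf κ)⁻¹ * B = unip c := by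
      apply exists_unip
      rw [mv_mul]
      change mv (slOf κ)⁻¹ (κ : Fin 2 → ℂ) = _
      rw [← mv_slOf κ, mv_inv_mv]
    exact ⟨(κ, c), by simp [← hc]⟩
  · exact (continuous_slOf.comp continuous_fst).mul (continuous_unip.comp continuous_snd)

/-- The special unitary matrix which takes `baseSpinor` to a given unit spinor. -/
def suOf (ν : Fin 2 → ℂ) (h : spinorNormSq ν = 1) : SU2 := ⟨slMat ν, slMat_mem_unitary h⟩

lemma mv_suOf {ν : Fin 2 → ℂ} (h : spinorNormSq ν = 1) : mv (toSL (suOf ν h)) baseSpinor = ν :=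
  slMat_mulVec ν

/-! ### `SU(2)` and rotations -/

lemma SU2.mul_conjTranspose (u : SU2) : (u : Mat) * (u : Mat)ᴴ = 1 :=
  Matrix.mem_unitaryGroup_iff.1 (Matrix.mem_specialUnitaryGroup_iff.1 u.2).1

lemma SU2.conjTranspose_mul (u : SU2) : (u : Mat)ᴴ * (u : Mat) = 1 :=
  Matrix.mem_unitaryGroup_iff'.1 (Matrix.mem_specialUnitaryGroup_iff.1 u.2).1

/-- For determinant one the inverse is the adjugate, and for a unitary matrix it is the adjoint;
comparing the two gives unit quaternion coordinates. -/
lemma SU2.exists_param (u : SU2) : ∃ a b c d : ℝ, a ^ 2 + b ^ 2 + c ^ 2 + d ^ 2 = 1 ∧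
    (u : Mat) = !![⟨a, b⟩, ⟨-c, d⟩; ⟨c, d⟩, ⟨a, -b⟩] := by
  have hd := (Matrix.mem_specialUnitaryGroup_iff.1 u.2).2
  have hinv : (u : Mat)ᴴ = (u : Mat).adjugate := by
    have h1 := Matrix.mul_adjugate (u : Mat)
    rw [hd, one_smul] at h1
    calc (u : Mat)ᴴ = (u : Mat)ᴴ * ((u : Mat) * (u : Mat).adjugate) := by rw [h1, mul_one]
      _ = _ := by rw [← mul_assoc, SU2.conjTranspose_mul, one_mul]
  rw [Matrix.adjugate_fin_two] at hinv
  have h00 := congrFun (congrFun hinv 0) 0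
  have h01 := congrFun (congrFun hinv 0) 1
  simp [Matrix.conjTranspose_apply, Complex.ext_iff] at h00 h01
  have hdr := congrArg Complex.re hd
  rw [Matrix.det_fin_two] at hdr
  simp at hdr
  refine ⟨((u : Mat) 0 0).re, ((u : Mat) 0 0).im, ((u : Mat) 1 0).re, ((u : Mat) 1 0).im, ?_, ?_⟩
  · rw [← h00.1, ← h00.2] at hdr
    have e1 : ((u : Mat) 0 1).re = -((u : Mat) 1 0).re := by linarith [h01.1]
    have e2 : ((u : Mat) 0 1).im = ((u : Mat) 1 0).im := by linarith [h01.2]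
    rw [e1, e2] at hdr
    linarith
  · ext i j
    fin_cases i <;> fin_cases j <;> apply Complex.ext <;> simp
    · linarith [h01.1]
    · linarith [h01.2]
    · linarith [h00.1]
    · linarith [h00.2]

/-- The rotation matrix of an element of `SU(2)` in the basis of Pauli matrices. -/
def rot (u : SU2) (i j : Fin 3) : ℝ := (pauli i * ((u : Mat) * pauli j * (u : Mat)ᴴ)).trace.re / 2

lemma pauli_isHermitian (j : Fin 3) : (pauli j).IsHermitian := by
  ext k l
  fin_cases j <;> fin_cases k <;> fin_cases l <;> simp [pauli]

lemma pauli_trace (j : Fin 3) : (pauli j).trace = 0 := by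
  fin_cases j <;> simp [pauli, Matrix.trace_fin_two]

/-- The Pauli matrices span the Hermitian matrices of trace zero. -/
lemma eq_sum_pauli {S : Mat} (hS : S.IsHermitian) (ht : S.trace = 0) :
    S = ∑ i, ((pauli i * S).trace.re / 2) • pauli i := by
  have h00 := congrFun (congrFun hS 0) 0
  have h01 := congrFun (congrFun hS 0) 1
  have h11 := congrFun (congrFun hS 1) 1
  rw [Matrix.trace_fin_two] at ht
  simp only [Matrix.conjTranspose_apply, Complex.star_def, Complex.ext_iff, Complex.conj_re,
    Complex.conj_im, Complex.add_re, Complex.add_im, Complex.zero_re, Complex.zero_im] at h00 h01 h11 ht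
  ext k l
  fin_cases k <;> fin_cases l <;> apply Complex.ext <;>
    simp [pauli, Fin.sum_univ_three, Matrix.trace_fin_two, Matrix.mul_apply] <;>
    linarith

lemma conj_pauli (u : SU2) (j : Fin 3) :
    (u : Mat) * pauli j * (u : Mat)ᴴ = ∑ i, rot u i j • pauli i := by
  apply eq_sum_pauli
  · exact Matrix.isHermitian_mul_mul_conjTranspose _ (pauli_isHermitian j)
  · rw [Matrix.trace_mul_comm, ← mul_assoc, SU2.conjTranspose_mul, one_mul, pauli_trace]

/-- The entries are quadratic forms in the quaternion coordinates, and each sum is identically 0 or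
the square of the quaternion norm. -/
lemma rot_orthonormal (u : SU2) (i j : Fin 3) :
    ∑ k, rot u k i * rot u k j = if i = j then 1 else 0 := by
  obtain ⟨a, b, c, d, h, hu⟩ := SU2.exists_param u
  simp only [rot, hu, Fin.sum_univ_three]
  fin_cases i <;> fin_cases j <;>
    simp [pauli, Fin.sum_univ_two, Matrix.trace, Matrix.vecMul, dotProduct] <;>
    first
    | ring1
    | linear_combination (a ^ 2 + b ^ 2 + c ^ 2 + d ^ 2 + 1) * h

/-- As a polynomial in the quaternion coordinates the determinant is the cube of the quaternion
norm. -/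
lemma det_rot (u : SU2) : (Matrix.of fun i j => rot u i j).det = 1 := by
  obtain ⟨a, b, c, d, h, hu⟩ := SU2.exists_param u
  simp only [rot, hu, Matrix.det_fin_three, Matrix.of_apply]
  simp [pauli, Fin.sum_univ_two, Matrix.trace, Matrix.vecMul, dotProduct]
  linear_combination ((a ^ 2 + b ^ 2 + c ^ 2 + d ^ 2) ^ 2 + (a ^ 2 + b ^ 2 + c ^ 2 + d ^ 2) + 1) * h

lemma pauli_linearIndependent {x y : Fin 3 → ℝ} (h : ∑ i, x i • pauli i = ∑ i, y i • pauli i) :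
    x = y := by
  have h00 := congrFun (congrFun h 0) 0
  have h01 := congrFun (congrFun h 0) 1
  simp [Fin.sum_univ_three, pauli, Complex.ext_iff] at h00 h01
  ext i
  fin_cases i
  · exact h01.1
  · exact h01.2
  · exact h00

lemma rot_eq_iff (u : SU2) (j : Fin 3) (x : Fin 3 → ℝ) :
    (∀ i, rot u i j = x i) ↔ (u : Mat) * pauli j * (u : Mat)ᴴ = ∑ i, x i • pauli i := by
  rw [conj_pauli]
  constructor
  · intro h
    simp only [h]
  · intro h i
    exact congrFun (pauli_linearIndependent (x := fun i => rot u i j) h) i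

/-- An element of `SU(2)` with eigenvector `baseSpinor` which fixes the second axis is `±1`. -/
lemma SU2.eq_one_or_eq_neg_one {u : SU2} {c : ℂ} (h0 : mv (toSL u) baseSpinor = c • baseSpinor)
    (h1 : (u : Mat) * pauli 1 * (u : Mat)ᴴ = pauli 1) : (u : Mat) = 1 ∨ (u : Mat) = -1 := by
  have hr : (sqrtHalf : ℂ) ≠ 0 := by exact_mod_cast sqrtHalf_ne_zero
  have h2 : (u : Mat) * pauli 1 = pauli 1 * (u : Mat) := by
    conv_rhs => rw [← h1]
    rw [mul_assoc, SU2.conjTranspose_mul, mul_one]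
  obtain ⟨a, b, e, d, h, hu⟩ := SU2.exists_param u
  have e0 := congrFun h0 0
  have e1 := congrFun h0 1
  have e2 := congrFun (congrFun h2 0) 0
  simp [mv, baseSpinor, Matrix.mulVec, dotProduct, Fin.sum_univ_two, ← add_mul, hr, hu] at e0 e1
  rw [← e1] at e0
  simp [hu, pauli, Matrix.mul_apply, Fin.sum_univ_two, Complex.ext_iff] at e2
  simp [Complex.ext_iff] at e0
  have hb : b = 0 := by linarith [e0.2]
  have he : e = 0 := by linarith [e0.1]
  have hd : d = 0 := by linarith [e2]
  subst hb he hd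
  have ha : (a - 1) * (a + 1) = 0 := by linarith
  rcases mul_eq_zero.1 ha with h | h
  · left
    rw [hu]
    ext i j
    fin_cases i <;> fin_cases j <;> apply Complex.ext <;> simp <;> linarith
  · right
    rw [hu]
    ext i j
    fin_cases i <;> fin_cases j <;> apply Complex.ext <;> simp <;> linarith

/-- A matrix commuting with σ_X preserves its eigenspace for the eigenvalue 1, which is the line of
κ₀. -/
lemma SU2.exists_smul_baseSpinor {u : SU2} (h : (u : Mat) * pauli 0 * (u : Mat)ᴴ = pauli 0) :
    ∃ c : ℂ, mv (toSL u) baseSpinor = c • baseSpinor := by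
  have h2 : (u : Mat) * pauli 0 = pauli 0 * (u : Mat) := by
    conv_rhs => rw [← h]
    rw [mul_assoc, SU2.conjTranspose_mul, mul_one]
  have h00 := congrFun (congrFun h2 0) 0
  have h01 := congrFun (congrFun h2 0) 1
  simp [pauli, Matrix.mul_apply, Fin.sum_univ_two] at h00 h01
  refine ⟨(u : Mat) 0 0 + (u : Mat) 0 1, ?_⟩
  ext i
  fin_cases i <;> simp [mv, baseSpinor, Matrix.mulVec, dotProduct, Fin.sum_univ_two]
  · ring
  · rw [h00, h01]; ring

/-! ### Framings of models by `SL(2, ℂ)` -/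

/-- The coordinates `ν^* σ_j ν` of the direction of a spinor. -/
def spinorDir (ν : Fin 2 → ℂ) (j : Fin 3) : ℝ := (star ν ⬝ᵥ (pauli j *ᵥ ν)).re

lemma spinorDir_baseSpinor (j : Fin 3) : spinorDir baseSpinor j = if j = 0 then 1 else 0 := by
  have := sqrtHalf_mul_self
  fin_cases j <;> simp [spinorDir, baseSpinor, pauli, dotProduct, Fin.sum_univ_two, Matrix.mulVec]
  linarith

/-- `κ` represents the function `β` cutting out a horosphere, with respect to the points `pt B` and
the frames `vec B`, `B ∈ SL(2, ℂ)`. -/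
def HoroRep {E : Type} [NormedAddCommGroup E] [NormedSpace ℝ E] (pt : SL2C → E)
    (vec : SL2C → Fin 3 → E) (β : E → ℝ) (κ : Fin 2 → ℂ) : Prop :=
  ∀ B, (β (pt B) = 0 ↔ spinorNormSq (mv B⁻¹ κ) = 1) ∧
    (β (pt B) = 0 → ∃ k : ℝ, 0 < k ∧ ∀ j, fderiv ℝ β (pt B) (vec B j) = -k * spinorDir (mv B⁻¹ κ) j)

/-- An identification of the spin frames of a model with `SL(2, ℂ)`: `B ∈ SL(2, ℂ)` corresponds to
the frame `vec B` at `pt B`, and `sec q` to the frame of the global frame field at `q`. -/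
structure Framing {E : Type} [NormedAddCommGroup E] [NormedSpace ℝ E] (M : HypModel E) where
  /-- the base point of a frame -/
  pt : SL2C → E
  /-- the vectors of a frame -/
  vec : SL2C → Fin 3 → E
  /-- the element of `SL(2, ℂ)` which gives the global frame field -/
  sec : E → SL2C
  pt_mem : ∀ B, pt B ∈ M.carrier
  pt_sec : ∀ q ∈ M.carrier, pt (sec q) = q
  vec_sec : ∀ q ∈ M.carrier, vec (sec q) = M.std q
  exists_su : ∀ B C, pt B = pt C → ∃ u : SU2, C = B * toSL u
  pt_mul : ∀ B (u : SU2), pt (B * toSL u) = pt B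
  vec_mul : ∀ B (u : SU2) j, vec (B * toSL u) j = ∑ i, rot u i j • vec B i
  continuous_pt : Continuous pt
  continuous_vec : Continuous vec
  continuousOn_sec : ContinuousOn sec M.carrier
  metric_std : ∀ q ∈ M.carrier, ∀ x y : Fin 3 → ℝ,
    M.metric q (∑ i, x i • M.std q i) (∑ i, y i • M.std q i) = ∑ i, x i * y i
  mem_tangent : ∀ q ∈ M.carrier, ∀ v, v ∈ M.tangent q ↔ ∃ x : Fin 3 → ℝ, v = ∑ i, x i • M.std q i
  act_pt : ∀ A B, M.act A (pt B) = pt (A * B)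
  fderiv_act : ∀ A B j, fderiv ℝ (M.act A) (pt B) (vec B j) = vec (A * B) j
  horo_exists : ∀ β ∈ M.horoFun, ∃ κ : Fin 2 → ℂ, κ ≠ 0 ∧ HoroRep pt vec β κ
  horo_of : ∀ κ : Fin 2 → ℂ, κ ≠ 0 → ∃ β ∈ M.horoFun, HoroRep pt vec β κ

/-! ### Half turns and the centre of SU(2) -/

lemma spinRot_mem (θ : ℝ) : spinRot θ ∈ Matrix.specialUnitaryGroup (Fin 2) ℂ := by
  have h : (Real.sin (θ / 2) : ℂ) ^ 2 + (Real.cos (θ / 2) : ℂ) ^ 2 = 1 := by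
    exact_mod_cast Real.sin_sq_add_cos_sq (θ / 2)
  rw [Matrix.mem_specialUnitaryGroup_iff, Matrix.mem_unitaryGroup_iff, spinRot]
  generalize Real.sin (θ / 2) = s at *
  generalize Real.cos (θ / 2) = c at *
  constructor
  · ext i j
    fin_cases i <;> fin_cases j <;>
      simp [Matrix.mul_apply, Fin.sum_univ_two, Matrix.star_apply] <;>
      first | ring1 | linear_combination h
  · rw [Matrix.det_fin_two_of]
    linear_combination h

/-- The rotation `spinRot` as an element of `SU(2)`. -/
def suRot (θ : ℝ) : SU2 := ⟨spinRot θ, spinRot_mem θ⟩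

lemma suRot_pi_conj (j : Fin 3) : ((suRot Real.pi : SU2) : Mat) * pauli j * ((suRot Real.pi : SU2) : Mat)ᴴ =
    ∑ i, (if i = j then (if j = 1 then (1 : ℝ) else -1) else 0) • pauli i := by
  ext k l
  fin_cases j <;> fin_cases k <;> fin_cases l <;>
    simp [suRot, spinRot, pauli, Matrix.mul_apply, Fin.sum_univ_two]

/-- The half turn about the second axis negates the first and third vectors. This is what exchanges
outward and inward frames with the same decoration. -/
lemma rot_suRot_pi (i j : Fin 3) :
    rot (suRot Real.pi) i j = if i = j then (if j = 1 then (1 : ℝ) else -1) else 0 :=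
  (rot_eq_iff _ j (fun i => if i = j then (if j = 1 then (1 : ℝ) else -1) else 0)).2
    (suRot_pi_conj j) i

/-- The nontrivial central element of `SU(2)`. -/
def negOne : SU2 := ⟨-1, by
  rw [Matrix.mem_specialUnitaryGroup_iff, Matrix.mem_unitaryGroup_iff]
  constructor
  · simp
  · simp [Matrix.det_neg]⟩

lemma rot_negOne (i j : Fin 3) : rot negOne i j = if i = j then 1 else 0 := by
  refine (rot_eq_iff negOne j (fun i => if i = j then 1 else 0)).2 ?_ i
  simp [negOne]

lemma mv_negOne (κ : Fin 2 → ℂ) : mv (toSL negOne) κ = -κ := by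
  simp [mv, negOne, Matrix.neg_mulVec]

/-- SU(2) acts freely on unit spinors; this makes a frame adapted to κ unique over each point of its
horosphere. -/
lemma SU2.eq_one_of_mv {u : SU2} (h0 : mv (toSL u) baseSpinor = baseSpinor) : u = 1 := by
  have hr : (sqrtHalf : ℂ) ≠ 0 := by exact_mod_cast sqrtHalf_ne_zero
  obtain ⟨a, b, e, d, h, hu⟩ := SU2.exists_param u
  have e0 := congrFun h0 0
  have e1 := congrFun h0 1
  simp [mv, baseSpinor, Matrix.mulVec, dotProduct, Fin.sum_univ_two, ← add_mul, hr, hu] at e0 e1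
  simp [Complex.ext_iff] at e0 e1
  apply Subtype.ext
  rw [hu]
  ext i j
  fin_cases i <;> fin_cases j <;> apply Complex.ext <;> simp <;> linarith [e0.1, e0.2, e1.1, e1.2]

/-! ### Phases of spinors and parabolic elements -/

lemma spinorNormSq_eq_dotProduct (κ : Fin 2 → ℂ) : (spinorNormSq κ : ℂ) = star κ ⬝ᵥ κ := by
  rw [spinorNormSq_complex]; simp [dotProduct, Fin.sum_univ_two]; ring

lemma spinorNormSq_su (u : SU2) (κ : Fin 2 → ℂ) : spinorNormSq (mv (toSL u) κ) = spinorNormSq κ := by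
  have : (spinorNormSq (mv (toSL u) κ) : ℂ) = spinorNormSq κ := by
    rw [spinorNormSq_eq_dotProduct, spinorNormSq_eq_dotProduct, mv, Matrix.star_mulVec,
      Matrix.dotProduct_mulVec, Matrix.vecMul_vecMul, coe_toSL, SU2.conjTranspose_mul, Matrix.vecMul_one]
  exact_mod_cast this

lemma spinorNormSq_smul (c : ℂ) (κ : Fin 2 → ℂ) :
    spinorNormSq (c • κ) = Complex.normSq c * spinorNormSq κ := by
  simp [spinorNormSq]; ring

lemma spinorDir_smul (c : ℂ) (κ : Fin 2 → ℂ) (j : Fin 3) :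
    spinorDir (c • κ) j = Complex.normSq c * spinorDir κ j := by
  rw [spinorDir, spinorDir, Matrix.mulVec_smul, star_smul, smul_dotProduct, dotProduct_smul,
    smul_smul, ← Complex.re_ofReal_mul, ← Complex.mul_conj]
  simp [mul_comm]

lemma HoroRep.smul {E : Type} [NormedAddCommGroup E] [NormedSpace ℝ E] {pt : SL2C → E}
    {vec : SL2C → Fin 3 → E} {β : E → ℝ} {κ : Fin 2 → ℂ} (h : HoroRep pt vec β κ) {c : ℂ}
    (hc : Complex.normSq c = 1) : HoroRep pt vec β (c • κ) := by
  intro B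
  simpa only [mv_smul, spinorNormSq_smul, spinorDir_smul, hc, one_mul] using h B

/-- The direction conditions say that both components have squared modulus 1/2 and that their
Hermitian product is real and positive. It has modulus 1/2, so it equals 1/2, and |ν₀ - ν₁|² = 1 - 2
· 1/2 vanishes. -/
lemma exists_phase_of_dir {ν : Fin 2 → ℂ} (h : spinorNormSq ν = 1) (h0 : 0 < spinorDir ν 0)
    (h1 : spinorDir ν 1 = 0) (h2 : spinorDir ν 2 = 0) :
    ∃ c : ℂ, Complex.normSq c = 1 ∧ ν = c • baseSpinor := by
  have hr := sqrtHalf_mul_self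
  have hr0 := sqrtHalf_ne_zero
  simp [spinorDir, pauli, Matrix.mulVec, dotProduct, Fin.sum_univ_two] at h0 h1 h2
  simp only [spinorNormSq, Complex.normSq_apply] at h
  have key : ((ν 0).re - (ν 1).re) ^ 2 + ((ν 0).im - (ν 1).im) ^ 2 = 0 := by
    have hx : ((ν 0).re * (ν 1).re + (ν 0).im * (ν 1).im) ^ 2 = (1 / 2) ^ 2 := by
      have e1 : (ν 0).re * (ν 0).re + (ν 0).im * (ν 0).im = 1 / 2 := by linarith
      have e2 : (ν 1).re * (ν 1).re + (ν 1).im * (ν 1).im = 1 / 2 := by linarith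
      have e3 : (ν 0).re * (ν 1).im - (ν 0).im * (ν 1).re = 0 := by linarith
      linear_combination (1 / 2) * e2 + ((ν 1).re * (ν 1).re + (ν 1).im * (ν 1).im) * e1
        - ((ν 0).re * (ν 1).im - (ν 0).im * (ν 1).re) * e3
    have hpos : 0 < (ν 0).re * (ν 1).re + (ν 0).im * (ν 1).im := by linarith
    have : (ν 0).re * (ν 1).re + (ν 0).im * (ν 1).im = 1 / 2 := by
      nlinarith [hx, hpos]
    linarith
  have k1 : (ν 0).re = (ν 1).re := by nlinarith [sq_nonneg ((ν 0).re - (ν 1).re), sq_nonneg ((ν 0).im - (ν 1).im)]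
  have k2 : (ν 0).im = (ν 1).im := by nlinarith [sq_nonneg ((ν 0).re - (ν 1).re), sq_nonneg ((ν 0).im - (ν 1).im)]
  have k : ν 1 = ν 0 := Complex.ext k1.symm k2.symm
  refine ⟨ν 0 / sqrtHalf, ?_, ?_⟩
  · rw [Complex.normSq_div, Complex.normSq_ofReal, hr, Complex.normSq_apply]
    rw [k] at h
    linarith
  · have hc : (sqrtHalf : ℂ) ≠ 0 := by exact_mod_cast hr0
    ext i
    fin_cases i <;> simp [baseSpinor, k, hc]

/-- Here `unip c` moves μ to μ + c(μ₀ - μ₁)(1, 1), whose squared norm has the quadratic term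
2|c|²|μ₀ - μ₁|². Constancy at c = 0, 1, -1 already forces μ₀ = μ₁. -/
lemma exists_phase_of_unip {μ : Fin 2 → ℂ} (h : ∀ c, spinorNormSq (mv (unip c) μ) = 1) :
    ∃ c : ℂ, Complex.normSq c = 1 ∧ μ = c • baseSpinor := by
  have hr0 := sqrtHalf_ne_zero
  have h0 := h 0
  have h1 := h 1
  have h2 := h (-1)
  simp [spinorNormSq, mv, unip, Matrix.mulVec, dotProduct, Fin.sum_univ_two, Complex.normSq_apply] at h0 h1 h2
  have k1 : (μ 0).re = (μ 1).re := by nlinarith [sq_nonneg ((μ 0).re - (μ 1).re), sq_nonneg ((μ 0).im - (μ 1).im)]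
  have k2 : (μ 0).im = (μ 1).im := by nlinarith [sq_nonneg ((μ 0).re - (μ 1).re), sq_nonneg ((μ 0).im - (μ 1).im)]
  have k : μ 1 = μ 0 := Complex.ext k1.symm k2.symm
  refine ⟨μ 0 / sqrtHalf, ?_, ?_⟩
  · rw [Complex.normSq_div, Complex.normSq_ofReal, sqrtHalf_mul_self, Complex.normSq_apply]
    rw [k] at h0
    linarith
  · have hc : (sqrtHalf : ℂ) ≠ 0 := by exact_mod_cast hr0
    ext i
    fin_cases i <;> simp [baseSpinor, k, hc]

/-- This is the characteristic equation of a matrix of determinant one. -/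
lemma eigenvalue_eq {A : SL2C} {κ : Fin 2 → ℂ} (hκ : κ ≠ 0) {e : ℂ} (h : mv A κ = e • κ) :
    e ^ 2 - (A : Mat).trace * e + 1 = 0 := by
  have h0 := congrFun h 0
  have h1 := congrFun h 1
  have hd := A.2
  rw [Matrix.det_fin_two] at hd
  simp [mv, Matrix.mulVec, dotProduct, Fin.sum_univ_two] at h0 h1
  rw [Matrix.trace_fin_two]
  have k0 : (e ^ 2 - ((A : Mat) 0 0 + (A : Mat) 1 1) * e + 1) * κ 0 = 0 := by
    linear_combination (-e + (A : Mat) 1 1) * h0 - (A : Mat) 0 1 * h1 - κ 0 * hd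
  have k1 : (e ^ 2 - ((A : Mat) 0 0 + (A : Mat) 1 1) * e + 1) * κ 1 = 0 := by
    linear_combination (-e + (A : Mat) 0 0) * h1 - (A : Mat) 1 0 * h0 - κ 1 * hd
  by_contra hne
  apply hκ
  ext i
  fin_cases i
  · exact (mul_eq_zero.1 k0).resolve_left hne
  · exact (mul_eq_zero.1 k1).resolve_left hne

lemma trace_eq_two {A : SL2C} {κ : Fin 2 → ℂ} (hκ : κ ≠ 0) (h : mv A κ = κ) : (A : Mat).trace = 2 := by
  have := eigenvalue_eq hκ (e := 1) (by rw [h, one_smul])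
  linear_combination -this

/-- For trace ±2 the characteristic polynomial is a perfect square, with the double root ±1. -/
lemma eigenvalue_parabolic {A : SL2C} {κ : Fin 2 → ℂ} (hκ : κ ≠ 0) {e : ℂ} (h : mv A κ = e • κ)
    (ht : (A : Mat).trace = 2 ∨ (A : Mat).trace = -2) : e = 1 ∨ e = -1 := by
  have := eigenvalue_eq hκ h
  rcases ht with ht | ht <;> rw [ht] at this
  · left
    have : (e - 1) ^ 2 = 0 := by linear_combination this
    linear_combination pow_eq_zero_iff (two_ne_zero) |>.1 this
  · right
    have : (e + 1) ^ 2 = 0 := by linear_combination this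
    linear_combination pow_eq_zero_iff (two_ne_zero) |>.1 this

/-- A continuous function to `{±1} ⊂ SL(2, ℂ)` on a connected space is constant. -/
lemma eq_one_of_connected {X : Type*} [TopologicalSpace X] [PreconnectedSpace X] {f : X → SL2C}
    (hf : Continuous f) (h : ∀ x, (f x : Mat) = 1 ∨ (f x : Mat) = -1) {x₀ : X} (h₀ : f x₀ = 1) (x : X) :
    f x = 1 := by
  have hc : Continuous fun x => (f x : Mat) 0 0 :=
    (continuous_apply 0).comp (Matrix.SpecialLinearGroup.continuous_apply f hf 0)
  have : Set.EqOn (fun x => (f x : Mat) 0 0) (fun _ => 1) Set.univ := by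
    refine isPreconnected_univ.eq_of_sq_eq hc.continuousOn continuousOn_const ?_ (by simp)
      (Set.mem_univ x₀) (by simp [h₀])
    intro y _
    rcases h y with h | h <;> simp [h]
  have hx := this (Set.mem_univ x)
  rcases h x with h | h
  · exact Subtype.ext h
  · simp [h] at hx
    norm_num [Complex.ext_iff] at hx

namespace Framing

variable {E : Type} [NormedAddCommGroup E] [NormedSpace ℝ E] {M : HypModel E} (F : Framing M)

/-! ### Spin frames -/

lemma pt_sec_pt (B : SL2C) : F.pt (F.sec (F.pt B)) = F.pt B := F.pt_sec _ (F.pt_mem B)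

lemma exists_lift (B : SL2C) : ∃ u : SU2, B = F.sec (F.pt B) * toSL u :=
  F.exists_su _ _ (F.pt_sec_pt B)

/-- The spin lift of the frame given by `B`. -/
def lift (B : SL2C) : SU2 := (F.exists_lift B).choose

lemma sec_mul_lift (B : SL2C) : F.sec (F.pt B) * toSL (F.lift B) = B :=
  (F.exists_lift B).choose_spec.symm

lemma vec_eq_std (B : SL2C) (j : Fin 3) :
    F.vec B j = ∑ i, rot (F.lift B) i j • M.std (F.pt B) i := by
  conv_lhs => rw [← F.sec_mul_lift B, F.vec_mul, F.vec_sec _ (F.pt_mem B)]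

lemma rotMatrix_transpose_mul (u : SU2) :
    (Matrix.of fun i j => rot u i j)ᵀ * (Matrix.of fun i j => rot u i j) = 1 := by
  ext i j
  rw [Matrix.mul_apply, Matrix.one_apply]
  exact rot_orthonormal u i j

lemma rotMatrix_mul_transpose (u : SU2) :
    (Matrix.of fun i j => rot u i j) * (Matrix.of fun i j => rot u i j)ᵀ = 1 :=
  mul_eq_one_comm.1 (rotMatrix_transpose_mul u)

lemma sum_vec (B : SL2C) (x : Fin 3 → ℝ) : ∑ j, x j • F.vec B j =
    ∑ i, ((Matrix.of fun i j => rot (F.lift B) i j) *ᵥ x) i • M.std (F.pt B) i := by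
  simp_rw [F.vec_eq_std B, Finset.smul_sum, Matrix.mulVec, dotProduct, Finset.sum_smul, smul_smul]
  rw [Finset.sum_comm]
  simp [mul_comm]

lemma metric_vec (B : SL2C) (x y : Fin 3 → ℝ) :
    M.metric (F.pt B) (∑ i, x i • F.vec B i) (∑ i, y i • F.vec B i) = ∑ i, x i * y i := by
  rw [F.sum_vec, F.sum_vec, F.metric_std _ (F.pt_mem B)]
  change ((Matrix.of fun i j => rot (F.lift B) i j) *ᵥ x) ⬝ᵥ
    ((Matrix.of fun i j => rot (F.lift B) i j) *ᵥ y) = x ⬝ᵥ y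
  rw [Matrix.dotProduct_mulVec, Matrix.vecMul_mulVec, rotMatrix_transpose_mul, Matrix.vecMul_one]

lemma mem_tangent_iff (B : SL2C) (v : E) :
    v ∈ M.tangent (F.pt B) ↔ ∃ x : Fin 3 → ℝ, v = ∑ i, x i • F.vec B i := by
  rw [F.mem_tangent _ (F.pt_mem B)]
  constructor
  · rintro ⟨x, rfl⟩
    refine ⟨(Matrix.of fun i j => rot (F.lift B) i j)ᵀ *ᵥ x, ?_⟩
    rw [F.sum_vec, Matrix.mulVec_mulVec, rotMatrix_mul_transpose, Matrix.one_mulVec]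
  · rintro ⟨x, rfl⟩
    exact ⟨_, F.sum_vec B x⟩

lemma vec_eq_sum (B : SL2C) (j : Fin 3) :
    F.vec B j = ∑ i, (Pi.single j 1 : Fin 3 → ℝ) i • F.vec B i := by
  simp [Pi.single_apply]

lemma metric_vec_sum (B : SL2C) (j : Fin 3) (x : Fin 3 → ℝ) :
    M.metric (F.pt B) (F.vec B j) (∑ i, x i • F.vec B i) = x j := by
  conv_lhs => rw [F.vec_eq_sum B j, F.metric_vec]
  simp [Pi.single_apply]

lemma metric_vec_vec (B : SL2C) (i j : Fin 3) :
    M.metric (F.pt B) (F.vec B i) (F.vec B j) = if i = j then 1 else 0 := by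
  rw [F.vec_eq_sum B j, F.metric_vec_sum, Pi.single_apply]

lemma sum_vec_injective (B : SL2C) {x y : Fin 3 → ℝ}
    (h : ∑ i, x i • F.vec B i = ∑ i, y i • F.vec B i) : x = y := by
  ext j
  rw [← F.metric_vec_sum B j x, h, F.metric_vec_sum]

lemma vec_mem_tangent (B : SL2C) (j : Fin 3) : F.vec B j ∈ M.tangent (F.pt B) :=
  (F.mem_tangent_iff B _).2 ⟨_, F.vec_eq_sum B j⟩

lemma metric_std_sum (F : Framing M) {q : E} (hq : q ∈ M.carrier) (j : Fin 3) (x : Fin 3 → ℝ) :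
    M.metric q (M.std q j) (∑ i, x i • M.std q i) = x j := by
  have := F.metric_vec_sum (F.sec q) j x
  rwa [F.vec_sec q hq, F.pt_sec q hq] at this

lemma metric_std_vec (B : SL2C) (i j : Fin 3) :
    M.metric (F.pt B) (M.std (F.pt B) i) (F.vec B j) = rot (F.lift B) i j := by
  rw [F.vec_eq_std, F.metric_std_sum (F.pt_mem B)]

/-- The spin frame given by `B ∈ SL(2, ℂ)`. -/
def frame (B : SL2C) : SpinFrame M where
  pt := F.pt B
  vec := F.vec B
  lift := F.lift B
  pt_mem := F.pt_mem B
  vec_mem := F.vec_mem_tangent B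
  orthonormal := F.metric_vec_vec B
  rightHanded := by
    simp only [F.metric_std_vec, det_rot]
    norm_num
  lift_spec j := by
    simp only [F.metric_std_vec, conj_pauli]

/-- The element of `SL(2, ℂ)` which gives a spin frame. -/
def unframe (s : SpinFrame M) : SL2C := F.sec s.pt * toSL s.lift

lemma pt_unframe (s : SpinFrame M) : F.pt (F.unframe s) = s.pt := by
  rw [unframe, F.pt_mul, F.pt_sec _ s.pt_mem]

lemma unframe_frame (B : SL2C) : F.unframe (F.frame B) = B := F.sec_mul_lift B

lemma frame_unframe (s : SpinFrame M) : F.frame (F.unframe s) = s := by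
  apply SpinFrame.ext
  · exact F.pt_unframe s
  · funext j
    change F.vec (F.sec s.pt * toSL s.lift) j = _
    rw [F.vec_mul, F.vec_sec _ s.pt_mem]
    obtain ⟨x, hx⟩ := (F.mem_tangent _ s.pt_mem _).1 (s.vec_mem j)
    -- Independence of the Pauli matrices lets `lift_spec` determine the components of the frame, so
    -- the spin lift and the base point determine the whole spin frame.
    have h : ∀ i, rot s.lift i j = x i := by
      rw [rot_eq_iff, s.lift_spec j]
      simp_rw [hx, F.metric_std_sum s.pt_mem]
    simp_rw [h, hx]
  · apply toSL_injective
    have := F.sec_mul_lift (F.unframe s)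
    rw [F.pt_unframe] at this
    exact mul_left_cancel this

/-- The lift is obtained by choice, but it is forced to be (sec (pt B))⁻¹ B, which depends
continuously on B. -/
lemma continuous_lift : Continuous F.lift := by
  have h : Continuous fun B => (F.sec (F.pt B))⁻¹ * B :=
    (F.continuousOn_sec.comp_continuous F.continuous_pt F.pt_mem).inv.mul continuous_id
  refine continuous_induced_rng.2 ?_
  have h2 : Continuous fun B => (((F.sec (F.pt B))⁻¹ * B : SL2C) : Mat) :=
    continuous_induced_dom.comp h
  convert h2 using 2 with B
  conv_rhs => rw [← F.sec_mul_lift B, F.pt_mul, F.pt_sec_pt, inv_mul_cancel_left]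
  rfl

lemma continuous_frame : Continuous F.frame :=
  continuous_induced_rng.2 (F.continuous_pt.prodMk (F.continuous_vec.prodMk F.continuous_lift))

lemma continuous_spinFrame_pt : Continuous (SpinFrame.pt : SpinFrame M → E) :=
  continuous_fst.comp (continuous_induced_dom (f := fun s : SpinFrame M => (s.pt, s.vec, s.lift)))

lemma continuous_spinFrame_lift : Continuous (SpinFrame.lift : SpinFrame M → SU2) :=
  continuous_snd.comp (continuous_snd.comp
    (continuous_induced_dom (f := fun s : SpinFrame M => (s.pt, s.vec, s.lift))))

lemma continuous_unframe : Continuous F.unframe :=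
  (F.continuousOn_sec.comp_continuous continuous_spinFrame_pt fun s => s.pt_mem).mul
    (continuous_toSL.comp continuous_spinFrame_lift)

lemma frame_injective : Function.Injective F.frame :=
  Function.LeftInverse.injective F.unframe_frame

lemma pt_mul_negOne (B : SL2C) : F.pt (B * toSL negOne) = F.pt B := F.pt_mul B negOne

lemma vec_mul_negOne (B : SL2C) (j : Fin 3) : F.vec (B * toSL negOne) j = F.vec B j := by
  simp [F.vec_mul, rot_negOne]

/-! ### Outward spin decorations -/

/-- The elements of `SL(2, ℂ)` whose frames make up the outward spin decoration given by `κ`. -/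
def fibre (κ : Fin 2 → ℂ) : Set SL2C := {B | mv B baseSpinor = κ}

lemma mv_inv_of_mem {κ : Fin 2 → ℂ} {B : SL2C} (h : B ∈ fibre κ) : mv B⁻¹ κ = baseSpinor := by
  rw [← (show mv B baseSpinor = κ from h), mv_inv_mv]

lemma mul_mem_fibre (A : SL2C) {κ : Fin 2 → ℂ} {B : SL2C} (h : B ∈ fibre κ) :
    A * B ∈ fibre (mv A κ) := by
  change mv (A * B) baseSpinor = _
  rw [mv_mul, (show mv B baseSpinor = κ from h)]

lemma mul_negOne_mem_fibre {κ : Fin 2 → ℂ} {B : SL2C} (h : B ∈ fibre (-κ)) :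
    B * toSL negOne ∈ fibre κ := by
  change mv (B * toSL negOne) baseSpinor = _
  rw [mv_mul, mv_negOne, mv, Matrix.mulVec_neg]
  change -(mv B baseSpinor) = _
  rw [(show mv B baseSpinor = -κ from h), neg_neg]

lemma slOf_mem_fibre (κ : nonzeroSpinors) : slOf κ ∈ fibre κ := mv_slOf κ

/-- A point `pt B` lies on the horosphere when B⁻¹κ is a unit spinor. As SU(2) is transitive on unit
spinors, B can then be corrected on the right, without moving the point, so that it carries κ₀ to κ.
-/
lemma horosphere_eq {β : E → ℝ} {κ : Fin 2 → ℂ} (h : HoroRep F.pt F.vec β κ) :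
    M.horosphere β = F.pt '' fibre κ := by
  ext q
  constructor
  · rintro ⟨hq, h0⟩
    rw [← F.pt_sec q hq] at h0
    have h1 := (h _).1.1 h0
    refine ⟨F.sec q * toSL (suOf _ h1), ?_, ?_⟩
    · change mv _ _ = _
      rw [mv_mul, mv_suOf, mv_mv_inv]
    · rw [F.pt_mul, F.pt_sec q hq]
  · rintro ⟨B, hB, rfl⟩
    refine ⟨F.pt_mem B, (h B).1.2 ?_⟩
    rw [mv_inv_of_mem hB, baseSpinor_normSq]

/-- Over a point `q` of the horosphere of `κ`, the element of `fibre κ` with base point `q`. -/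
def atPt (κ : nonzeroSpinors) (q : E) : SL2C :=
  F.sec q * slOf ⟨mv (F.sec q)⁻¹ κ, mv_ne_zero _ κ.2⟩

lemma atPt_mem_fibre (κ : nonzeroSpinors) (q : E) : F.atPt κ q ∈ fibre κ := by
  change mv _ _ = _
  rw [atPt, mv_mul, mv_slOf, mv_mv_inv]

/-- Two such frames differ by an element of SU(2) fixing κ₀, which is trivial. Thus the fibre is a
section of the spin frames over the horosphere. -/
lemma eq_of_mem_fibre {κ : Fin 2 → ℂ} {B C : SL2C} (hB : B ∈ fibre κ) (hC : C ∈ fibre κ)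
    (h : F.pt B = F.pt C) : B = C := by
  obtain ⟨u, rfl⟩ := F.exists_su _ _ h
  have : u = 1 := by
    apply SU2.eq_one_of_mv
    have h1 : mv (B * toSL u) baseSpinor = κ := hC
    rw [← (show mv B baseSpinor = κ from hB), mv_mul] at h1
    rw [← mv_inv_mv B (mv (toSL u) baseSpinor), h1, mv_inv_mv]
  rw [this, map_one, mul_one]

/-- On the horosphere the spinor (sec q)⁻¹κ has norm one, so `slOf` of it is unitary and fixes the
base point. At other points `atPt κ q` still lies in the fibre, but need not lie over q. -/
lemma pt_atPt_pt {κ : nonzeroSpinors} {B : SL2C} (hB : B ∈ fibre κ) : F.pt (F.atPt κ (F.pt B)) = F.pt B := by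
  have hn : spinorNormSq (mv (F.sec (F.pt B))⁻¹ κ) = 1 := by
    rw [← (show mv B baseSpinor = κ from hB), ← mv_mul]
    conv_lhs => rw [← F.sec_mul_lift B, F.pt_mul, F.pt_sec_pt, inv_mul_cancel_left]
    rw [spinorNormSq_su, baseSpinor_normSq]
  have : F.atPt κ (F.pt B) = F.sec (F.pt B) * toSL (suOf _ hn) := rfl
  rw [this, F.pt_mul, F.pt_sec_pt]

lemma atPt_pt {κ : nonzeroSpinors} {B : SL2C} (hB : B ∈ fibre κ) : F.atPt κ (F.pt B) = B :=
  F.eq_of_mem_fibre (F.atPt_mem_fibre _ _) hB (F.pt_atPt_pt hB)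

lemma pt_atPt {κ : nonzeroSpinors} {q : E} (hq : q ∈ F.pt '' fibre κ) : F.pt (F.atPt κ q) = q := by
  obtain ⟨B, hB, rfl⟩ := hq
  exact F.pt_atPt_pt hB

lemma continuousOn_atPt (κ : nonzeroSpinors) : ContinuousOn (F.atPt κ) M.carrier := by
  have h := F.continuousOn_sec
  rw [continuousOn_iff_continuous_domRestrict] at h ⊢
  refine h.mul (continuous_slOf.comp ?_)
  exact Continuous.subtype_mk (continuous_mv h.inv continuous_const) _

lemma image_act (A : SL2C) (κ : Fin 2 → ℂ) :
    M.act A '' (F.pt '' fibre κ) = F.pt '' fibre (mv A κ) := by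
  ext q
  constructor
  · rintro ⟨_, ⟨B, hB, rfl⟩, rfl⟩
    exact ⟨A * B, mul_mem_fibre A hB, (F.act_pt A B).symm⟩
  · rintro ⟨B, hB, rfl⟩
    refine ⟨_, ⟨A⁻¹ * B, ?_, rfl⟩, ?_⟩
    · simpa using mul_mem_fibre A⁻¹ hB
    · rw [F.act_pt, mul_inv_cancel_left]

/-- A horosphere determines the spinor up to a phase. -/
lemma exists_phase {κ : nonzeroSpinors} {κ' : Fin 2 → ℂ} (h : F.pt '' fibre κ ⊆ F.pt '' fibre κ') :
    ∃ c : ℂ, Complex.normSq c = 1 ∧ κ' = c • (κ : Fin 2 → ℂ) := by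
  -- The elements slOf κ · (unip c)⁻¹ are frames over the horosphere of κ. That their base points
  -- lie on the horosphere of κ' gives the norm condition on μ = (slOf κ)⁻¹κ' for every c.
  obtain ⟨c, hc, h2⟩ := exists_phase_of_unip (μ := mv (slOf κ)⁻¹ κ') (by
    intro c
    have hm : slOf κ * (unip c)⁻¹ ∈ fibre κ := by
      change mv _ _ = _
      rw [mv_mul]
      conv_lhs => rw [← mv_unip c, mv_inv_mv, mv_slOf]
    obtain ⟨B, hB, hpt⟩ := h ⟨_, hm, rfl⟩
    obtain ⟨u, hu⟩ := F.exists_su _ _ hpt.symm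
    rw [← (show mv B baseSpinor = κ' from hB), ← mv_mul, ← mv_mul, hu]
    have : unip c * (slOf κ)⁻¹ * (slOf κ * (unip c)⁻¹ * toSL u) = toSL u := by group
    rw [this, spinorNormSq_su, baseSpinor_normSq])
  refine ⟨c, hc, ?_⟩
  rw [← mv_mv_inv (slOf κ) κ', h2, mv_smul, mv_slOf]

/-- Preserving the horosphere makes κ an eigenvector, and parabolicity restricts its eigenvalue to
±1. The sign is invisible on frames, since -1 acts trivially on points and vectors. -/
lemma parabolic_eq {κ : nonzeroSpinors} {A : SL2C} (h : M.ParabolicFixing (F.pt '' fibre κ) A) :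
    mv A κ = κ ∨ mv A κ = -(κ : Fin 2 → ℂ) := by
  obtain ⟨ht, hA⟩ := h
  rw [F.image_act] at hA
  obtain ⟨c, -, hc⟩ := F.exists_phase hA.ge
  rcases eigenvalue_parabolic κ.2 hc ht with rfl | rfl
  · left; rw [hc, one_smul]
  · right; rw [hc, neg_one_smul]

/-- The frame of `B` is moved by a parabolic isometry preserving the horosphere to the frame of an
element of the same fibre, up to sign. -/
lemma exists_parabolic_image {κ : nonzeroSpinors} {A : SL2C}
    (h : M.ParabolicFixing (F.pt '' fibre κ) A) {B : SL2C} (hB : B ∈ fibre κ) :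
    ∃ C ∈ fibre κ, F.pt C = M.act A (F.pt B) ∧
      ∀ j, F.vec C j = fderiv ℝ (M.act A) (F.pt B) (F.vec B j) := by
  have hm := mul_mem_fibre A hB
  rcases F.parabolic_eq h with h | h
  · rw [h] at hm
    exact ⟨A * B, hm, (F.act_pt A B).symm, fun j => (F.fderiv_act A B j).symm⟩
  · rw [h] at hm
    refine ⟨A * B * toSL negOne, mul_negOne_mem_fibre hm, ?_, fun j => ?_⟩
    · rw [F.pt_mul_negOne, F.act_pt]
    · rw [F.vec_mul_negOne, F.fderiv_act]

/-- Apply A⁻¹ to the frame of C; as A κ = ±κ, the result is in the fibre of κ up to the central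
sign. Together with the forward direction this gives equality, and not just inclusion, of
transported line fields. -/
lemma exists_parabolic_preimage {κ : nonzeroSpinors} {A : SL2C}
    (h : M.ParabolicFixing (F.pt '' fibre κ) A) {C : SL2C} (hC : C ∈ fibre κ) :
    ∃ B ∈ fibre κ, F.pt C = M.act A (F.pt B) ∧
      ∀ j, F.vec C j = fderiv ℝ (M.act A) (F.pt B) (F.vec B j) := by
  have hpre : C ∈ fibre (mv A (mv A⁻¹ κ)) := by rwa [mv_mv_inv]
  have hm := mul_mem_fibre A⁻¹ hC
  rcases F.parabolic_eq h with h | h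
  · rw [← h, mv_inv_mv] at hm
    refine ⟨A⁻¹ * C, hm, ?_, fun j => ?_⟩
    · rw [F.act_pt, mul_inv_cancel_left]
    · rw [F.fderiv_act, mul_inv_cancel_left]
  · have h' : mv A⁻¹ κ = -(κ : Fin 2 → ℂ) := by
      have : mv A (-(κ : Fin 2 → ℂ)) = κ := by
        rw [mv, Matrix.mulVec_neg]
        change -(mv A κ) = _
        rw [h, neg_neg]
      conv_lhs => rw [← this, mv_inv_mv]
    rw [h'] at hm
    refine ⟨A⁻¹ * C * toSL negOne, mul_negOne_mem_fibre hm, ?_, fun j => ?_⟩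
    · rw [F.act_pt, ← mul_assoc, mul_inv_cancel_left, F.pt_mul_negOne]
    · rw [F.fderiv_act, ← mul_assoc, mul_inv_cancel_left, F.vec_mul_negOne]

/-- In a frame adapted to κ the spinor B⁻¹κ is κ₀, whose direction is the first axis, so the
differential of β is a negative multiple of the first coordinate. -/
lemma tangentTo_sum {β : E → ℝ} {κ : Fin 2 → ℂ} (h : HoroRep F.pt F.vec β κ) {B : SL2C}
    (hB : B ∈ fibre κ) (x : Fin 3 → ℝ) :
    M.TangentTo β (F.pt B) (∑ i, x i • F.vec B i) ↔ x 0 = 0 := by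
  have h0 : β (F.pt B) = 0 := (h B).1.2 (by rw [mv_inv_of_mem hB, baseSpinor_normSq])
  obtain ⟨k, hk, hf⟩ := (h B).2 h0
  rw [HypModel.TangentTo, map_sum]
  simp_rw [map_smul, hf, mv_inv_of_mem hB, spinorDir_baseSpinor, Fin.sum_univ_three]
  have : ∑ i, x i • F.vec B i ∈ M.tangent (F.pt B) := (F.mem_tangent_iff B _).2 ⟨x, rfl⟩
  rw [Fin.sum_univ_three] at this
  simp [this, hk.ne']

lemma tangentTo_vec_one {β : E → ℝ} {κ : Fin 2 → ℂ} (h : HoroRep F.pt F.vec β κ) {B : SL2C}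
    (hB : B ∈ fibre κ) : M.TangentTo β (F.pt B) (F.vec B 1) := by
  rw [F.vec_eq_sum B 1, F.tangentTo_sum h hB]
  simp

lemma outwardNormal_vec_zero {β : E → ℝ} {κ : Fin 2 → ℂ} (h : HoroRep F.pt F.vec β κ) {B : SL2C}
    (hB : B ∈ fibre κ) : M.OutwardNormal β (F.pt B) (F.vec B 0) := by
  have h0 : β (F.pt B) = 0 := (h B).1.2 (by rw [mv_inv_of_mem hB, baseSpinor_normSq])
  refine ⟨⟨F.vec_mem_tangent B 0, by simp [F.metric_vec_vec], fun w hw => ?_⟩, ?_⟩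
  · obtain ⟨x, rfl⟩ := (F.mem_tangent_iff B _).1 hw.1
    rw [F.metric_vec_sum, (F.tangentTo_sum h hB x).1 hw]
  · obtain ⟨k, hk, hf⟩ := (h B).2 h0
    rw [hf, mv_inv_of_mem hB, spinorDir_baseSpinor]
    simpa using hk

lemma inwardNormal_neg_vec_zero {β : E → ℝ} {κ : Fin 2 → ℂ} (h : HoroRep F.pt F.vec β κ) {B : SL2C}
    (hB : B ∈ fibre κ) : M.InwardNormal β (F.pt B) (-F.vec B 0) := by
  obtain ⟨-, ho⟩ := F.outwardNormal_vec_zero h hB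
  have hv : -F.vec B 0 = ∑ i, (Pi.single 0 (-1) : Fin 3 → ℝ) i • F.vec B i := by
    simp [Pi.single_apply]
  refine ⟨⟨?_, ?_, fun w hw => ?_⟩, ?_⟩
  · exact (F.mem_tangent_iff B _).2 ⟨_, hv⟩
  · rw [hv, F.metric_vec]; simp [Pi.single_apply]
  · obtain ⟨x, rfl⟩ := (F.mem_tangent_iff B _).1 hw.1
    rw [hv, F.metric_vec]
    have := (F.tangentTo_sum h hB x).1 hw
    simp [Pi.single_apply, this]
  · rw [map_neg]; linarith

/-- A parabolic isometry preserving the horosphere multiplies the fibre on the left and maps it to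
itself up to sign; it therefore permutes the second vectors of the frames. -/
lemma unitParallel {β : E → ℝ} {κ : nonzeroSpinors} (h : HoroRep F.pt F.vec β κ) :
    M.UnitParallel β fun q => F.vec (F.atPt κ q) 1 := by
  refine ⟨?_, ?_⟩
  · rw [F.horosphere_eq h]
    rintro _ ⟨B, hB, rfl⟩
    beta_reduce
    rw [F.atPt_pt hB]
    exact ⟨F.tangentTo_vec_one h hB, by simp [F.metric_vec_vec]⟩
  · intro A hA
    rw [F.horosphere_eq h] at hA ⊢
    rintro _ ⟨B, hB, rfl⟩
    obtain ⟨C, hC, hpt, hvec⟩ := F.exists_parabolic_image hA hB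
    beta_reduce
    rw [F.atPt_pt hB, ← hpt, F.atPt_pt hC, hvec]

lemma range_atPt {β : E → ℝ} {κ : nonzeroSpinors} (h : HoroRep F.pt F.vec β κ) {X : Type*}
    (g : SL2C → X) : Set.range (fun q : M.horosphere β => g (F.atPt κ q)) = g '' fibre κ := by
  ext x
  constructor
  · rintro ⟨q, rfl⟩
    exact ⟨_, F.atPt_mem_fibre κ q, rfl⟩
  · rintro ⟨B, hB, rfl⟩
    exact ⟨⟨F.pt B, by rw [F.horosphere_eq h]; exact ⟨B, hB, rfl⟩⟩, by simp [F.atPt_pt hB]⟩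

lemma continuous_atPt_horosphere (β : E → ℝ) (κ : nonzeroSpinors) :
    Continuous fun q : M.horosphere β => F.atPt κ q :=
  (F.continuousOn_atPt κ).comp_continuous continuous_subtype_val fun q => q.2.1

lemma isOutward {β : E → ℝ} {κ : nonzeroSpinors} (h : HoroRep F.pt F.vec β κ) :
    IsOutward M β (F.frame '' fibre κ) := by
  refine ⟨_, F.unitParallel h, fun q => F.frame (F.atPt κ q),
    F.continuous_frame.comp (F.continuous_atPt_horosphere β κ), fun q => ?_, (F.range_atPt h _).symm⟩
  have hq : F.pt (F.atPt κ q) = q := F.pt_atPt (by rw [← F.horosphere_eq h]; exact q.2)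
  refine ⟨hq, ?_, rfl⟩
  have := F.outwardNormal_vec_zero h (F.atPt_mem_fibre κ q)
  rwa [hq] at this

lemma vec_mul_suRot_zero (B : SL2C) : F.vec (B * toSL (suRot Real.pi)) 0 = -F.vec B 0 := by
  simp [F.vec_mul, rot_suRot_pi]

lemma vec_mul_suRot_one (B : SL2C) : F.vec (B * toSL (suRot Real.pi)) 1 = F.vec B 1 := by
  simp [F.vec_mul, rot_suRot_pi]

lemma isInward {β : E → ℝ} {κ : nonzeroSpinors} (h : HoroRep F.pt F.vec β κ) :
    IsInward M β ((fun B => F.frame (B * toSL (suRot Real.pi))) '' fibre κ) := by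
  refine ⟨_, F.unitParallel h, fun q => F.frame (F.atPt κ q * toSL (suRot Real.pi)),
    F.continuous_frame.comp ((F.continuous_atPt_horosphere β κ).mul continuous_const), fun q => ?_,
    (F.range_atPt h _).symm⟩
  have hq : F.pt (F.atPt κ q) = q := F.pt_atPt (by rw [← F.horosphere_eq h]; exact q.2)
  refine ⟨(F.pt_mul _ _).trans hq, ?_, F.vec_mul_suRot_one _⟩
  have := F.inwardNormal_neg_vec_zero h (F.atPt_mem_fibre κ q)
  rw [hq, ← F.vec_mul_suRot_zero] at this
  exact this

/-- Rotation about a vector of the moving frame is right multiplication, so it commutes with the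
left action of isometries. -/
lemma rotated_image (θ : ℝ) (S : Set SL2C) :
    rotated M θ (F.frame '' S) = (fun B => F.frame (B * toSL (suRot θ))) '' S := by
  have key : ∀ B (s : SpinFrame M), (s.pt = F.pt B ∧ (s.lift : Mat) = (F.lift B : Mat) * spinRot θ) ↔
      s = F.frame (B * toSL (suRot θ)) := by
    intro B s
    have hl : F.lift (B * toSL (suRot θ)) = F.lift B * suRot θ := by
      apply toSL_injective
      apply mul_left_cancel (a := F.sec (F.pt B))
      rw [map_mul, ← mul_assoc, F.sec_mul_lift]
      conv_lhs => rw [← F.pt_mul B (suRot θ), F.sec_mul_lift]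
    constructor
    · rintro ⟨h1, h2⟩
      have h3 : s.lift = F.lift B * suRot θ := Subtype.ext h2
      rw [← F.frame_unframe s, unframe, h1, h3, map_mul, ← mul_assoc, F.sec_mul_lift]
    · rintro rfl
      exact ⟨F.pt_mul _ _, congrArg (fun u : SU2 => (u : Mat)) hl⟩
  ext s
  constructor
  · rintro ⟨_, ⟨B, hB, rfl⟩, h⟩
    exact ⟨B, hB, ((key B s).1 h).symm⟩
  · rintro ⟨B, hB, rfl⟩
    exact ⟨_, ⟨B, hB, rfl⟩, (key B _).2 rfl⟩

lemma suRot_mul_suRot_neg (θ : ℝ) : suRot θ * suRot (-θ) = 1 := by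
  have h : (Real.sin (θ / 2) : ℂ) ^ 2 + (Real.cos (θ / 2) : ℂ) ^ 2 = 1 := by
    exact_mod_cast Real.sin_sq_add_cos_sq (θ / 2)
  apply Subtype.ext
  change spinRot θ * spinRot (-θ) = 1
  simp only [spinRot, neg_div, Real.sin_neg, Real.cos_neg]
  ext i j
  fin_cases i <;> fin_cases j <;> simp [-Complex.ofReal_sin, -Complex.ofReal_cos] <;>
    first | ring1 | linear_combination h

/-! ### The spin-decorated horosphere of a spinor -/

/-- The spin-decorated horosphere given by a spinor. -/
def spinDec (κ : nonzeroSpinors) : SpinDecHorosphere M where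
  hor := F.pt '' fibre κ
  Win := (fun B => F.frame (B * toSL (suRot Real.pi))) '' fibre κ
  Wout := F.frame '' fibre κ
  isSpinDec := by
    obtain ⟨β, hβ, h⟩ := F.horo_of κ κ.2
    exact ⟨β, hβ, (F.horosphere_eq h).symm, F.isInward h, F.isOutward h⟩
  in_of_out := (F.rotated_image _ _).symm
  out_of_in := by
    rw [← Set.image_image F.frame (fun B => B * toSL (suRot Real.pi)), F.rotated_image,
      Set.image_image]
    simp only [mul_assoc, ← map_mul, suRot_mul_suRot_neg, map_one, mul_one]

/-! ### Spin-decorated horospheres and spinors -/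

lemma exists_phase_of_outwardNormal {β : E → ℝ} {κ : Fin 2 → ℂ} (h : HoroRep F.pt F.vec β κ)
    {B : SL2C} (h0 : β (F.pt B) = 0) (hN : M.OutwardNormal β (F.pt B) (F.vec B 0)) :
    ∃ c : ℂ, Complex.normSq c = 1 ∧ mv B⁻¹ κ = c • baseSpinor := by
  obtain ⟨k, hk, hf⟩ := (h B).2 h0
  set ν := mv B⁻¹ κ
  have hd0 : 0 < spinorDir ν 0 := by
    have := hN.2
    rw [hf] at this
    by_contra hn
    have : 0 ≤ k * -spinorDir ν 0 := mul_nonneg hk.le (by linarith)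
    linarith
  have hd : ∀ j, j ≠ 0 → spinorDir ν j = 0 := by
    intro j hj
    -- The test vector -d_j e₀ + d₀ e_j, with d the direction of ν, is annihilated by the
    -- differential of β. Being orthogonal to the normal e₀, it shows that d_j = 0.
    let x : Fin 3 → ℝ := fun i => if i = 0 then -spinorDir ν j else if i = j then spinorDir ν 0 else 0
    have ht : M.TangentTo β (F.pt B) (∑ i, x i • F.vec B i) := by
      refine ⟨(F.mem_tangent_iff B _).2 ⟨x, rfl⟩, ?_⟩
      rw [map_sum]
      simp_rw [map_smul, hf, Fin.sum_univ_three]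
      fin_cases j
      · exact absurd rfl hj
      · simp [x]; ring
      · simp [x]; ring
    have := hN.1.2.2 _ ht
    rw [F.metric_vec_sum] at this
    simpa [x] using this
  exact exists_phase_of_dir ((h B).1.1 h0) hd0 (hd 1 (by decide)) (hd 2 (by decide))

/-- The horosphere is a continuous image of ℂ, by translating one adapted frame with `unip`. -/
lemma preconnectedSpace_horosphere {β : E → ℝ} {κ : nonzeroSpinors} (h : HoroRep F.pt F.vec β κ) :
    PreconnectedSpace (M.horosphere β) := by
  apply Subtype.preconnectedSpace
  have : M.horosphere β = Set.range fun c => F.pt (slOf κ * unip c) := by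
    rw [F.horosphere_eq h]
    ext q
    constructor
    · rintro ⟨B, hB, rfl⟩
      obtain ⟨c, hc⟩ : ∃ c, (slOf κ)⁻¹ * B = unip c := by
        apply exists_unip
        rw [mv_mul, (show mv B baseSpinor = κ from hB), mv_inv_of_mem (slOf_mem_fibre κ)]
      exact ⟨c, by simp [← hc]⟩
    · rintro ⟨c, rfl⟩
      refine ⟨_, ?_, rfl⟩
      change mv _ _ = _
      rw [mv_mul, mv_unip, mv_slOf]
  rw [this]
  exact isPreconnected_range (F.continuous_pt.comp (continuous_const.mul continuous_unip))

/-- Every outward spin decoration comes from a spinor. -/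
lemma exists_eq_of_isOutward {β : E → ℝ} (hβ : β ∈ M.horoFun) {W : Set (SpinFrame M)}
    (hW : IsOutward M β W) :
    ∃ κ : nonzeroSpinors, HoroRep F.pt F.vec β κ ∧ W = F.frame '' fibre κ := by
  obtain ⟨V, hV, w, hw, hspec, rfl⟩ := hW
  obtain ⟨κ', hκ', h'⟩ := F.horo_exists β hβ
  have hhor := F.horosphere_eq h'
  let q₀ : M.horosphere β :=
    ⟨F.pt (slOf ⟨κ', hκ'⟩), by rw [hhor]; exact ⟨_, slOf_mem_fibre ⟨κ', hκ'⟩, rfl⟩⟩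
  let C : M.horosphere β → SL2C := fun q => F.unframe (w q)
  have hCpt : ∀ q, F.pt (C q) = q := fun q => by rw [F.pt_unframe, (hspec q).1]
  have hCvec : ∀ q j, F.vec (C q) j = (w q).vec j := fun q j => by
    have := congrArg (fun s => s.vec j) (F.frame_unframe (w q))
    exact this
  have hphase : ∀ q, ∃ c : ℂ, Complex.normSq c = 1 ∧ mv (C q)⁻¹ κ' = c • baseSpinor := by
    intro q
    apply F.exists_phase_of_outwardNormal h'
    · rw [hCpt]; exact q.2.2
    · rw [hCpt, hCvec]; exact (hspec q).2.1
  obtain ⟨c₀, hc₀, hC₀⟩ := hphase q₀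
  have hc₀' : c₀ ≠ 0 := by rintro rfl; simp at hc₀
  -- The horosphere alone fixes the spinor up to phase. The spin frame at a single point q₀ fixes
  -- the phase, sign included.
  let κ : nonzeroSpinors := ⟨mv (C q₀) baseSpinor, mv_ne_zero _ baseSpinor_ne_zero⟩
  have hκ : κ' = c₀ • (κ : Fin 2 → ℂ) := by
    change κ' = c₀ • mv (C q₀) baseSpinor
    rw [← mv_smul, ← hC₀, mv_mv_inv]
  have hκ2 : (κ : Fin 2 → ℂ) = c₀⁻¹ • κ' := by rw [hκ, smul_smul, inv_mul_cancel₀ hc₀', one_smul]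
  have h : HoroRep F.pt F.vec β κ := by
    rw [hκ2]
    exact h'.smul (by rw [Complex.normSq_inv, hc₀, inv_one])
  have hhorκ := F.horosphere_eq h
  have hC₀mem : C q₀ ∈ fibre κ := rfl
  have hmem : ∀ q : M.horosphere β, (q : E) ∈ F.pt '' fibre κ := fun q => by
    rw [← hhorκ]; exact q.2
  have hpt : ∀ q : M.horosphere β, F.pt (F.atPt κ q) = q := fun q => F.pt_atPt (hmem q)
  -- At each point, the frame of κ and the given frame have the same normal and, because both fields
  -- are parallel, the same second vector; hence their spin lifts agree up to sign.
  have hpm : ∀ q : M.horosphere β, (((F.atPt κ q)⁻¹ * C q : SL2C) : Mat) = 1 ∨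
      (((F.atPt κ q)⁻¹ * C q : SL2C) : Mat) = -1 := by
    intro q
    set B := F.atPt κ q with hB
    have hBm : B ∈ fibre κ := F.atPt_mem_fibre κ q
    obtain ⟨u, hu⟩ := F.exists_su B (C q) (by rw [hpt, hCpt])
    rw [hu, inv_mul_cancel_left, coe_toSL]
    obtain ⟨c, hc, hcq⟩ := hphase q
    have hcz : c ≠ 0 := by rintro rfl; simp at hc
    refine SU2.eq_one_or_eq_neg_one (c := c₀ / c) ?_ ?_
    · rw [hu, hκ, mv_smul, mul_inv_rev, mv_mul, mv_inv_of_mem hBm] at hcq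
      rw [div_eq_inv_mul, ← smul_smul, ← mv_inv_mv (toSL u)⁻¹ (c₀ • baseSpinor), mv_smul, hcq,
        inv_inv, ← mv_smul, smul_smul, inv_mul_cancel₀ hcz, one_smul]
    -- The element B (C q₀)⁻¹ fixes κ, so it has trace 2 and preserves the horosphere. It moves the
    -- frame at q₀ to the frame of B at q, which carries the comparison of V from q₀ to q.
    · have hA : M.ParabolicFixing (M.horosphere β) (B * (C q₀)⁻¹) := by
        have hfix : mv (B * (C q₀)⁻¹) κ = κ := by
          rw [mv_mul, mv_inv_of_mem hC₀mem]
          exact hBm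
        refine ⟨Or.inl (trace_eq_two κ.2 hfix), ?_⟩
        rw [hhorκ, F.image_act, hfix]
      have hVq := hV.2 _ hA q₀ q₀.2
      rw [← (hspec q₀).2.2, ← hCvec, ← hCpt q₀, F.fderiv_act, F.act_pt, inv_mul_cancel_right,
        hpt, ← (hspec q).2.2, ← hCvec, hu, F.vec_mul] at hVq
      rw [F.vec_eq_sum B 1] at hVq
      have := F.sum_vec_injective B hVq
      rw [conj_pauli]
      have h3 : ∀ i, rot u i 1 = (Pi.single 1 1 : Fin 3 → ℝ) i := fun i => (congrFun this i).symm
      simp_rw [h3]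
      simp [Pi.single_apply]
  have := F.preconnectedSpace_horosphere h
  -- The sign is continuous on a connected horosphere and equals 1 at q₀.
  have hone : ∀ q : M.horosphere β, (F.atPt κ q)⁻¹ * C q = 1 := by
    refine fun q => eq_one_of_connected (x₀ := q₀)
      (f := fun q : M.horosphere β => (F.atPt κ q)⁻¹ * C q) ?_ hpm ?_ q
    · exact (F.continuous_atPt_horosphere β κ).inv.mul (F.continuous_unframe.comp hw)
    · have : F.atPt κ q₀ = C q₀ := by
        have := F.atPt_pt hC₀mem
        rwa [hCpt] at this
      change (F.atPt κ q₀)⁻¹ * C q₀ = 1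
      rw [this, inv_mul_cancel]
  refine ⟨κ, h, ?_⟩
  rw [← F.range_atPt h F.frame]
  congr 1
  funext q
  rw [inv_mul_eq_one.1 (hone q), F.frame_unframe]

lemma spinDec_surjective : Function.Surjective F.spinDec := by
  intro x
  obtain ⟨β, hβ, hhor, -, hout⟩ := x.isSpinDec
  obtain ⟨κ, h, hW⟩ := F.exists_eq_of_isOutward hβ hout
  refine ⟨κ, SpinDecHorosphere.ext ?_ ?_ ?_⟩
  · rw [hhor, F.horosphere_eq h]; rfl
  · rw [x.in_of_out, hW, F.rotated_image]; rfl
  · rw [hW]; rfl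

lemma spinDec_injective : Function.Injective F.spinDec := by
  intro κ κ' h
  have hW : F.frame '' fibre κ = F.frame '' fibre κ' := congrArg SpinDecHorosphere.Wout h
  have hm : slOf κ ∈ fibre κ' := by
    have : fibre κ = fibre κ' := F.frame_injective.image_injective hW
    rw [← this]; exact slOf_mem_fibre κ
  apply Subtype.ext
  rw [← (show mv (slOf κ) baseSpinor = κ' from hm), mv_slOf]

/-- The frame of `slOf κ` is a continuous choice of a frame in the outward decoration of κ;
composing with the quotient map gives continuity. -/
lemma continuous_spinDec : Continuous F.spinDec := by
  let Z := {z : SpinDecHorosphere M × SpinFrame M // z.2 ∈ z.1.Wout}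
  let _ : TopologicalSpace Z := TopologicalSpace.induced (fun z => z.1.2) inferInstance
  let g : nonzeroSpinors → Z := fun κ =>
    ⟨(F.spinDec κ, F.frame (slOf κ)), ⟨_, slOf_mem_fibre κ, rfl⟩⟩
  have hg : Continuous g := continuous_induced_rng.2 (F.continuous_frame.comp continuous_slOf)
  have hp : Continuous fun z : Z => z.1.1 := continuous_coinduced_rng
  exact hp.comp hg

/-- The bijection of nonzero spinors with spin-decorated horospheres. -/
def spinDecEquiv : nonzeroSpinors ≃ SpinDecHorosphere M :=
  Equiv.ofBijective F.spinDec ⟨F.spinDec_injective, F.spinDec_surjective⟩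

/-- The homeomorphism of nonzero spinors with spin-decorated horospheres. -/
def spinDecHomeo : nonzeroSpinors ≃ₜ SpinDecHorosphere M where
  toEquiv := F.spinDecEquiv
  continuous_toFun := F.continuous_spinDec
  continuous_invFun := by
    refine continuous_coinduced_dom.2 ?_
    refine continuous_induced_rng.2 ?_
    -- On spin frames the inverse is s ↦ (unframe s) κ₀. It takes the same value on all frames of
    -- one outward decoration, so it descends continuously to the quotient.
    have hc : Continuous fun s : SpinFrame M => mv (F.unframe s) baseSpinor :=
      continuous_mv F.continuous_unframe continuous_const
    let Z := {z : SpinDecHorosphere M × SpinFrame M // z.2 ∈ z.1.Wout}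
    let _ : TopologicalSpace Z := TopologicalSpace.induced (fun z => z.1.2) inferInstance
    have hp : Continuous fun z : Z => z.1.2 := continuous_induced_dom
    refine (hc.comp hp).congr ?_
    rintro ⟨⟨x, s⟩, hs⟩
    obtain ⟨κ, rfl⟩ := F.spinDec_surjective x
    have hs' : s ∈ F.frame '' fibre κ := hs
    obtain ⟨B, hB, hBs⟩ := hs'
    have h1 : F.spinDecEquiv.symm (F.spinDec κ) = κ := F.spinDecEquiv.symm_apply_apply κ
    change mv (F.unframe s) baseSpinor =
      ((F.spinDecEquiv.symm (F.spinDec κ) : nonzeroSpinors) : Fin 2 → ℂ)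
    rw [h1, ← hBs, F.unframe_frame]
    exact hB

@[simp] lemma spinDecHomeo_symm_spinDec (κ : nonzeroSpinors) :
    F.spinDecHomeo.symm (F.spinDec κ) = κ := F.spinDecHomeo.symm_apply_apply κ

lemma mem_line_toDec {κ : nonzeroSpinors} {z : E × E} : z ∈ (F.spinDec κ).toDec.line ↔
    ∃ B ∈ fibre κ, ∃ c : ℝ, 0 < c ∧ z = (F.pt B, c • F.vec B 1) := by
  constructor
  · rintro ⟨_, ⟨B, hB, rfl⟩, h⟩
    exact ⟨B, hB, h⟩
  · rintro ⟨B, hB, h⟩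
    exact ⟨_, ⟨B, hB, rfl⟩, h⟩

lemma hor_toDec (κ : nonzeroSpinors) : (F.spinDec κ).toDec.hor = F.pt '' fibre κ := rfl

lemma vec_ne_zero (B : SL2C) (j : Fin 3) : F.vec B j ≠ 0 := by
  intro h
  have h1 : ∑ i, (Pi.single j 1 : Fin 3 → ℝ) i • F.vec B i = ∑ i, (0 : Fin 3 → ℝ) i • F.vec B i := by
    rw [← F.vec_eq_sum, h]; simp
  have := congrFun (F.sum_vec_injective B h1) j
  simp at this

lemma isDecorated (κ : nonzeroSpinors) : IsDecorated M (F.spinDec κ).toDec := by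
  obtain ⟨β, hβ, h⟩ := F.horo_of κ κ.2
  refine ⟨β, hβ, (F.horosphere_eq h).symm, ?_, ?_, ?_⟩
  · intro z hz
    obtain ⟨B, hB, c, -, rfl⟩ := F.mem_line_toDec.1 hz
    exact ⟨B, hB, rfl⟩
  · rintro _ ⟨B, hB, rfl⟩
    refine ⟨F.vec B 1, F.vec_ne_zero B 1, F.tangentTo_vec_one h hB, ?_⟩
    ext v
    rw [Set.mem_ofPred_eq, F.mem_line_toDec]
    constructor
    · rintro ⟨C, hC, c, hc, he⟩
      have h1 := congrArg Prod.fst he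
      have h2 := congrArg Prod.snd he
      rw [← F.eq_of_mem_fibre hB hC h1] at h2
      exact ⟨c, hc, h2⟩
    · rintro ⟨c, hc, rfl⟩
      exact ⟨B, hB, c, hc, rfl⟩
  · intro A hA
    ext z
    constructor
    · rintro ⟨z', hz', rfl⟩
      obtain ⟨B, hB, c, hc, rfl⟩ := F.mem_line_toDec.1 hz'
      obtain ⟨C, hC, hpt, hvec⟩ := F.exists_parabolic_image hA hB
      refine F.mem_line_toDec.2 ⟨C, hC, c, hc, ?_⟩
      simp [hpt, hvec]
    · intro hz
      obtain ⟨C, hC, c, hc, rfl⟩ := F.mem_line_toDec.1 hz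
      obtain ⟨B, hB, hpt, hvec⟩ := F.exists_parabolic_preimage hA hC
      refine ⟨_, F.mem_line_toDec.2 ⟨B, hB, c, hc, rfl⟩, ?_⟩
      simp [hpt, hvec]

/-! ### The action of `SL(2, ℂ)` -/

/-- A lifted path of frames and the path γ(t) B have the same points and vectors, so they differ by
±1 at each time. They agree at time 0, and the interval is connected. A path γ exists because SL(2,
ℂ) is path connected. -/
lemma spinAct_iff (A B : SL2C) (s : SpinFrame M) : SpinAct A (F.frame B) s ↔ s = F.frame (A * B) := by
  constructor
  · rintro ⟨γ, σ, h⟩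
    have hpm : ∀ t, (((γ t * B)⁻¹ * F.unframe (σ t) : SL2C) : Mat) = 1 ∨
        (((γ t * B)⁻¹ * F.unframe (σ t) : SL2C) : Mat) = -1 := by
      intro t
      obtain ⟨h1, h2⟩ := h t
      obtain ⟨u, hu⟩ := F.exists_su (γ t * B) (F.unframe (σ t)) (by
        rw [F.pt_unframe, h1, ← F.act_pt]; rfl)
      have hrot : ∀ j, (u : Mat) * pauli j * (u : Mat)ᴴ = pauli j := by
        intro j
        have h3 := congrArg (fun s => s.vec j) (F.frame_unframe (σ t))
        change F.vec (F.unframe (σ t)) j = (σ t).vec j at h3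
        rw [h2 j, hu, F.vec_mul] at h3
        change _ = fderiv ℝ (M.act (γ t)) (F.pt B) (F.vec B j) at h3
        rw [F.fderiv_act, F.vec_eq_sum (γ t * B) j] at h3
        have h4 := F.sum_vec_injective _ h3
        have h5 : ∀ i, rot u i j = (Pi.single j 1 : Fin 3 → ℝ) i := fun i => congrFun h4 i
        rw [conj_pauli]
        simp_rw [h5]
        simp [Pi.single_apply]
      rw [hu, inv_mul_cancel_left, coe_toSL]
      obtain ⟨c, hc⟩ := SU2.exists_smul_baseSpinor (hrot 0)
      exact SU2.eq_one_or_eq_neg_one hc (hrot 1)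
    have hone := eq_one_of_connected (x₀ := (0 : unitInterval))
      (f := fun t => (γ t * B)⁻¹ * F.unframe (σ t))
      ((γ.continuous.mul continuous_const).inv.mul (F.continuous_unframe.comp σ.continuous)) hpm
      (by simp [F.unframe_frame]) 1
    simp only [γ.target, σ.target] at hone
    rw [inv_mul_eq_one.1 hone, F.frame_unframe]
  · rintro rfl
    let γ : Path (1 : SL2C) A := (PathConnectedSpace.joined 1 A).somePath
    refine ⟨γ, ⟨⟨fun t => F.frame (γ t * B), F.continuous_frame.comp
      (γ.continuous.mul continuous_const)⟩, by simp, by simp⟩, fun t => ⟨?_, fun j => ?_⟩⟩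
    · exact (F.act_pt (γ t) B).symm
    · exact (F.fderiv_act (γ t) B j).symm

lemma spinAct_image (A : SL2C) (S : Set SL2C) :
    {s' | ∃ s ∈ F.frame '' S, SpinAct A s s'} = (fun B => F.frame (A * B)) '' S := by
  ext s
  constructor
  · rintro ⟨_, ⟨B, hB, rfl⟩, h⟩
    exact ⟨B, hB, ((F.spinAct_iff A B s).1 h).symm⟩
  · rintro ⟨B, hB, rfl⟩
    exact ⟨_, ⟨B, hB, rfl⟩, (F.spinAct_iff A B _).2 rfl⟩

lemma image_mul_fibre {X : Type*} (A : SL2C) (κ : Fin 2 → ℂ) (g : SL2C → X) :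
    (fun B => g (A * B)) '' fibre κ = g '' fibre (mv A κ) := by
  ext x
  constructor
  · rintro ⟨B, hB, rfl⟩
    exact ⟨_, mul_mem_fibre A hB, rfl⟩
  · rintro ⟨B, hB, rfl⟩
    exact ⟨A⁻¹ * B, by simpa using mul_mem_fibre A⁻¹ hB, by simp⟩

/-- Left multiplication by A carries the fibre of κ onto that of A κ, and it commutes with the right
multiplication that produces the inward decoration. -/
lemma horoAct_spinDec (A : SL2C) (κ : nonzeroSpinors) (y : SpinDecHorosphere M) :
    HoroAct A (F.spinDec κ) y ↔ y = F.spinDec (spinorAct A κ) := by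
  have h1 : M.act A '' (F.spinDec κ).hor = (F.spinDec (spinorAct A κ)).hor := F.image_act A κ
  have h2 : {s' | ∃ s ∈ (F.spinDec κ).Wout, SpinAct A s s'} = (F.spinDec (spinorAct A κ)).Wout := by
    change {s' | ∃ s ∈ F.frame '' fibre κ, SpinAct A s s'} = F.frame '' fibre (mv A κ)
    rw [F.spinAct_image, image_mul_fibre A κ F.frame]
  have h3 : {s' | ∃ s ∈ (F.spinDec κ).Win, SpinAct A s s'} = (F.spinDec (spinorAct A κ)).Win := by
    change {s' | ∃ s ∈ (fun B => F.frame (B * toSL (suRot Real.pi))) '' fibre κ, SpinAct A s s'} =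
      (fun B => F.frame (B * toSL (suRot Real.pi))) '' fibre (mv A κ)
    rw [← Set.image_image F.frame (fun B => B * toSL (suRot Real.pi)), F.spinAct_image,
      Set.image_image, ← image_mul_fibre A κ fun B => F.frame (B * toSL (suRot Real.pi))]
    simp only [mul_assoc]
  rw [HoroAct, h1, h2, h3]
  constructor
  · rintro ⟨e1, e2, e3⟩
    exact SpinDecHorosphere.ext e1 e2 e3
  · rintro rfl
    exact ⟨rfl, rfl, rfl⟩

end Framing
/-! ### Minkowski space and Hermitian matrices -/

lemma gMap_apply (S : Mat) : gMap S =
    ![(S 0 0).re + (S 1 1).re, 2 * (S 0 1).re, 2 * (S 0 1).im, (S 0 0).re - (S 1 1).re] := rfl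

lemma gInv_gMap {S : Mat} (hS : S.IsHermitian) : gInv (gMap S) = S := by
  have h00 := congrFun (congrFun hS 0) 0
  have h01 := congrFun (congrFun hS 0) 1
  have h11 := congrFun (congrFun hS 1) 1
  simp only [Matrix.conjTranspose_apply, Complex.star_def, Complex.ext_iff, Complex.conj_re,
    Complex.conj_im] at h00 h01 h11
  rw [gMap_apply]
  ext k l
  fin_cases k <;> fin_cases l <;> apply Complex.ext <;>
    simp [gInv] <;> linarith

lemma gMap_injOn {S S' : Mat} (hS : S.IsHermitian) (hS' : S'.IsHermitian) (h : gMap S = gMap S') :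
    S = S' := by
  rw [← gInv_gMap hS, h, gInv_gMap hS']

/-- The Minkowski form is the polarisation of 4 det. -/
lemma mink_gMap {S S' : Mat} (hS : S.IsHermitian) (hS' : S'.IsHermitian) :
    mink (gMap S) (gMap S') = 2 * (S.adjugate * S').trace.re := by
  have h00 := congrFun (congrFun hS 0) 0
  have h01 := congrFun (congrFun hS 0) 1
  have h11 := congrFun (congrFun hS 1) 1
  have k00 := congrFun (congrFun hS' 0) 0
  have k01 := congrFun (congrFun hS' 0) 1
  have k11 := congrFun (congrFun hS' 1) 1
  simp only [Matrix.conjTranspose_apply, Complex.star_def, Complex.ext_iff, Complex.conj_re,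
    Complex.conj_im] at h00 h01 h11 k00 k01 k11
  rw [gMap_apply, gMap_apply, Matrix.adjugate_fin_two, Matrix.trace_fin_two]
  simp [mink, Matrix.mul_apply, Fin.sum_univ_two]
  have e1 : (S 0 0).im = 0 := by linarith [h00.2]
  have e2 : (S 1 1).im = 0 := by linarith [h11.2]
  have e3 : (S 1 0).re = (S 0 1).re := h01.1
  have e4 : (S 1 0).im = -(S 0 1).im := by linarith [h01.2]
  have e5 : (S' 1 0).re = (S' 0 1).re := k01.1
  have e6 : (S' 1 0).im = -(S' 0 1).im := by linarith [k01.2]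
  rw [e1, e2, e3, e4, e5, e6]
  ring

lemma isHermitian_conj (B : SL2C) {S : Mat} (hS : S.IsHermitian) :
    ((B : Mat) * S * (B : Mat)ᴴ).IsHermitian :=
  Matrix.isHermitian_mul_mul_conjTranspose _ hS

/-- The adjugate is multiplicative in reverse order, so the factors of determinant one cancel under
the trace. -/
lemma mink_gMap_conj (B : SL2C) {S S' : Mat} (hS : S.IsHermitian) (hS' : S'.IsHermitian) :
    mink (gMap ((B : Mat) * S * (B : Mat)ᴴ)) (gMap ((B : Mat) * S' * (B : Mat)ᴴ)) =
      mink (gMap S) (gMap S') := by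
  rw [mink_gMap (isHermitian_conj B hS) (isHermitian_conj B hS'), mink_gMap hS hS',
    Matrix.adjugate_mul_distrib, Matrix.adjugate_mul_distrib]
  have h1 : (B : Mat).adjugate * (B : Mat) = 1 := by rw [Matrix.adjugate_mul, B.2, one_smul]
  have h2 : (B : Mat)ᴴ * (B : Mat)ᴴ.adjugate = 1 := by
    rw [Matrix.mul_adjugate, Matrix.det_conjTranspose, B.2, star_one, one_smul]
  have h3 : (B : Mat)ᴴ.adjugate * (S.adjugate * (B : Mat).adjugate) * ((B : Mat) * S' * (B : Mat)ᴴ) =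
      (B : Mat)ᴴ.adjugate * (S.adjugate * ((B : Mat).adjugate * (B : Mat)) * S' * (B : Mat)ᴴ) := by
    simp only [mul_assoc]
  rw [h3, h1, mul_one, Matrix.trace_mul_comm, mul_assoc, h2, mul_one]

/-- The vector of Minkowski space with Hermitian matrix `B S B^* / 2`, normalised so that the Pauli
matrices give the coordinate vectors. -/
def conjVec (B : SL2C) (S : Mat) : Mink := (1 / 2 : ℝ) • gMap ((B : Mat) * S * (B : Mat)ᴴ)

/-- The point of the hyperboloid with Hermitian matrix `B B^*`. -/
def hyp (B : SL2C) : Mink := conjVec B 1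

lemma conjVec_sum (B : SL2C) (x : Fin 3 → ℝ) :
    conjVec B (∑ i, x i • pauli i) = ∑ i, x i • conjVec B (pauli i) := by
  simp only [conjVec, Matrix.mul_sum, Matrix.sum_mul, map_sum, Finset.smul_sum, Matrix.mul_smul,
    Matrix.smul_mul, map_smul]
  refine Finset.sum_congr rfl fun i _ => ?_
  rw [smul_comm]

lemma conjVec_mul_toSL (B : SL2C) (u : SU2) (j : Fin 3) :
    conjVec (B * toSL u) (pauli j) = ∑ i, rot u i j • conjVec B (pauli i) := by
  rw [← conjVec_sum, ← conj_pauli, conjVec, conjVec, Matrix.SpecialLinearGroup.coe_mul,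
    Matrix.conjTranspose_mul]
  simp only [mul_assoc, coe_toSL]

lemma hyp_mul_toSL (B : SL2C) (u : SU2) : hyp (B * toSL u) = hyp B := by
  have h : (B : Mat) * (u : Mat) * ((u : Mat)ᴴ * (B : Mat)ᴴ) =
      (B : Mat) * ((u : Mat) * (u : Mat)ᴴ) * (B : Mat)ᴴ := by simp only [mul_assoc]
  rw [hyp, hyp, conjVec, conjVec, Matrix.SpecialLinearGroup.coe_mul, Matrix.conjTranspose_mul, mul_one,
    mul_one, coe_toSL, h, SU2.mul_conjTranspose, mul_one]

lemma minkAct_conjVec (A B : SL2C) {S : Mat} (hS : S.IsHermitian) :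
    minkAct A (conjVec B S) = conjVec (A * B) S := by
  have h := isHermitian_conj B hS
  rw [minkAct, conjVec, conjVec, ← map_smul, gInv_gMap (h.smul (by simp [IsSelfAdjoint])), Matrix.mul_smul,
    Matrix.smul_mul, map_smul, Matrix.SpecialLinearGroup.coe_mul, Matrix.conjTranspose_mul]
  simp only [mul_assoc]

lemma mink_smul_left (c : ℝ) (p q : Mink) : mink (c • p) q = c * mink p q := by
  simp [mink]; ring

lemma mink_add_right (p q r : Mink) : mink p (q + r) = mink p q + mink p r := by
  simp [mink]; ring

lemma mink_smul_right (c : ℝ) (p q : Mink) : mink p (c • q) = c * mink p q := by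
  simp [mink]; ring

lemma isHermitian_one : (1 : Mat).IsHermitian := Matrix.isHermitian_one

lemma hyp_mem (B : SL2C) : hyp B ∈ hyperboloid.carrier := by
  constructor
  · rw [hyp, conjVec, mink_smul_left, mink_smul_right, mink_gMap_conj B isHermitian_one isHermitian_one]
    simp [gMap_apply, mink]; norm_num
  · have hd := B.2
    rw [Matrix.det_fin_two] at hd
    simp [hyp, conjVec, gMap_apply, Matrix.mul_apply, Fin.sum_univ_two]
    have : (B : Mat) 0 0 ≠ 0 ∨ (B : Mat) 0 1 ≠ 0 := by
      by_contra h
      push Not at h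
      rw [h.1, h.2] at hd
      simp at hd
    have e : ∀ z : ℂ, 0 ≤ z.re * z.re + z.im * z.im := fun z =>
      add_nonneg (mul_self_nonneg _) (mul_self_nonneg _)
    have e' : ∀ z : ℂ, z ≠ 0 → 0 < z.re * z.re + z.im * z.im := fun z hz => by
      have := Complex.normSq_pos.2 hz
      rwa [Complex.normSq_apply] at this
    rcases this with h | h
    · linarith [e' _ h, e ((B : Mat) 0 1), e ((B : Mat) 1 0), e ((B : Mat) 1 1)]
    · linarith [e' _ h, e ((B : Mat) 0 0), e ((B : Mat) 1 0), e ((B : Mat) 1 1)]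

lemma mink_hyp_conjVec (B : SL2C) (j : Fin 3) : mink (hyp B) (conjVec B (pauli j)) = 0 := by
  rw [hyp, conjVec, conjVec, mink_smul_left, mink_smul_right,
    mink_gMap_conj B isHermitian_one (pauli_isHermitian j)]
  fin_cases j <;> simp [gMap_apply, mink, pauli]

/-- The point determines B B^*, and B B^* = C C^* says that B⁻¹C is unitary. -/
lemma exists_su_of_hyp_eq {B C : SL2C} (h : hyp B = hyp C) : ∃ u : SU2, C = B * toSL u := by
  have h1 : (B : Mat) * (B : Mat)ᴴ = (C : Mat) * (C : Mat)ᴴ := by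
    have h0 : gMap ((B : Mat) * 1 * (B : Mat)ᴴ) = gMap ((C : Mat) * 1 * (C : Mat)ᴴ) := by
      have : (1 / 2 : ℝ) ≠ 0 := by norm_num
      exact smul_right_injective Mink this h
    have := gMap_injOn (isHermitian_conj B isHermitian_one) (isHermitian_conj C isHermitian_one) h0
    simpa using this
  have hu : ((B⁻¹ * C : SL2C) : Mat) ∈ Matrix.specialUnitaryGroup (Fin 2) ℂ := by
    rw [Matrix.mem_specialUnitaryGroup_iff, Matrix.mem_unitaryGroup_iff]
    refine ⟨?_, (B⁻¹ * C).2⟩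
    have hB : ((B⁻¹ : SL2C) : Mat) * (B : Mat) = 1 := by
      rw [← Matrix.SpecialLinearGroup.coe_mul, inv_mul_cancel, Matrix.SpecialLinearGroup.coe_one]
    rw [Matrix.star_eq_conjTranspose, Matrix.SpecialLinearGroup.coe_mul, Matrix.conjTranspose_mul]
    calc ((B⁻¹ : SL2C) : Mat) * (C : Mat) * ((C : Mat)ᴴ * ((B⁻¹ : SL2C) : Mat)ᴴ)
        = ((B⁻¹ : SL2C) : Mat) * ((C : Mat) * (C : Mat)ᴴ) * ((B⁻¹ : SL2C) : Mat)ᴴ := by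
          simp only [mul_assoc]
      _ = (((B⁻¹ : SL2C) : Mat) * (B : Mat)) * (((B⁻¹ : SL2C) : Mat) * (B : Mat))ᴴ := by
          rw [← h1, Matrix.conjTranspose_mul]; simp only [mul_assoc]
      _ = 1 := by rw [hB]; simp
  refine ⟨⟨_, hu⟩, ?_⟩
  have : toSL ⟨_, hu⟩ = B⁻¹ * C := Subtype.ext rfl
  rw [this, mul_inv_cancel_left]

/-! ### Null vectors of spinors -/

lemma fMap_isHermitian (κ : Fin 2 → ℂ) : (fMap κ).IsHermitian := by
  rw [fMap, Matrix.IsHermitian, Matrix.conjTranspose_vecMulVec, star_star]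

lemma fMap_mv (B : SL2C) (κ : Fin 2 → ℂ) : fMap (mv B κ) = (B : Mat) * fMap κ * (B : Mat)ᴴ := by
  rw [fMap, fMap, Matrix.mul_vecMulVec, Matrix.vecMulVec_mul, mv, Matrix.star_mulVec]

lemma mink_conjVec_fMap (B : SL2C) {S : Mat} (hS : S.IsHermitian) (κ : Fin 2 → ℂ) :
    mink (conjVec B S) (gMap (fMap κ)) = (1 / 2) * mink (gMap S) (gMap (fMap (mv B⁻¹ κ))) := by
  conv_lhs => rw [← mv_mv_inv B κ, fMap_mv, conjVec, mink_smul_left,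
    mink_gMap_conj B hS (fMap_isHermitian _)]

/-- Move everything back to the origin by B⁻¹: the product of (1, 0, 0, 0) with the null vector of a
spinor is its time coordinate, the squared norm. This is the source of the norm condition in
`HoroRep`. -/
lemma mink_hyp_fMap (B : SL2C) (κ : Fin 2 → ℂ) :
    mink (hyp B) (gMap (fMap κ)) = spinorNormSq (mv B⁻¹ κ) := by
  rw [hyp, mink_conjVec_fMap B isHermitian_one]
  simp [gMap_apply, mink, fMap, Matrix.vecMulVec_apply, spinorNormSq, Complex.normSq_apply]
  ring

/-- The spatial counterpart, which is the source of the derivative condition in `HoroRep`. -/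
lemma mink_conjVec_pauli_fMap (B : SL2C) (j : Fin 3) (κ : Fin 2 → ℂ) :
    mink (conjVec B (pauli j)) (gMap (fMap κ)) = -spinorDir (mv B⁻¹ κ) j := by
  rw [mink_conjVec_fMap B (pauli_isHermitian j)]
  generalize mv B⁻¹ κ = ν
  fin_cases j <;>
  simp [gMap_apply, mink, fMap, Matrix.vecMulVec_apply, spinorDir, pauli, dotProduct,
    Fin.sum_univ_two, Matrix.mulVec] <;> ring

lemma gMap_fMap_mem {κ : Fin 2 → ℂ} (h : κ ≠ 0) : gMap (fMap κ) ∈ lightCone := by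
  constructor
  · simp [gMap_apply, mink, fMap, Matrix.vecMulVec_apply]; ring
  · have := spinorNormSq_pos h
    simp [spinorNormSq, Complex.normSq_apply] at this
    simp [gMap_apply, fMap, Matrix.vecMulVec_apply]
    linarith

lemma gMap_fMap (κ : Fin 2 → ℂ) : gMap (fMap κ) =
    ![Complex.normSq (κ 0) + Complex.normSq (κ 1), 2 * ((κ 0).re * (κ 1).re + (κ 0).im * (κ 1).im),
      2 * ((κ 0).im * (κ 1).re - (κ 0).re * (κ 1).im),
      Complex.normSq (κ 0) - Complex.normSq (κ 1)] := by
  ext i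
  fin_cases i <;> simp [gMap_apply, fMap, Matrix.vecMulVec_apply, Complex.normSq_apply]
  ring

/-- A null vector determines κ up to phase. The phase is normalised by taking κ₀ real and positive
where p₀ + p₃ ≠ 0; otherwise the first component is zero and the second is √p₀. -/
lemma exists_gMap_fMap {p : Mink} (h : p ∈ lightCone) : ∃ κ : Fin 2 → ℂ, κ ≠ 0 ∧ gMap (fMap κ) = p := by
  obtain ⟨h0, hp⟩ := h
  have key : ∃ κ : Fin 2 → ℂ, gMap (fMap κ) = p := by
    simp only [mink] at h0
    by_cases h3 : p 0 + p 3 = 0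
    · refine ⟨![0, (Real.sqrt (p 0) : ℂ)], ?_⟩
      have hs := Real.mul_self_sqrt hp.le
      have e3 : p 3 = -p 0 := by linarith
      rw [e3] at h0
      have e1 : p 1 = 0 := by nlinarith [sq_nonneg (p 1), sq_nonneg (p 2)]
      have e2 : p 2 = 0 := by nlinarith [sq_nonneg (p 1), sq_nonneg (p 2)]
      rw [gMap_fMap]
      ext i
      fin_cases i <;> simp [hs, e1, e2, e3]
    · have hpos : 0 < p 0 + p 3 := by
        have h4 : 0 ≤ (p 0 + p 3) * (p 0 - p 3) := by nlinarith [sq_nonneg (p 1), sq_nonneg (p 2)]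
        rcases lt_or_gt_of_ne h3 with h5 | h5
        · nlinarith
        · exact h5
      set r := Real.sqrt ((p 0 + p 3) / 2) with hr
      have hs : r * r = (p 0 + p 3) / 2 := Real.mul_self_sqrt (by linarith)
      have hr0 : r ≠ 0 := by intro h; rw [h] at hs; linarith
      refine ⟨![(r : ℂ), ⟨p 1 / (2 * r), -p 2 / (2 * r)⟩], ?_⟩
      have e : p 1 / (2 * r) * (p 1 / (2 * r)) + p 2 / (2 * r) * (p 2 / (2 * r)) = (p 0 - p 3) / 2 := by
        field_simp
        rw [show r ^ 2 = r * r by ring, hs]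
        linear_combination -h0
      rw [gMap_fMap]
      ext i
      fin_cases i <;> simp [Complex.normSq_apply]
      · rw [hs]; linear_combination e
      · field_simp
      · field_simp
      · rw [hs]; linear_combination -e
  obtain ⟨κ, hκ⟩ := key
  refine ⟨κ, ?_, hκ⟩
  rintro rfl
  rw [← hκ] at hp
  simp [gMap_apply, fMap] at hp

lemma continuous_gMap : Continuous gMap := gMap.continuous_of_finiteDimensional

lemma continuous_conjVec (S : Mat) : Continuous fun B => conjVec B S := by
  have h : Continuous fun B : SL2C => (B : Mat) := continuous_induced_dom
  exact (continuous_const (y := (1 / 2 : ℝ))).smul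
    (continuous_gMap.comp ((h.matrix_mul continuous_const).matrix_mul h.matrix_conjTranspose))

/-! ### Tangential derivatives on the hyperboloid -/

/-- The projection to the hyperboloid along the time axis. -/
def hypRetract (x : Mink) : Mink :=
  ![Real.sqrt (1 + x 1 ^ 2 + x 2 ^ 2 + x 3 ^ 2), x 1, x 2, x 3]

lemma hypRetract_mem (x : Mink) : hypRetract x ∈ hyperboloid.carrier := by
  have h : 0 < 1 + x 1 ^ 2 + x 2 ^ 2 + x 3 ^ 2 := by positivity
  constructor
  · simp [hypRetract, mink, Real.mul_self_sqrt h.le]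
    ring
  · simpa [hypRetract] using h

lemma hypRetract_eq {x : Mink} (hx : x ∈ hyperboloid.carrier) : hypRetract x = x := by
  obtain ⟨h1, h2⟩ := hx
  simp only [mink] at h1
  ext i
  fin_cases i <;> simp [hypRetract]
  rw [Real.sqrt_eq_iff_mul_self_eq (by positivity) h2.le]
  linarith

/-- Its time component has differential (x₁v₁ + x₂v₂ + x₃v₃)/x₀, which is v₀ exactly on tangent
vectors. The retraction extends equalities on the hyperboloid to equalities in the ambient space,
where `fderiv` is taken. -/
lemma hasFDerivAt_hypRetract {x : Mink} (hx : x ∈ hyperboloid.carrier) :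
    ∃ L : Mink →L[ℝ] Mink, HasFDerivAt hypRetract L x ∧ ∀ v, mink x v = 0 → L v = v := by
  have hpos : 0 < 1 + x 1 ^ 2 + x 2 ^ 2 + x 3 ^ 2 := by positivity
  have hs : Real.sqrt (1 + x 1 ^ 2 + x 2 ^ 2 + x 3 ^ 2) = x 0 := by
    have := congrFun (hypRetract_eq hx) 0
    simpa [hypRetract] using this
  have hp : ∀ i : Fin 4, HasFDerivAt (fun y : Mink => y i) (ContinuousLinearMap.proj i : Mink →L[ℝ] ℝ) x :=
    fun i => hasFDerivAt_apply i x
  obtain ⟨L, hL, hLv⟩ : ∃ L : Mink →L[ℝ] ℝ,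
      HasFDerivAt (fun y : Mink => Real.sqrt (1 + y 1 ^ 2 + y 2 ^ 2 + y 3 ^ 2)) L x ∧
        ∀ v, L v = (x 1 * v 1 + x 2 * v 2 + x 3 * v 3) / x 0 := by
    refine ⟨_, HasFDerivAt.sqrt (((((hp 1).pow 2).const_add 1).add ((hp 2).pow 2)).add
      ((hp 3).pow 2)) hpos.ne', fun v => ?_⟩
    have hx0 := hx.2.ne'
    simp [hs]
    field_simp
  refine ⟨ContinuousLinearMap.pi ![L, ContinuousLinearMap.proj 1, ContinuousLinearMap.proj 2,
    ContinuousLinearMap.proj 3], hasFDerivAt_pi.2 fun i => ?_, fun v hv => ?_⟩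
  · fin_cases i
    · exact hL
    · exact hp 1
    · exact hp 2
    · exact hp 3
  · ext i
    simp only [mink] at hv
    have hx0 := hx.2.ne'
    fin_cases i <;> simp [hLv]
    field_simp
    linarith

/-- Differentiable maps which agree on the hyperboloid have the same tangential derivatives. -/
lemma fderiv_eq_of_eqOn {G : Type*} [NormedAddCommGroup G] [NormedSpace ℝ G] {f g : Mink → G}
    (hfg : Set.EqOn f g hyperboloid.carrier) {x v : Mink} (hx : x ∈ hyperboloid.carrier)
    (hv : mink x v = 0) (hf : DifferentiableAt ℝ f x) (hg : DifferentiableAt ℝ g x) :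
    fderiv ℝ f x v = fderiv ℝ g x v := by
  obtain ⟨L, hL, hLv⟩ := hasFDerivAt_hypRetract hx
  have h1 : HasFDerivAt (f ∘ hypRetract) ((fderiv ℝ f x).comp L) x := by
    apply HasFDerivAt.comp
    · rw [hypRetract_eq hx]; exact hf.hasFDerivAt
    · exact hL
  have h2 : HasFDerivAt (g ∘ hypRetract) ((fderiv ℝ g x).comp L) x := by
    apply HasFDerivAt.comp
    · rw [hypRetract_eq hx]; exact hg.hasFDerivAt
    · exact hL
  have h3 : f ∘ hypRetract = g ∘ hypRetract := funext fun y => hfg (hypRetract_mem y)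
  rw [h3] at h1
  have := congrArg (fun T => T v) (h1.unique h2)
  simpa [hLv v hv] using this

/-- `minkAct A` as a continuous linear map. -/
def minkActL (A : SL2C) : Mink →L[ℝ] Mink :=
  LinearMap.toContinuousLinearMap
    { toFun := minkAct A
      map_add' := fun p q => by
        have : gInv (p + q) = gInv p + gInv q := by
          ext i j; fin_cases i <;> fin_cases j <;> simp [gInv] <;> ring
        rw [minkAct, this, mul_add, add_mul, map_add]; rfl
      map_smul' := fun c p => by
        have : gInv (c • p) = c • gInv p := by
          ext i j; fin_cases i <;> fin_cases j <;> simp [gInv] <;> ring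
        rw [minkAct, this, Matrix.mul_smul, Matrix.smul_mul, map_smul]; rfl }

lemma hasFDerivAt_minkAct (A : SL2C) (x : Mink) : HasFDerivAt (minkAct A) (minkActL A) x :=
  (minkActL A).hasFDerivAt

/-! ### Framings from isometries with the hyperboloid model -/

/-- Under the map `φ`, the function `β` is a positive multiple of `⟨x, p⟩ - 1` on the hyperboloid. -/
def HoroCut {E : Type} [NormedAddCommGroup E] [NormedSpace ℝ E] (φ : Mink → E) (β : E → ℝ)
    (p : Mink) : Prop :=
  ∃ k : Mink → ℝ, ∀ x ∈ hyperboloid.carrier, 0 < k x ∧ DifferentiableAt ℝ k x ∧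
    DifferentiableAt ℝ β (φ x) ∧ β (φ x) = k x * (mink x p - 1)

/-- An isometry from the hyperboloid model to the model `M`, compatible with the actions of
`SL(2, ℂ)`, the horospheres and the orientations. -/
structure ModelChart {E : Type} [NormedAddCommGroup E] [NormedSpace ℝ E] (M : HypModel E) where
  /-- the isometry -/
  φ : Mink → E
  /-- elements of `SL(2, ℂ)` which give the global frame field -/
  sec : E → SL2C
  contDiffAt : ∀ x ∈ hyperboloid.carrier, ContDiffAt ℝ 1 φ x
  map_mem : ∀ x ∈ hyperboloid.carrier, φ x ∈ M.carrier
  injOn : Set.InjOn φ hyperboloid.carrier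
  map_sec : ∀ q ∈ M.carrier, φ (hyp (sec q)) = q
  continuousOn_sec : ContinuousOn sec M.carrier
  fderiv_sec : ∀ q ∈ M.carrier, ∀ j,
    fderiv ℝ φ (hyp (sec q)) (conjVec (sec q) (pauli j)) = M.std q j
  metric_std : ∀ q ∈ M.carrier, ∀ x y : Fin 3 → ℝ,
    M.metric q (∑ i, x i • M.std q i) (∑ i, y i • M.std q i) = ∑ i, x i * y i
  mem_tangent : ∀ q ∈ M.carrier, ∀ v, v ∈ M.tangent q ↔ ∃ x : Fin 3 → ℝ, v = ∑ i, x i • M.std q i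
  act_map : ∀ A, ∀ x ∈ hyperboloid.carrier, M.act A (φ x) = φ (minkAct A x)
  differentiableAt_act : ∀ A, ∀ x ∈ hyperboloid.carrier, DifferentiableAt ℝ (M.act A) (φ x)
  horo_exists : ∀ β ∈ M.horoFun, ∃ p ∈ lightCone, HoroCut φ β p
  horo_of : ∀ p ∈ lightCone, ∃ β ∈ M.horoFun, HoroCut φ β p

lemma hasFDerivAt_mink (p x : Mink) :
    ∃ L : Mink →L[ℝ] ℝ, HasFDerivAt (fun y => mink y p - 1) L x ∧ ∀ v, L v = mink v p := by
  let L : Mink →L[ℝ] ℝ := LinearMap.toContinuousLinearMap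
    { toFun := fun y => mink y p
      map_add' := fun a b => by simp [mink]; ring
      map_smul' := fun c a => by simp [mink]; ring }
  exact ⟨L, (L.hasFDerivAt (x := x)).sub_const 1, fun v => rfl⟩

namespace ModelChart

variable {E : Type} [NormedAddCommGroup E] [NormedSpace ℝ E] {M : HypModel E} (K : ModelChart M)

lemma differentiableAt {x : Mink} (hx : x ∈ hyperboloid.carrier) : DifferentiableAt ℝ K.φ x :=
  (K.contDiffAt x hx).differentiableAt (by norm_num)

lemma minkAct_hyp (A B : SL2C) : minkAct A (hyp B) = hyp (A * B) :=
  minkAct_conjVec A B isHermitian_one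

/-- Equivariance of φ holds only on the hyperboloid, so it is differentiated in tangent directions.
-/
lemma fderiv_act_map (A B : SL2C) (j : Fin 3) :
    fderiv ℝ (M.act A) (K.φ (hyp B)) (fderiv ℝ K.φ (hyp B) (conjVec B (pauli j))) =
      fderiv ℝ K.φ (hyp (A * B)) (conjVec (A * B) (pauli j)) := by
  have h1 : HasFDerivAt (M.act A ∘ K.φ)
      ((fderiv ℝ (M.act A) (K.φ (hyp B))).comp (fderiv ℝ K.φ (hyp B))) (hyp B) :=
    (K.differentiableAt_act A _ (hyp_mem B)).hasFDerivAt.comp _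
      (K.differentiableAt (hyp_mem B)).hasFDerivAt
  have h2 : HasFDerivAt (K.φ ∘ minkAct A)
      ((fderiv ℝ K.φ (hyp (A * B))).comp (minkActL A)) (hyp B) := by
    apply HasFDerivAt.comp
    · rw [minkAct_hyp]
      exact (K.differentiableAt (hyp_mem _)).hasFDerivAt
    · exact hasFDerivAt_minkAct A _
  have := fderiv_eq_of_eqOn (f := M.act A ∘ K.φ) (g := K.φ ∘ minkAct A)
    (fun x hx => K.act_map A x hx) (hyp_mem B) (mink_hyp_conjVec B j)
    h1.differentiableAt h2.differentiableAt
  rw [h1.fderiv, h2.fderiv] at this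
  have e : minkActL A (conjVec B (pauli j)) = conjVec (A * B) (pauli j) :=
    minkAct_conjVec A B (pauli_isHermitian j)
  simpa [e] using this

/-- On the horosphere the factor ⟨x, p⟩ - 1 vanishes, so the derivative of β along the frame is k
times that of ⟨x, p⟩, with k > 0. -/
lemma horoRep {β : E → ℝ} {κ : Fin 2 → ℂ} (h : HoroCut K.φ β (gMap (fMap κ))) :
    HoroRep (fun B => K.φ (hyp B)) (fun B j => fderiv ℝ K.φ (hyp B) (conjVec B (pauli j))) β κ := by
  obtain ⟨k, hk⟩ := h
  intro B
  obtain ⟨hpos, hdk, hdβ, heq⟩ := hk _ (hyp_mem B)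
  refine ⟨?_, fun h0 => ⟨k (hyp B), hpos, fun j => ?_⟩⟩
  · rw [heq, mink_hyp_fMap, mul_eq_zero, or_iff_right hpos.ne', sub_eq_zero]
  · have h1 : HasFDerivAt (β ∘ K.φ)
        ((fderiv ℝ β (K.φ (hyp B))).comp (fderiv ℝ K.φ (hyp B))) (hyp B) :=
      hdβ.hasFDerivAt.comp _ (K.differentiableAt (hyp_mem B)).hasFDerivAt
    obtain ⟨L, hL, hLv⟩ := hasFDerivAt_mink (gMap (fMap κ)) (hyp B)
    have h2 := hdk.hasFDerivAt.mul hL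
    have := fderiv_eq_of_eqOn (f := β ∘ K.φ) (g := k * fun y => mink y (gMap (fMap κ)) - 1)
      (fun x hx => (hk x hx).2.2.2) (hyp_mem B) (mink_hyp_conjVec B j)
      h1.differentiableAt h2.differentiableAt
    rw [h1.fderiv, h2.fderiv] at this
    have h3 : mink (hyp B) (gMap (fMap κ)) - 1 = 0 := by
      rw [heq] at h0
      exact (mul_eq_zero.1 h0).resolve_left hpos.ne'
    simpa [hLv, h3, mink_conjVec_pauli_fMap] using this

/-- The framing given by an isometry with the hyperboloid model. -/
def framing : Framing M where
  pt B := K.φ (hyp B)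
  vec B j := fderiv ℝ K.φ (hyp B) (conjVec B (pauli j))
  sec := K.sec
  pt_mem B := K.map_mem _ (hyp_mem B)
  pt_sec := K.map_sec
  vec_sec q hq := funext fun j => K.fderiv_sec q hq j
  exists_su B C h := exists_su_of_hyp_eq (K.injOn (hyp_mem B) (hyp_mem C) h)
  pt_mul B u := by rw [hyp_mul_toSL]
  vec_mul B u j := by simp only [hyp_mul_toSL, conjVec_mul_toSL, map_sum, map_smul]
  continuous_pt := continuous_iff_continuousAt.2 fun B =>
    (K.contDiffAt _ (hyp_mem B)).continuousAt.comp (continuous_conjVec 1).continuousAt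
  continuous_vec := by
    refine continuous_pi fun j => continuous_iff_continuousAt.2 fun B => ?_
    have h1 : ContinuousAt (fderiv ℝ K.φ) (hyp B) :=
      (K.contDiffAt _ (hyp_mem B)).continuousAt_fderiv (by norm_num)
    have h2 : ContinuousAt (fun B => fderiv ℝ K.φ (hyp B)) B :=
      h1.comp (f := hyp) (continuous_conjVec 1).continuousAt
    exact h2.clm_apply (continuous_conjVec (pauli j)).continuousAt
  continuousOn_sec := K.continuousOn_sec
  metric_std := K.metric_std
  mem_tangent := K.mem_tangent
  act_pt A B := by rw [K.act_map A _ (hyp_mem B), minkAct_hyp]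
  fderiv_act := K.fderiv_act_map
  horo_exists β hβ := by
    obtain ⟨p, hp, h⟩ := K.horo_exists β hβ
    obtain ⟨κ, hκ, rfl⟩ := exists_gMap_fMap hp
    exact ⟨κ, hκ, K.horoRep h⟩
  horo_of κ hκ := by
    obtain ⟨β, hβ, h⟩ := K.horo_of _ (gMap_fMap_mem hκ)
    exact ⟨β, hβ, K.horoRep h⟩

end ModelChart

/-! ### The flag of a spinor -/

lemma dfMap_eq (κ ν : Fin 2 → ℂ) :
    dfMap κ ν = Matrix.vecMulVec κ (star ν) + Matrix.vecMulVec ν (star κ) := by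
  ext i j
  have h1 : ∀ l, HasDerivAt (fun s : ℝ => κ l + (s : ℂ) * ν l) (ν l) 0 := fun l => by
    have := ((hasDerivAt_id (0 : ℝ)).ofReal_comp.mul_const (ν l)).const_add (κ l)
    simpa using this
  have h2 : HasDerivAt (fun s : ℝ => star (κ j + (s : ℂ) * ν j)) (star (ν j)) 0 := (h1 j).star
  have h3 : HasDerivAt (fun s : ℝ => (κ i + (s : ℂ) * ν i) * star (κ j + (s : ℂ) * ν j)) _ 0 :=
    (h1 i).mul h2
  have : (fun s : ℝ => fMap (κ + (s : ℂ) • ν) i j) =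
      fun s : ℝ => (κ i + (s : ℂ) * ν i) * star (κ j + (s : ℂ) * ν j) := by
    funext s
    simp [fMap, Matrix.vecMulVec_apply]
  rw [dfMap, Matrix.of_apply, this, h3.deriv]
  simp [Matrix.vecMulVec_apply]
  ring

lemma dfMap_apply (κ ν : Fin 2 → ℂ) (i j : Fin 2) :
    dfMap κ ν i j = κ i * star (ν j) + ν i * star (κ j) := by
  rw [dfMap_eq]; rfl

lemma dfMap_mv (B : SL2C) (κ ν : Fin 2 → ℂ) :
    dfMap (mv B κ) (mv B ν) = (B : Mat) * dfMap κ ν * (B : Mat)ᴴ := by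
  rw [dfMap_eq, dfMap_eq, mul_add, add_mul, Matrix.mul_vecMulVec, Matrix.vecMulVec_mul,
    Matrix.mul_vecMulVec, Matrix.vecMulVec_mul, mv, mv, Matrix.star_mulVec, Matrix.star_mulVec]

lemma dfMap_add_smul (κ ν : Fin 2 → ℂ) (c : ℝ) (α : ℂ) :
    dfMap κ ((c : ℂ) • ν + α • κ) = c • dfMap κ ν + (2 * α.re) • fMap κ := by
  rw [dfMap_eq, dfMap_eq, fMap]
  ext i j
  apply Complex.ext <;> simp [Matrix.vecMulVec_apply] <;> ring

lemma dfMap_baseSpinor : dfMap baseSpinor (zMap baseSpinor) = pauli 1 := by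
  have h := sqrtHalf_mul_self
  ext i j
  rw [dfMap_apply]
  fin_cases i <;> fin_cases j <;> apply Complex.ext <;>
    simp [zMap, baseSpinor, pauli] <;> linarith

/-- The map 𝒵 is not equivariant, but det(κ, 𝒵κ) = -i|κ|² for every spinor and B preserves
determinants. Hence 𝒵(Bκ₀) - |Bκ₀|² B𝒵(κ₀) has zero determinant with Bκ₀ and is a multiple of it.
Such a multiple does not change the flag. -/
lemma exists_zMap_mv (B : SL2C) : ∃ α : ℂ, zMap (mv B baseSpinor) =
    (spinorNormSq (mv B baseSpinor) : ℂ) • mv B (zMap baseSpinor) + α • mv B baseSpinor := by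
  have hr := sqrtHalf_mul_self_complex
  have hN : (spinorNormSq (mv B baseSpinor) : ℂ) ≠ 0 := by
    exact_mod_cast (spinorNormSq_pos (mv_ne_zero B baseSpinor_ne_zero)).ne'
  have hs := spinorNormSq_complex (mv B baseSpinor)
  have hd := B.2
  rw [Matrix.det_fin_two] at hd
  set N := (spinorNormSq (mv B baseSpinor) : ℂ)
  set κ := mv B baseSpinor with hκ
  set ν := mv B (zMap baseSpinor) with hν
  have hdet : κ 0 * ν 1 - κ 1 * ν 0 = -Complex.I := by
    simp [hκ, hν, mv, baseSpinor, zMap]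
    linear_combination (-Complex.I) * hd - 2 * Complex.I * ((B : Mat) 0 0 * (B : Mat) 1 1 - (B : Mat) 0 1 * (B : Mat) 1 0) * hr
  -- The coefficient is the Hermitian projection of the difference on κ.
  refine ⟨(zMap κ 0 * star (κ 0) + zMap κ 1 * star (κ 1) - N * (ν 0 * star (κ 0) + ν 1 * star (κ 1))) / N, ?_⟩
  ext i
  fin_cases i
  · simp [zMap]
    field_simp
    simp only [Complex.star_def] at hs
    rw [hs]
    linear_combination ((κ 0 * (starRingEnd ℂ) (κ 0) + κ 1 * (starRingEnd ℂ) (κ 1)) * (starRingEnd ℂ) (κ 1)) * hdet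
  · simp [zMap]
    field_simp
    simp only [Complex.star_def] at hs
    rw [hs]
    linear_combination (-(κ 0 * (starRingEnd ℂ) (κ 0) + κ 1 * (starRingEnd ℂ) (κ 1)) * (starRingEnd ℂ) (κ 0)) * hdet

/-- In terms of `B` with `B baseSpinor = κ`, the flag of `κ` is directed by `B σ_Y B^*`. -/
lemma exists_dfMap_eq {κ : nonzeroSpinors} {B : SL2C} (hB : B ∈ Framing.fibre κ) :
    ∃ b : ℝ, dfMap κ (zMap κ) =
      spinorNormSq κ • ((B : Mat) * pauli 1 * (B : Mat)ᴴ) + b • fMap κ := by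
  have hB' : mv B baseSpinor = κ := hB
  obtain ⟨α, hα⟩ := exists_zMap_mv B
  rw [hB'] at hα
  refine ⟨2 * α.re, ?_⟩
  rw [hα, dfMap_add_smul, ← hB', dfMap_mv, dfMap_baseSpinor]

lemma mem_pos_iff {κ : nonzeroSpinors} {B : SL2C} (hB : B ∈ Framing.fibre κ) (v : Mink) :
    v ∈ (GMap (FMap κ)).pos ↔
      ∃ a b : ℝ, 0 < b ∧ v = a • gMap (fMap κ) + b • conjVec B (pauli 1) := by
  obtain ⟨β, hβ⟩ := exists_dfMap_eq hB
  have hN := spinorNormSq_pos κ.2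
  constructor
  · rintro ⟨S, ⟨a, b, hb, rfl⟩, rfl⟩
    refine ⟨a + b * β, b * spinorNormSq κ * 2, by positivity, ?_⟩
    rw [hβ, conjVec, map_add, map_smul, map_smul, map_add, map_smul, map_smul]
    module
  · rintro ⟨a, b, hb, rfl⟩
    refine ⟨_, ⟨a - b / (spinorNormSq κ * 2) * β, b / (spinorNormSq κ * 2), by positivity, rfl⟩, ?_⟩
    have e : b / (spinorNormSq κ * 2) * spinorNormSq κ = b * (1 / 2) := by field_simp
    rw [hβ, conjVec, map_add, map_smul, map_smul, map_add, map_smul, map_smul, smul_add, smul_smul,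
      smul_smul, smul_smul, e]
    module

lemma exists_hyp_eq_of_mink {κ : nonzeroSpinors} {B : SL2C} (h : mink (hyp B) (gMap (fMap κ)) = 1) :
    ∃ C ∈ Framing.fibre κ, hyp C = hyp B := by
  rw [mink_hyp_fMap] at h
  refine ⟨B * toSL (suOf _ h), ?_, hyp_mul_toSL _ _⟩
  change mv _ _ = _
  rw [mv_mul, mv_suOf, mv_mv_inv]

lemma mink_hyp_of_mem_fibre {κ : nonzeroSpinors} {B : SL2C} (hB : B ∈ Framing.fibre κ) :
    mink (hyp B) (gMap (fMap κ)) = 1 := by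
  rw [mink_hyp_fMap, Framing.mv_inv_of_mem hB, baseSpinor_normSq]

/-- At an adapted frame, ⟨q, p⟩ = 1 while B σ_Y B^* is orthogonal to q. So orthogonality to q
removes the component along p and leaves the ray of the second vector of the frame. -/
lemma mem_line_HMap {κ : nonzeroSpinors} (hsurj : ∀ x ∈ hyperboloid.carrier, ∃ B, hyp B = x)
    (z : Mink × Mink) : z ∈ (HMap (GMap (FMap κ))).line ↔
      ∃ B ∈ Framing.fibre κ, ∃ c : ℝ, 0 < c ∧ z = (hyp B, c • conjVec B (pauli 1)) := by
  constructor
  · rintro ⟨⟨h1, h2⟩, h3, h4⟩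
    obtain ⟨B', hB'⟩ := hsurj _ h1
    obtain ⟨B, hB, hBB⟩ := exists_hyp_eq_of_mink (κ := κ) (B := B') (by rw [hB']; exact h2)
    rw [hB'] at hBB
    obtain ⟨a, b, hb, hv⟩ := (mem_pos_iff hB _).1 h3
    rw [hv, ← hBB, mink_add_right, mink_smul_right, mink_smul_right, mink_hyp_of_mem_fibre hB,
      mink_hyp_conjVec] at h4
    have ha : a = 0 := by linarith
    refine ⟨B, hB, b, hb, Prod.ext hBB.symm ?_⟩
    rw [hv, ha, zero_smul, zero_add]
  · rintro ⟨B, hB, c, hc, rfl⟩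
    refine ⟨⟨hyp_mem B, mink_hyp_of_mem_fibre hB⟩, (mem_pos_iff hB _).2 ⟨0, c, hc, by simp⟩, ?_⟩
    simp [mink_smul_right, mink_hyp_conjVec]

lemma hor_HMap {κ : nonzeroSpinors} (hsurj : ∀ x ∈ hyperboloid.carrier, ∃ B, hyp B = x) :
    (HMap (GMap (FMap κ))).hor = hyp '' Framing.fibre κ := by
  ext x
  constructor
  · rintro ⟨h1, h2⟩
    obtain ⟨B', rfl⟩ := hsurj _ h1
    obtain ⟨B, hB, hBB⟩ := exists_hyp_eq_of_mink (κ := κ) (B := B') h2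
    exact ⟨B, hB, hBB⟩
  · rintro ⟨B, hB, rfl⟩
    exact ⟨hyp_mem B, mink_hyp_of_mem_fibre hB⟩

/-- The spin-decorated horosphere of a spinor projects to the image of its flag. -/
lemma toDec_spinDec {E : Type} [NormedAddCommGroup E] [NormedSpace ℝ E] {M : HypModel E}
    (K : ModelChart M) (hsurj : ∀ x ∈ hyperboloid.carrier, ∃ B, hyp B = x) (κ : nonzeroSpinors) :
    (K.framing.spinDec κ).toDec = (HMap (GMap (FMap κ))).push K.φ := by
  apply DecData.ext
  · rw [Framing.hor_toDec, DecData.push, hor_HMap hsurj, Set.image_image]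
    rfl
  · ext z
    rw [Framing.mem_line_toDec]
    constructor
    · rintro ⟨B, hB, c, hc, rfl⟩
      refine ⟨_, (mem_line_HMap hsurj _).2 ⟨B, hB, c, hc, rfl⟩, ?_⟩
      simp [ModelChart.framing]
    · rintro ⟨z', hz', rfl⟩
      obtain ⟨B, hB, c, hc, rfl⟩ := (mem_line_HMap hsurj _).1 hz'
      refine ⟨B, hB, c, hc, ?_⟩
      simp [ModelChart.framing]

/-! ### The hyperboloid model -/

/-- The matrix of the pure boost which takes `(1, 0, 0, 0)` to `x`. -/
def boostMat (x : Mink) : Mat :=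
  (((Real.sqrt (2 * (1 + x 0)))⁻¹ : ℝ) : ℂ) • !![(1 + x 0 + x 3 : ℂ), x 1 + x 2 * Complex.I; x 1 - x 2 * Complex.I, 1 + x 0 - x 3]

lemma boost_scalar {x : Mink} (hx : x ∈ hyperboloid.carrier) :
    (Real.sqrt (2 * (1 + x 0)))⁻¹ * (Real.sqrt (2 * (1 + x 0)))⁻¹ * (2 * (1 + x 0)) = 1 := by
  have h0 : 0 < 2 * (1 + x 0) := by linarith [hx.2]
  rw [← mul_inv, Real.mul_self_sqrt h0.le, inv_mul_cancel₀ h0.ne']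

lemma det_boostMat {x : Mink} (hx : x ∈ hyperboloid.carrier) : (boostMat x).det = 1 := by
  have h := boost_scalar hx
  have h1 := hx.1
  simp only [mink] at h1
  rw [Matrix.det_fin_two, boostMat]
  generalize (Real.sqrt (2 * (1 + x 0)))⁻¹ = r at *
  apply Complex.ext <;> simp
  · linear_combination h + r * r * h1
  · ring

open Classical in
/-- The pure boost which takes `(1, 0, 0, 0)` to `x`. -/
def boost (x : Mink) : SL2C :=
  if h : x ∈ hyperboloid.carrier then (⟨boostMat x, det_boostMat h⟩ : SL2C) else 1

lemma coe_boost {x : Mink} (hx : x ∈ hyperboloid.carrier) : ((boost x : SL2C) : Mat) = boostMat x := by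
  have : boost x = ⟨boostMat x, det_boostMat hx⟩ := dif_pos hx
  rw [this]

/-- Let S be the Hermitian matrix of x, normalised to determinant 1 and trace 2x₀. Cayley–Hamilton
gives (1 + S)² = 2(1 + x₀)S, so `boostMat` is a Hermitian square root of S. -/
lemma hyp_boost {x : Mink} (hx : x ∈ hyperboloid.carrier) : hyp (boost x) = x := by
  have h := boost_scalar hx
  have h1 := hx.1
  simp only [mink] at h1
  rw [hyp, conjVec, coe_boost hx, boostMat, mul_one]
  generalize (Real.sqrt (2 * (1 + x 0)))⁻¹ = r at *
  ext i
  fin_cases i <;> simp [gMap_apply, Matrix.vecMul, dotProduct, Fin.sum_univ_two]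
  · linear_combination (x 0) * h - r * r * h1
  · linear_combination (x 1) * h
  · linear_combination (x 2) * h
  · linear_combination (x 3) * h

lemma exists_hyp_eq {x : Mink} (hx : x ∈ hyperboloid.carrier) : ∃ B, hyp B = x :=
  ⟨_, hyp_boost hx⟩

lemma conjVec_boost {x : Mink} (hx : x ∈ hyperboloid.carrier) (j : Fin 3) :
    conjVec (boost x) (pauli j) = hyperboloid.std x j := by
  have h := boost_scalar hx
  have h1 := hx.1
  simp only [mink] at h1
  have h0 : 1 + x 0 ≠ 0 := by linarith [hx.2]
  rw [conjVec, coe_boost hx, boostMat]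
  generalize (Real.sqrt (2 * (1 + x 0)))⁻¹ = r at *
  have hr : r ^ 2 * (1 + x 0) = 1 / 2 := by linear_combination h / 2
  ext i
  fin_cases j <;> fin_cases i <;>
    simp [gMap_apply, Matrix.vecMul, dotProduct, Fin.sum_univ_two, pauli, hyperboloid] <;>
    field_simp
  · linear_combination x 1 * 2 * (2 + 2 * x 0) * hr
  · linear_combination (x 1 ^ 2 - x 2 ^ 2 + (1 + x 0 + x 3) * (1 + x 0 - x 3)) * hr + h1 / 2
  · linear_combination 2 * x 1 * x 2 * hr
  · linear_combination x 1 * 2 * (2 * x 3) * hr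
  · linear_combination x 2 * 2 * (2 + 2 * x 0) * hr
  · linear_combination 2 * x 1 * x 2 * hr
  · linear_combination (x 2 ^ 2 - x 1 ^ 2 + (1 + x 0 + x 3) * (1 + x 0 - x 3)) * hr + h1 / 2
  · linear_combination x 2 * 2 * (2 * x 3) * hr
  · linear_combination 4 * (1 + x 0) * x 3 * hr
  · linear_combination x 1 * (2 * x 3) * hr
  · linear_combination x 2 * (2 * x 3) * hr
  · linear_combination (2 * (1 + x 0) ^ 2 + 2 * x 3 ^ 2 - 2 * x 1 ^ 2 - 2 * x 2 ^ 2) * hr + h1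

lemma continuousOn_boost : ContinuousOn boost hyperboloid.carrier := by
  rw [continuousOn_iff_continuous_domRestrict]
  refine continuous_induced_rng.2 ?_
  have h : Continuous fun x : hyperboloid.carrier => boostMat x := by
    have hx : ∀ i : Fin 4, Continuous fun x : hyperboloid.carrier => (x : Mink) i := fun i =>
      (continuous_apply i).comp continuous_subtype_val
    have hc : ∀ i : Fin 4, Continuous fun x : hyperboloid.carrier => (((x : Mink) i : ℝ) : ℂ) :=
      fun i => Complex.continuous_ofReal.comp (hx i)
    have hr : Continuous fun x : hyperboloid.carrier => (((Real.sqrt (2 * (1 + (x : Mink) 0)))⁻¹ : ℝ) : ℂ) := by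
      refine Complex.continuous_ofReal.comp (Continuous.inv₀ ?_ fun x => ?_)
      · exact Real.continuous_sqrt.comp (continuous_const.mul (continuous_const.add (hx 0)))
      · have := x.2.2
        positivity
    have h0 := hc 0
    have h1 := hc 1
    have h2 := hc 2
    have h3 := hc 3
    unfold boostMat
    refine hr.smul (continuous_matrix fun i j => ?_)
    fin_cases i <;> fin_cases j <;> simp <;> fun_prop
  refine h.congr fun x => ?_
  exact (coe_boost x.2).symm

lemma minkAct_mem (A : SL2C) {x : Mink} (hx : x ∈ hyperboloid.carrier) :
    minkAct A x ∈ hyperboloid.carrier := by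
  rw [← hyp_boost hx, ModelChart.minkAct_hyp]
  exact hyp_mem _

/-- The hyperboloid model as a chart for itself. -/
def hyperboloidChart : ModelChart hyperboloid where
  φ := id
  sec := boost
  contDiffAt _ _ := contDiffAt_id
  map_mem _ hx := hx
  injOn := Set.injOn_id _
  map_sec _ hq := hyp_boost hq
  continuousOn_sec := continuousOn_boost
  fderiv_sec q hq j := by rw [fderiv_id]; exact conjVec_boost hq j
  metric_std q hq x y := by
    simp_rw [← conjVec_boost hq, ← conjVec_sum]
    change -mink _ _ = _
    have hh : ∀ x : Fin 3 → ℝ, (∑ i, x i • pauli i).IsHermitian := fun x => by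
      rw [Matrix.IsHermitian, Matrix.conjTranspose_sum]
      simp [Matrix.conjTranspose_smul, (pauli_isHermitian _).eq]
    rw [conjVec, conjVec, mink_smul_left, mink_smul_right, mink_gMap_conj _ (hh x) (hh y)]
    simp [gMap_apply, mink, Fin.sum_univ_three, pauli]
    ring
  mem_tangent q hq v := by
    constructor
    · intro hv
      have hv' : mink q v = 0 := hv
      have h1 := hq.1
      have h0 : 1 + q 0 ≠ 0 := by linarith [hq.2]
      simp only [mink] at hv' h1
      -- These are the inner products of v with the vectors of the global frame, for the metric
      -- -⟨·,·⟩, simplified by ⟨q, v⟩ = 0.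
      refine ⟨fun k => v k.succ - q k.succ * v 0 / (1 + q 0), ?_⟩
      ext i
      fin_cases i <;> simp [hyperboloid, Fin.sum_univ_three] <;> field_simp
      · linear_combination (1 + q 0) ^ 2 * hv' - (1 + q 0) * v 0 * h1
      · linear_combination (1 + q 0) * q 1 * hv' - q 1 * v 0 * h1
      · linear_combination (1 + q 0) * q 2 * hv' - q 2 * v 0 * h1
      · linear_combination (1 + q 0) * q 3 * hv' - q 3 * v 0 * h1
    · rintro ⟨x, rfl⟩
      change mink q _ = 0
      simp_rw [← conjVec_boost hq, Fin.sum_univ_three, mink_add_right, mink_smul_right]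
      have := mink_hyp_conjVec (boost q)
      rw [hyp_boost hq] at this
      simp [this]
  act_map _ _ _ := rfl
  differentiableAt_act A x _ := (hasFDerivAt_minkAct A x).differentiableAt
  horo_exists β hβ := by
    obtain ⟨n, hn, c, hc, rfl⟩ := hβ
    -- Rescaling the null vector turns the level c into the level 1.
    refine ⟨c⁻¹ • n, ⟨?_, ?_⟩, fun _ => c, fun x hx => ⟨hc, by fun_prop, ?_, ?_⟩⟩
    · rw [mink_smul_left, mink_smul_right, hn.1]; simp
    · have := hn.2
      simp only [Pi.smul_apply, smul_eq_mul]
      positivity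
    · unfold mink; fun_prop
    · rw [mink_smul_right]
      simp only [id]
      field_simp
  horo_of p hp := ⟨_, ⟨p, hp, 1, one_pos, rfl⟩, fun _ => 1, fun x hx =>
    ⟨one_pos, by fun_prop, by unfold mink; fun_prop, by simp⟩⟩

/-! ### The disc model -/

lemma dotProduct_R3 (v w : R3) : v ⬝ᵥ w = v 0 * w 0 + v 1 * w 1 + v 2 * w 2 := by
  simp [dotProduct, Fin.sum_univ_three]

lemma one_add_ne_zero {x : Mink} (hx : x ∈ hyperboloid.carrier) : 1 + x 0 ≠ 0 := by
  linarith [hx.2]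

lemma iMap_dotProduct {x : Mink} (hx : x ∈ hyperboloid.carrier) :
    iMap x ⬝ᵥ iMap x = (x 0 - 1) / (x 0 + 1) := by
  have h0 : x 0 + 1 ≠ 0 := by linarith [hx.2]
  have h0' := one_add_ne_zero hx
  have h1 := hx.1
  simp only [mink] at h1
  rw [dotProduct_R3]
  simp [iMap]
  field_simp
  linear_combination -(1 + x 0) * h1

lemma iMap_mem {x : Mink} (hx : x ∈ hyperboloid.carrier) : iMap x ∈ disc.carrier := by
  change iMap x ⬝ᵥ iMap x < 1
  rw [iMap_dotProduct hx, div_lt_one (by linarith [hx.2])]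
  linarith

lemma iInv_iMap {x : Mink} (hx : x ∈ hyperboloid.carrier) : iInv (iMap x) = x := by
  have h0 : x 0 + 1 ≠ 0 := by linarith [hx.2]
  have h2 : 1 - (x 0 - 1) / (x 0 + 1) = 2 / (x 0 + 1) := by field_simp; ring
  have h3 : 1 + (x 0 - 1) / (x 0 + 1) = 2 * x 0 / (x 0 + 1) := by field_simp; ring
  rw [iInv, iMap_dotProduct hx, h2, h3]
  ext i
  refine Fin.cases ?_ (fun k => ?_) i
  · simp; field_simp
  · simp [iMap, add_comm 1 (x 0)]; field_simp

lemma iMap_iInv {v : R3} (hv : v ∈ disc.carrier) : iMap (iInv v) = v := by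
  have hv' : v ⬝ᵥ v < 1 := hv
  have h0 : 1 - v ⬝ᵥ v ≠ 0 := by linarith
  have h1 : 1 + (1 + v ⬝ᵥ v) / (1 - v ⬝ᵥ v) = 2 / (1 - v ⬝ᵥ v) := by field_simp; ring
  ext k
  simp only [iMap, iInv, Fin.cons_zero, Fin.cons_succ, h1]
  field_simp

lemma iInv_mem {v : R3} (hv : v ∈ disc.carrier) : iInv v ∈ hyperboloid.carrier := by
  have hv' : v ⬝ᵥ v < 1 := hv
  have h0 : 0 < 1 - v ⬝ᵥ v := by linarith
  have hnn : 0 ≤ v ⬝ᵥ v := by rw [dotProduct_R3]; nlinarith [mul_self_nonneg (v 0), mul_self_nonneg (v 1), mul_self_nonneg (v 2)]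
  have e1 : iInv v 1 = 2 * v 0 / (1 - v ⬝ᵥ v) := rfl
  have e2 : iInv v 2 = 2 * v 1 / (1 - v ⬝ᵥ v) := rfl
  have e3 : iInv v 3 = 2 * v 2 / (1 - v ⬝ᵥ v) := rfl
  have e0 : iInv v 0 = (1 + v ⬝ᵥ v) / (1 - v ⬝ᵥ v) := rfl
  constructor
  · rw [mink, e0, e1, e2, e3]
    field_simp
    have := dotProduct_R3 v v
    linear_combination 4 * this
  · rw [e0]; positivity

lemma contDiffAt_iMap {n : ℕ∞ω} {x : Mink} (hx : 1 + x 0 ≠ 0) : ContDiffAt ℝ n iMap x := by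
  refine contDiffAt_pi.2 fun k => ?_
  exact ContDiffAt.div (by fun_prop) (by fun_prop) hx

lemma fderiv_iMap {x : Mink} (hx : 1 + x 0 ≠ 0) (v : Mink) (k : Fin 3) :
    fderiv ℝ iMap x v k = v k.succ / (1 + x 0) - x k.succ * v 0 / (1 + x 0) ^ 2 := by
  have hp : ∀ i : Fin 4, HasFDerivAt (fun y : Mink => y i) (ContinuousLinearMap.proj i : Mink →L[ℝ] ℝ) x :=
    fun i => hasFDerivAt_apply i x
  have hi := (hasDerivAt_inv hx).comp_hasFDerivAt x ((hp 0).const_add 1)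
  have h := fun k : Fin 3 => (hp k.succ).fun_mul hi
  have h' : HasFDerivAt iMap (ContinuousLinearMap.pi fun k => _) x := hasFDerivAt_pi.2 h
  rw [h'.fderiv]
  simp
  field_simp
  ring

lemma contDiffAt_iInv {n : ℕ∞ω} {v : R3} (hv : v ∈ disc.carrier) : ContDiffAt ℝ n iInv v := by
  have hv' : v ⬝ᵥ v < 1 := hv
  have h0 : 1 - v ⬝ᵥ v ≠ 0 := by linarith
  have hd : ContDiffAt ℝ n (fun v : R3 => v ⬝ᵥ v) v := by
    simp_rw [dotProduct_R3]; fun_prop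
  refine contDiffAt_pi.2 fun i => ?_
  refine Fin.cases ?_ (fun k => ?_) i
  · exact ContDiffAt.div (contDiffAt_const.add hd) (contDiffAt_const.sub hd) h0
  · exact ContDiffAt.div (by fun_prop) (contDiffAt_const.sub hd) h0

lemma sum_disc_std (q : R3) (x : Fin 3 → ℝ) :
    ∑ i, x i • disc.std q i = ((1 - q ⬝ᵥ q) / 2) • x := by
  ext k
  simp [disc, Finset.sum_apply, Pi.single_apply]
  ring

lemma discAct_iMap (A : SL2C) {x : Mink} (hx : x ∈ hyperboloid.carrier) :
    discAct A (iMap x) = iMap (minkAct A x) := by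
  rw [discAct, iInv_iMap hx]

lemma differentiableAt_discAct (A : SL2C) {x : Mink} (hx : x ∈ hyperboloid.carrier) :
    DifferentiableAt ℝ (discAct A) (iMap x) := by
  have h1 : DifferentiableAt ℝ iInv (iMap x) :=
    (contDiffAt_iInv (n := 1) (iMap_mem hx)).differentiableAt (by norm_num)
  have h2 : DifferentiableAt ℝ (minkAct A) (iInv (iMap x)) := (hasFDerivAt_minkAct A _).differentiableAt
  have h3 : DifferentiableAt ℝ iMap (minkAct A (iInv (iMap x))) := by
    rw [iInv_iMap hx]
    exact (contDiffAt_iMap (n := 1) (one_add_ne_zero (minkAct_mem A hx))).differentiableAt (by norm_num)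
  exact h3.comp (iMap x) (h2.comp (iMap x) h1)

/-- The light-like vector of the horosphere of the disc model with centre `n` through `s n`. -/
def discNull (n : R3) (s : ℝ) : Mink := ((1 + s) / (1 - s)) • Fin.cons 1 n

lemma discNull_mem {n : R3} {s : ℝ} (hn : n ⬝ᵥ n = 1) (h1 : -1 < s) (h2 : s < 1) :
    discNull n s ∈ lightCone := by
  constructor
  · rw [discNull, mink_smul_left, mink_smul_right]
    have : mink (Fin.cons 1 n) (Fin.cons 1 n) = 0 := by
      rw [dotProduct_R3] at hn
      change 1 * 1 - n 0 * n 0 - n 1 * n 1 - n 2 * n 2 = 0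
      linarith
    rw [this]; simp
  · change 0 < (1 + s) / (1 - s) * 1
    have : 0 < 1 + s := by linarith
    have : 0 < 1 - s := by linarith
    positivity

/-- The point s n of the disc has ⟨x, (1, n)⟩ = (1 - s)/(1 + s), which accounts for the scale of
`discNull`. The factor (1 - s)/(1 + x₀) is the conformal denominator of the projection. -/
lemma horoCut_disc {n : R3} {s : ℝ} (hn : n ⬝ᵥ n = 1) (h2 : s < 1) :
    HoroCut iMap (discHoroFun n s) (discNull n s) := by
  refine ⟨fun x => (1 - s) / (1 + x 0), fun x hx => ⟨?_, ?_, ?_, ?_⟩⟩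
  · have := hx.2
    have : 0 < 1 - s := by linarith
    positivity
  · exact ((contDiffAt_const (c := 1 - s)).div (n := 1) (g := fun x : Mink => 1 + x 0) (by fun_prop)
      (one_add_ne_zero hx)).differentiableAt (by norm_num)
  · unfold discHoroFun
    simp_rw [dotProduct_R3]
    fun_prop
  · have h0 := one_add_ne_zero hx
    have hs : 1 - s ≠ 0 := by linarith
    have h1 := hx.1
    rw [dotProduct_R3] at hn
    have e : mink x (discNull n s) =
        (1 + s) / (1 - s) * (x 0 - x 1 * n 0 - x 2 * n 1 - x 3 * n 2) := by
      rw [discNull, mink_smul_right]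
      congr 1
      change x 0 * 1 - x 1 * n 0 - x 2 * n 1 - x 3 * n 2 = _
      ring
    rw [e, discHoroFun, dotProduct_R3]
    simp only [mink] at h1
    simp [iMap]
    field_simp
    linear_combination (-4) * h1 + (1 + s) ^ 2 * (1 + x 0) ^ 2 * hn

/-- The disc model. -/
def discChart : ModelChart disc where
  φ := iMap
  sec v := boost (iInv v)
  contDiffAt _ hx := contDiffAt_iMap (one_add_ne_zero hx)
  map_mem _ hx := iMap_mem hx
  injOn := Set.LeftInvOn.injOn (f₁' := iInv) fun _ hx => iInv_iMap hx
  map_sec _ hq := by rw [hyp_boost (iInv_mem hq), iMap_iInv hq]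
  continuousOn_sec := continuousOn_boost.comp
    (fun v hv => (contDiffAt_iInv (n := 0) hv).continuousAt.continuousWithinAt) fun _ hv => iInv_mem hv
  fderiv_sec q hq j := by
    have hx := iInv_mem hq
    rw [hyp_boost hx, conjVec_boost hx]
    have h0 := one_add_ne_zero hx
    have h3 := iMap_dotProduct hx
    rw [iMap_iInv hq] at h3
    ext k
    rw [fderiv_iMap h0]
    generalize iInv q = x at *
    simp only [disc, h3, Pi.smul_apply, smul_eq_mul]
    have h4 : x 0 + 1 ≠ 0 := by linarith [hx.2]
    fin_cases j <;> fin_cases k <;> simp [hyperboloid] <;> field_simp <;> ring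
  metric_std q hq x y := by
    have hv' : q ⬝ᵥ q < 1 := hq
    have h0 : 1 - q ⬝ᵥ q ≠ 0 := by linarith
    rw [sum_disc_std, sum_disc_std]
    simp [disc]
    field_simp
    rw [dotProduct]
    ring
  mem_tangent q hq v := by
    have hv' : q ⬝ᵥ q < 1 := hq
    have h0 : (1 - q ⬝ᵥ q) / 2 ≠ 0 := by
      have : 1 - q ⬝ᵥ q ≠ 0 := by linarith
      positivity
    refine iff_of_true trivial ⟨((1 - q ⬝ᵥ q) / 2)⁻¹ • v, ?_⟩
    rw [sum_disc_std, smul_inv_smul₀ h0]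
  act_map A _ hx := discAct_iMap A hx
  differentiableAt_act A _ hx := differentiableAt_discAct A hx
  horo_exists β hβ := by
    obtain ⟨n, s, hn, h1, h2, rfl⟩ := hβ
    exact ⟨_, discNull_mem hn h1 h2, horoCut_disc hn h2⟩
  horo_of p hp := by
    obtain ⟨h0, hp0⟩ := hp
    simp only [mink] at h0
    have hne : p 0 ≠ 0 := hp0.ne'
    have hne1 : p 0 + 1 ≠ 0 := by linarith
    have hn : (fun k : Fin 3 => p k.succ / p 0) ⬝ᵥ (fun k : Fin 3 => p k.succ / p 0) = 1 := by
      rw [dotProduct_R3]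
      simp
      field_simp
      linear_combination -h0
    -- This s solves (1 + s)/(1 - s) = p₀.
    have hs1 : -1 < (p 0 - 1) / (p 0 + 1) := by rw [lt_div_iff₀ (by linarith)]; linarith
    have hs2 : (p 0 - 1) / (p 0 + 1) < 1 := by rw [div_lt_one (by linarith)]; linarith
    refine ⟨_, ⟨_, _, hn, hs1, hs2, rfl⟩, ?_⟩
    have e : discNull (fun k : Fin 3 => p k.succ / p 0) ((p 0 - 1) / (p 0 + 1)) = p := by
      have e1 : (1 + (p 0 - 1) / (p 0 + 1)) / (1 - (p 0 - 1) / (p 0 + 1)) = p 0 := by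
        have : 1 - (p 0 - 1) / (p 0 + 1) = 2 / (p 0 + 1) := by field_simp; ring
        rw [this]
        field_simp
        ring
      rw [discNull, e1]
      ext i
      refine Fin.cases ?_ (fun k => ?_) i
      · simp
      · simp; field_simp
    have := horoCut_disc hn hs2
    rwa [e] at this

/-! ### The upper half space model -/

/-- The isometry from the hyperboloid to the upper half space, in simpler terms. -/
def upMap (x : Mink) : ℂ × ℝ :=
  (((x 0 - x 3)⁻¹ : ℝ) * ((x 1 : ℂ) + x 2 * Complex.I), (x 0 - x 3)⁻¹)

lemma sub_pos_of_mem {x : Mink} (hx : x ∈ hyperboloid.carrier) : 0 < x 0 - x 3 := by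
  obtain ⟨h1, h0⟩ := hx
  simp only [mink] at h1
  nlinarith [mul_self_nonneg (x 1), mul_self_nonneg (x 2), mul_self_nonneg (x 3)]

lemma jMap_denom_pos {v : R3} (hv : v ∈ disc.carrier) : 0 < v ⬝ᵥ v - 2 * v 2 + 1 := by
  have hv' : v ⬝ᵥ v < 1 := hv
  rw [dotProduct_R3] at *
  nlinarith [mul_self_nonneg (v 0), mul_self_nonneg (v 1), mul_self_nonneg (1 - v 2)]

lemma ofReal_mul_mk (r a b : ℝ) : (r : ℂ) * ((a : ℂ) + b * Complex.I) = ⟨r * a, r * b⟩ := by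
  apply Complex.ext <;> simp

/-- The simplification uses ⟨x, x⟩ = 1, so the two maps are shown to agree on the hyperboloid only;
their derivatives are later compared in tangent directions. -/
lemma jMap_iMap {x : Mink} (hx : x ∈ hyperboloid.carrier) : jMap (iMap x) = upMap x := by
  have h0 : x 0 + 1 ≠ 0 := by linarith [hx.2]
  have h0' := one_add_ne_zero hx
  have hw := (sub_pos_of_mem hx).ne'
  have h2 : (x 0 - 1) / (x 0 + 1) - 2 * iMap x 2 + 1 = 2 * (x 0 - x 3) / (x 0 + 1) := by
    have : iMap x 2 = x 3 / (1 + x 0) := rfl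
    rw [this]; field_simp; ring
  have e0 : iMap x 0 = x 1 / (1 + x 0) := rfl
  have e1 : iMap x 1 = x 2 / (1 + x 0) := rfl
  rw [jMap, iMap_dotProduct hx, h2, e0, e1, upMap, ofReal_mul_mk, ofReal_mul_mk]
  refine Prod.ext (Complex.ext ?_ ?_) ?_
  · simp
    field_simp
    ring
  · simp
    field_simp
    ring
  · simp
    field_simp
    ring

lemma jInv_upMap {x : Mink} (hx : x ∈ hyperboloid.carrier) : jInv (upMap x) = iMap x := by
  have h0' := one_add_ne_zero hx
  have hw := (sub_pos_of_mem hx).ne'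
  have h1 := hx.1
  simp only [mink] at h1
  have hd : Complex.normSq (upMap x).1 + ((upMap x).2 + 1) ^ 2 = 2 * (1 + x 0) / (x 0 - x 3) := by
    simp [upMap, Complex.normSq_apply]
    field_simp
    linear_combination -h1
  have hd' : Complex.normSq (upMap x).1 + (upMap x).2 ^ 2 - 1 = 2 * x 3 / (x 0 - x 3) := by
    simp [upMap, Complex.normSq_apply]
    field_simp
    linear_combination -h1
  rw [jInv, hd, hd']
  ext k
  fin_cases k <;> simp [upMap, iMap, ofReal_mul_mk, -Complex.ofReal_inv, -Complex.ofReal_sub] <;> field_simp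

/-- The inverse of `upMap`. -/
def upInv (q : ℂ × ℝ) : Mink :=
  ![(Complex.normSq q.1 + q.2 ^ 2 + 1) / (2 * q.2), q.1.re / q.2, q.1.im / q.2,
    (Complex.normSq q.1 + q.2 ^ 2 - 1) / (2 * q.2)]

lemma upInv_mem {q : ℂ × ℝ} (hq : q ∈ upper.carrier) : upInv q ∈ hyperboloid.carrier := by
  have h : 0 < q.2 := hq
  constructor
  · simp [mink, upInv, Complex.normSq_apply]
    field_simp
    ring
  · have := Complex.normSq_nonneg q.1
    simp [upInv]
    positivity

lemma upMap_upInv {q : ℂ × ℝ} (hq : q ∈ upper.carrier) : upMap (upInv q) = q := by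
  have h : 0 < q.2 := hq
  have e : upInv q 0 - upInv q 3 = q.2⁻¹ := by
    simp [upInv]
    field_simp
    ring
  rw [upMap, e, inv_inv]
  refine Prod.ext (Complex.ext ?_ ?_) rfl
  · simp [upInv]; field_simp
  · simp [upInv]; field_simp

lemma contDiffAt_jMap {n : ℕ∞ω} {v : R3} (hv : v ∈ disc.carrier) : ContDiffAt ℝ n jMap v := by
  have h0 := (jMap_denom_pos hv).ne'
  have hd : ContDiffAt ℝ n (fun v : R3 => v ⬝ᵥ v) v := by
    simp_rw [dotProduct_R3]; fun_prop
  have hD : ContDiffAt ℝ n (fun v : R3 => v ⬝ᵥ v - 2 * v 2 + 1) v := by fun_prop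
  have hc : ∀ i : Fin 3, ContDiffAt ℝ n (fun v : R3 => (v i : ℂ)) v := fun i =>
    (Complex.ofRealCLM.contDiff.contDiffAt).comp v (by fun_prop)
  refine ContDiffAt.prodMk (ContDiffAt.mul ?_ ((hc 0).add ((hc 1).mul contDiffAt_const))) ?_
  · exact (Complex.ofRealCLM.contDiff.contDiffAt).comp v
      ((contDiffAt_const (c := (2 : ℝ))).div hD h0)
  · exact (contDiffAt_const.sub hd).div hD h0

lemma contDiffAt_jInv {n : ℕ∞ω} {q : ℂ × ℝ} (hq : q ∈ upper.carrier) : ContDiffAt ℝ n jInv q := by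
  have h : 0 < q.2 := hq
  have hre : ContDiffAt ℝ n (fun q : ℂ × ℝ => q.1.re) q :=
    (Complex.reCLM.contDiff.comp contDiff_fst).contDiffAt
  have him : ContDiffAt ℝ n (fun q : ℂ × ℝ => q.1.im) q :=
    (Complex.imCLM.contDiff.comp contDiff_fst).contDiffAt
  have h2 : ContDiffAt ℝ n (fun q : ℂ × ℝ => q.2) q := contDiffAt_snd
  have hn : ContDiffAt ℝ n (fun q : ℂ × ℝ => Complex.normSq q.1) q := by
    simp_rw [Complex.normSq_apply]; fun_prop
  refine ContDiffAt.smul (ContDiffAt.inv (hn.add ((h2.add contDiffAt_const).pow 2)) ?_) (contDiffAt_pi.2 fun k => ?_)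
  · have := Complex.normSq_nonneg q.1
    positivity
  · fin_cases k <;> simp <;> fun_prop

lemma upper_act_map (A : SL2C) {x : Mink} (hx : x ∈ hyperboloid.carrier) :
    upperAct A (jMap (iMap x)) = jMap (iMap (minkAct A x)) := by
  rw [upperAct, jMap_iMap hx, jInv_upMap hx, discAct_iMap A hx]

lemma upMap_mem {x : Mink} (hx : x ∈ hyperboloid.carrier) : upMap x ∈ upper.carrier :=
  inv_pos.2 (sub_pos_of_mem hx)

lemma differentiableAt_upperAct (A : SL2C) {x : Mink} (hx : x ∈ hyperboloid.carrier) :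
    DifferentiableAt ℝ (upperAct A) (jMap (iMap x)) := by
  have e : jInv (jMap (iMap x)) = iMap x := by rw [jMap_iMap hx, jInv_upMap hx]
  have h1 : DifferentiableAt ℝ jInv (jMap (iMap x)) := by
    rw [jMap_iMap hx]
    exact (contDiffAt_jInv (n := 1) (upMap_mem hx)).differentiableAt (by norm_num)
  have h2 : DifferentiableAt ℝ (discAct A) (jInv (jMap (iMap x))) := by
    rw [e]; exact differentiableAt_discAct A hx
  have h3 : DifferentiableAt ℝ jMap (discAct A (jInv (jMap (iMap x)))) := by
    rw [e, discAct_iMap A hx]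
    exact (contDiffAt_jMap (n := 1) (iMap_mem (minkAct_mem A hx))).differentiableAt (by norm_num)
  exact h3.comp (jMap (iMap x)) (h2.comp (jMap (iMap x)) h1)

lemma hasFDerivAt_upMap {x : Mink} (hx : x 0 - x 3 ≠ 0) : ∃ L : Mink →L[ℝ] ℂ × ℝ,
    HasFDerivAt upMap L x ∧ ∀ v, L v =
      ((((x 0 - x 3)⁻¹ : ℝ) : ℂ) * ((v 1 : ℂ) + v 2 * Complex.I) -
        (((v 0 - v 3) * ((x 0 - x 3) ^ 2)⁻¹ : ℝ) : ℂ) * ((x 1 : ℂ) + x 2 * Complex.I),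
        -((v 0 - v 3) * ((x 0 - x 3) ^ 2)⁻¹)) := by
  have hp : ∀ i : Fin 4, HasFDerivAt (fun y : Mink => y i) (ContinuousLinearMap.proj i : Mink →L[ℝ] ℝ) x :=
    fun i => hasFDerivAt_apply i x
  have hc : ∀ i : Fin 4, HasFDerivAt (fun y : Mink => (y i : ℂ))
      (Complex.ofRealCLM.comp (ContinuousLinearMap.proj i : Mink →L[ℝ] ℝ)) x := fun i =>
    Complex.ofRealCLM.hasFDerivAt.comp x (hp i)
  have hi := (hasDerivAt_inv hx).comp_hasFDerivAt x ((hp 0).fun_sub (hp 3))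
  have hi' := (Complex.ofRealCLM.hasFDerivAt (x := (x 0 - x 3)⁻¹)).comp x hi
  have h := (hi'.fun_mul ((hc 1).fun_add ((hc 2).mul_const Complex.I))).prodMk hi
  refine ⟨_, h, fun v => ?_⟩
  refine Prod.ext (Complex.ext ?_ ?_) ?_ <;> simp [Complex.ofReal_inv] <;> ring

/-- The upper triangular matrix which takes `(0, 1)` to `q`. -/
def upMat (q : ℂ × ℝ) : Mat :=
  !![(Real.sqrt q.2 : ℂ), q.1 * ((Real.sqrt q.2)⁻¹ : ℝ); 0, ((Real.sqrt q.2)⁻¹ : ℝ)]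

lemma det_upMat {q : ℂ × ℝ} (hq : q ∈ upper.carrier) : (upMat q).det = 1 := by
  have h : 0 < q.2 := hq
  have h1 : (Real.sqrt q.2 : ℂ) ≠ 0 := by exact_mod_cast (Real.sqrt_pos.2 h).ne'
  rw [upMat, Matrix.det_fin_two_of]
  push_cast
  field_simp
  ring

open Classical in
/-- The element of `SL(2, ℂ)` which gives the global frame field at `q`. -/
def upSec (q : ℂ × ℝ) : SL2C :=
  if h : q ∈ upper.carrier then (⟨upMat q, det_upMat h⟩ : SL2C) else 1

lemma coe_upSec {q : ℂ × ℝ} (hq : q ∈ upper.carrier) : ((upSec q : SL2C) : Mat) = upMat q := by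
  have : upSec q = ⟨upMat q, det_upMat hq⟩ := dif_pos hq
  rw [this]

lemma hyp_upSec {q : ℂ × ℝ} (hq : q ∈ upper.carrier) : hyp (upSec q) = upInv q := by
  have h : 0 < q.2 := hq
  have h1 := (Real.sqrt_pos.2 h).ne'
  have h2 := Real.sq_sqrt h.le
  rw [hyp, conjVec, coe_upSec hq, upMat, mul_one]
  unfold upInv
  generalize Real.sqrt q.2 = r at *
  rw [← h2]
  ext i
  fin_cases i <;>
    simp [gMap_apply, Matrix.vecMul, dotProduct, Fin.sum_univ_two, Complex.normSq_apply] <;>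
    field_simp <;> ring

lemma continuousOn_upSec : ContinuousOn upSec upper.carrier := by
  rw [continuousOn_iff_continuous_domRestrict]
  refine continuous_induced_rng.2 ?_
  have h : Continuous fun q : upper.carrier => upMat q := by
    have h1 : Continuous fun q : upper.carrier => (q : ℂ × ℝ).1 := continuous_fst.comp continuous_subtype_val
    have h2 : Continuous fun q : upper.carrier => Real.sqrt (q : ℂ × ℝ).2 :=
      Real.continuous_sqrt.comp (continuous_snd.comp continuous_subtype_val)
    have h3 : Continuous fun q : upper.carrier => (Real.sqrt (q : ℂ × ℝ).2)⁻¹ :=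
      h2.inv₀ fun q => (Real.sqrt_pos.2 q.2).ne'
    have h2' := Complex.continuous_ofReal.comp h2
    have h3' := Complex.continuous_ofReal.comp h3
    refine continuous_matrix fun i j => ?_
    fin_cases i <;> fin_cases j
    · exact h2'
    · exact h1.mul h3'
    · exact continuous_const
    · exact h3'
  refine h.congr fun x => ?_
  exact (coe_upSec x.2).symm

/-- Upper triangular matrices with positive real diagonal act by translations and dilations, which
preserve the global frame field. A boost would rotate it, so the section here differs from the ones
used for the other two models. -/
lemma fderiv_upMap_sec {q : ℂ × ℝ} (hq : q ∈ upper.carrier) (j : Fin 3) :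
    fderiv ℝ upMap (hyp (upSec q)) (conjVec (upSec q) (pauli j)) = upper.std q j := by
  have h : 0 < q.2 := hq
  have h1 := (Real.sqrt_pos.2 h).ne'
  have h2 := Real.sq_sqrt h.le
  have hx := upInv_mem hq
  obtain ⟨L, hL, hLv⟩ := hasFDerivAt_upMap (sub_pos_of_mem hx).ne'
  rw [hyp_upSec hq, hL.fderiv, hLv, conjVec, coe_upSec hq, upMat]
  have e : upInv q 0 - upInv q 3 = q.2⁻¹ := by
    simp [upInv]
    field_simp
    ring
  have e1 : upInv q 1 = q.1.re / q.2 := rfl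
  have e2 : upInv q 2 = q.1.im / q.2 := rfl
  rw [e, e1, e2, ofReal_mul_mk, ofReal_mul_mk]
  simp only [upper]
  generalize Real.sqrt q.2 = r at *
  rw [← h2]
  fin_cases j <;> refine Prod.ext (Complex.ext ?_ ?_) ?_ <;>
    simp [gMap_apply, Matrix.vecMul, dotProduct, Fin.sum_univ_two, pauli, -Complex.ofReal_pow] <;>
    field_simp <;> ring

lemma sum_upper_std (q : ℂ × ℝ) (x : Fin 3 → ℝ) :
    ∑ i, x i • upper.std q i = (⟨q.2 * x 0, q.2 * x 1⟩, q.2 * x 2) := by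
  refine Prod.ext (Complex.ext ?_ ?_) ?_ <;> simp [upper, Fin.sum_univ_three] <;> ring

/-- The light-like vector of the horosphere of the upper half space with centre `c` and diameter
`d`. -/
def sphereNull (c : ℂ) (d : ℝ) : Mink :=
  ![(1 + Complex.normSq c) / d, 2 * c.re / d, 2 * c.im / d, (Complex.normSq c - 1) / d]

/-- The light-like vector of the horosphere of the upper half space at height `a`. -/
def planeNull (a : ℝ) : Mink := ![a, 0, 0, a]

lemma sphereNull_mem (c : ℂ) {d : ℝ} (hd : 0 < d) : sphereNull c d ∈ lightCone := by
  constructor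
  · simp [mink, sphereNull, Complex.normSq_apply]
    field_simp
    ring
  · have := Complex.normSq_nonneg c
    simp [sphereNull]
    positivity

lemma planeNull_mem {a : ℝ} (ha : 0 < a) : planeNull a ∈ lightCone :=
  ⟨by simp [mink, planeNull], by simpa [planeNull]⟩

lemma differentiableAt_inv_sub {x : Mink} (hx : x ∈ hyperboloid.carrier) (d : ℝ) :
    DifferentiableAt ℝ (fun x : Mink => d / (x 0 - x 3)) x :=
  ((contDiffAt_const (c := d)).div (n := 1) (g := fun x : Mink => x 0 - x 3) (by fun_prop)
    (sub_pos_of_mem hx).ne').differentiableAt (by norm_num)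

/-- On the hyperboloid t = 1/(x₀ - x₃), so the factor is d t: the sphere equation |z - c|² + t² - d
t is d t times the affine equation. -/
lemma horoCut_sphere (c : ℂ) {d : ℝ} (hd : 0 < d) :
    HoroCut (jMap ∘ iMap) (upperSphereFun c d) (sphereNull c d) := by
  refine ⟨fun x => d / (x 0 - x 3), fun x hx => ⟨?_, differentiableAt_inv_sub hx d, ?_, ?_⟩⟩
  · exact div_pos hd (sub_pos_of_mem hx)
  · have hre : Differentiable ℝ (fun q : ℂ × ℝ => q.1.re) :=
      Complex.reCLM.differentiable.comp differentiable_fst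
    have him : Differentiable ℝ (fun q : ℂ × ℝ => q.1.im) :=
      Complex.imCLM.differentiable.comp differentiable_fst
    unfold upperSphereFun
    simp_rw [Complex.normSq_apply, Complex.sub_re, Complex.sub_im]
    fun_prop
  · have hw := (sub_pos_of_mem hx).ne'
    have h1 := hx.1
    simp only [mink] at h1
    rw [Function.comp, jMap_iMap hx]
    simp [upperSphereFun, upMap, Complex.normSq_apply, mink, sphereNull]
    field_simp
    linear_combination -4 * h1

lemma horoCut_plane {a : ℝ} :
    HoroCut (jMap ∘ iMap) (upperPlaneFun a) (planeNull a) := by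
  refine ⟨fun x => 1 / (x 0 - x 3), fun x hx => ⟨?_, differentiableAt_inv_sub hx 1, ?_, ?_⟩⟩
  · exact div_pos one_pos (sub_pos_of_mem hx)
  · unfold upperPlaneFun; fun_prop
  · have hw := (sub_pos_of_mem hx).ne'
    rw [Function.comp, jMap_iMap hx]
    simp [upperPlaneFun, upMap, mink, planeNull]
    field_simp

/-- The case p₀ = p₃ is the centre ∞. Otherwise stereographic projection gives the centre (p₁ + i
p₂)/(p₀ - p₃), and the scale gives d = 2/(p₀ - p₃). -/
lemma lightCone_cases {p : Mink} (hp : p ∈ lightCone) :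
    (∃ c : ℂ, ∃ d : ℝ, 0 < d ∧ p = sphereNull c d) ∨ ∃ a : ℝ, 0 < a ∧ p = planeNull a := by
  obtain ⟨h, h0⟩ := hp
  simp only [mink] at h
  by_cases h3 : p 0 = p 3
  · right
    rw [← h3] at h
    have k1 : p 1 = 0 := by nlinarith [mul_self_nonneg (p 1), mul_self_nonneg (p 2)]
    have k2 : p 2 = 0 := by nlinarith [mul_self_nonneg (p 1), mul_self_nonneg (p 2)]
    refine ⟨p 0, h0, ?_⟩
    ext i
    fin_cases i <;> simp [planeNull, k1, k2, h3]
  · left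
    have hw : 0 < p 0 - p 3 := by
      have h3' : p 0 - p 3 ≠ 0 := sub_ne_zero.2 h3
      have hle : p 3 ≤ p 0 := by
        nlinarith [mul_self_nonneg (p 1), mul_self_nonneg (p 2)]
      exact lt_of_le_of_ne (by linarith) (Ne.symm h3')
    refine ⟨⟨p 1 / (p 0 - p 3), p 2 / (p 0 - p 3)⟩, 2 / (p 0 - p 3), by positivity, ?_⟩
    ext i
    fin_cases i <;> simp [sphereNull, Complex.normSq_apply] <;> field_simp
    · linear_combination h
    · linear_combination h

/-- The upper half space model. -/
def upperChart : ModelChart upper where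
  φ := jMap ∘ iMap
  sec := upSec
  contDiffAt x hx := (contDiffAt_jMap (iMap_mem hx)).comp x (contDiffAt_iMap (one_add_ne_zero hx))
  map_mem x hx := by rw [Function.comp, jMap_iMap hx]; exact upMap_mem hx
  injOn := by
    intro x hx y hy h
    simp only [Function.comp, jMap_iMap hx, jMap_iMap hy] at h
    have := congrArg jInv h
    rw [jInv_upMap hx, jInv_upMap hy] at this
    exact discChart.injOn hx hy this
  map_sec q hq := by
    rw [hyp_upSec hq, Function.comp, jMap_iMap (upInv_mem hq), upMap_upInv hq]
  continuousOn_sec := continuousOn_upSec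
  fderiv_sec q hq j := by
    have hx := hyp_mem (upSec q)
    rw [← fderiv_upMap_sec hq]
    obtain ⟨L, hL, -⟩ := hasFDerivAt_upMap (sub_pos_of_mem hx).ne'
    refine fderiv_eq_of_eqOn (fun x hx => jMap_iMap hx) hx (mink_hyp_conjVec _ j) ?_ hL.differentiableAt
    exact ((contDiffAt_jMap (n := 1) (iMap_mem hx)).comp _
      (contDiffAt_iMap (one_add_ne_zero hx))).differentiableAt (by norm_num)
  metric_std q hq x y := by
    have h : 0 < q.2 := hq
    rw [sum_upper_std, sum_upper_std]
    simp [upper, Fin.sum_univ_three]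
    field_simp
  mem_tangent q hq v := by
    have h : 0 < q.2 := hq
    refine iff_of_true trivial ⟨![v.1.re / q.2, v.1.im / q.2, v.2 / q.2], ?_⟩
    rw [sum_upper_std]
    refine Prod.ext (Complex.ext ?_ ?_) ?_ <;> simp <;> field_simp
  act_map A _ hx := upper_act_map A hx
  differentiableAt_act A _ hx := differentiableAt_upperAct A hx
  horo_exists β hβ := by
    rcases hβ with ⟨c, d, hd, rfl⟩ | ⟨a, ha, rfl⟩
    · exact ⟨_, sphereNull_mem c hd, horoCut_sphere c hd⟩
    · exact ⟨_, planeNull_mem ha, horoCut_plane⟩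
  horo_of p hp := by
    rcases lightCone_cases hp with ⟨c, d, hd, rfl⟩ | ⟨a, ha, rfl⟩
    · exact ⟨_, Or.inl ⟨c, d, hd, rfl⟩, horoCut_sphere c hd⟩
    · exact ⟨_, Or.inr ⟨a, ha, rfl⟩, horoCut_plane⟩

/-! ### Decorated horospheres of spinors -/

/-- The image of the second axis under the rotation which corresponds to a unit spinor. -/
def spinorAxis (ν : Fin 2 → ℂ) : R3 :=
  ![2 * ((ν 1).re * (ν 1).im - (ν 0).re * (ν 0).im),
    (ν 0).re ^ 2 - (ν 0).im ^ 2 + (ν 1).re ^ 2 - (ν 1).im ^ 2,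
    2 * ((ν 0).re * (ν 1).im + (ν 0).im * (ν 1).re)]

lemma rot_suOf_one {ν : Fin 2 → ℂ} (h : spinorNormSq ν = 1) (i : Fin 3) :
    rot (suOf ν h) i 1 = spinorAxis ν i := by
  have hr := sqrtHalf_mul_self
  have hu : ((suOf ν h : SU2) : Mat) = slMat ν := rfl
  rw [rot, hu, slMat, h]
  fin_cases i <;>
    simp [pauli, spinorAxis, Matrix.trace, Fin.sum_univ_two, Matrix.vecMul, dotProduct]
  · linear_combination 4 * ((ν 1).re * (ν 1).im - (ν 0).re * (ν 0).im) * hr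
  · linear_combination 2 * ((ν 0).re ^ 2 - (ν 0).im ^ 2 + (ν 1).re ^ 2 - (ν 1).im ^ 2) * hr
  · linear_combination 4 * ((ν 0).re * (ν 1).im + (ν 0).im * (ν 1).re) * hr

namespace Framing

variable {E : Type} [NormedAddCommGroup E] [NormedSpace ℝ E] {M : HypModel E} (F : Framing M)

lemma mem_line_of_unit {κ : nonzeroSpinors} {q : E} (hq : q ∈ M.carrier) {ν : Fin 2 → ℂ}
    (hν : spinorNormSq ν = 1) (h : mv (F.sec q) ν = κ) {c : ℝ} (hc : 0 < c) :
    (q, c • ∑ i, spinorAxis ν i • M.std q i) ∈ (F.spinDec κ).toDec.line := by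
  refine F.mem_line_toDec.2 ⟨F.sec q * toSL (suOf ν hν), ?_, c, hc, ?_⟩
  · change mv _ _ = _
    rw [mv_mul, mv_suOf, h]
  · rw [F.pt_mul, F.pt_sec q hq, F.vec_mul, F.vec_sec q hq]
    simp_rw [rot_suOf_one]

/-- A spin-decorated horosphere is determined up to sign by the decorated horosphere under it. -/
lemma eq_or_eq_neg_of_toDec {κ κ' : nonzeroSpinors}
    (h : (F.spinDec κ).toDec = (F.spinDec κ').toDec) :
    (κ' : Fin 2 → ℂ) = κ ∨ (κ' : Fin 2 → ℂ) = -(κ : Fin 2 → ℂ) := by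
  have hhor : F.pt '' fibre κ = F.pt '' fibre κ' := congrArg DecData.hor h
  obtain ⟨c, -, hc⟩ := F.exists_phase hhor.le
  have hB := slOf_mem_fibre κ
  have hl : (F.pt (slOf κ), F.vec (slOf κ) 1) ∈ (F.spinDec κ').toDec.line := by
    rw [← h]
    exact F.mem_line_toDec.2 ⟨_, hB, 1, one_pos, by rw [one_smul]⟩
  obtain ⟨B', hB', a, ha, hz⟩ := F.mem_line_toDec.1 hl
  obtain ⟨hp, hv⟩ := Prod.ext_iff.1 hz
  obtain ⟨u, rfl⟩ := F.exists_su _ _ hp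
  simp only at hv
  -- Equal horospheres make κ' a phase multiple of κ, so the comparison element u has κ₀ as an
  -- eigenvector.
  have hu0 : mv (toSL u) baseSpinor = c • baseSpinor := by
    have h1 : mv (slOf κ * toSL u) baseSpinor = κ' := hB'
    rw [hc, mv_mul, ← mv_slOf κ, ← mv_smul] at h1
    have h2 := congrArg (mv (slOf κ)⁻¹) h1
    rwa [mv_inv_mv, mv_inv_mv] at h2
  rw [F.vec_mul, Finset.smul_sum, F.vec_eq_sum (slOf κ) 1] at hv
  simp_rw [smul_smul] at hv
  have hx := F.sum_vec_injective (slOf κ) hv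
  have ho := rot_orthonormal u 1 1
  -- Both second vectors have length one, so the positive factor between them is 1.
  have ha1 : a = 1 := by
    have : a ^ 2 = 1 := by
      have e : ∀ k, a * rot u k 1 = (Pi.single 1 1 : Fin 3 → ℝ) k := fun k => (congrFun hx k).symm
      have e0 := e 0
      have e1 := e 1
      have e2 := e 2
      simp [Fin.sum_univ_three] at ho e0 e1 e2
      have : a ^ 2 = (a * rot u 0 1) ^ 2 + (a * rot u 1 1) ^ 2 + (a * rot u 2 1) ^ 2 := by
        linear_combination (-a ^ 2) * ho
      rw [this, e1]
      rcases e0 with e0 | e0 <;> rcases e2 with e2 | e2 <;> simp [e0, e2]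
    nlinarith
  have hu1 : (u : Mat) * pauli 1 * (u : Mat)ᴴ = pauli 1 := by
    have := (rot_eq_iff u 1 (Pi.single 1 1)).1 fun i => by
      have := congrFun hx i
      rw [ha1, one_mul] at this
      exact this.symm
    rw [this]
    simp [Pi.single_apply]
  rcases SU2.eq_one_or_eq_neg_one hu0 hu1 with h1 | h1
  · left
    have : mv (slOf κ * toSL u) baseSpinor = κ' := hB'
    have e : u = 1 := Subtype.ext h1
    rw [e, map_one, mul_one, mv_slOf] at this
    exact this.symm
  · right
    have : mv (slOf κ * toSL u) baseSpinor = κ' := hB'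
    have e : u = negOne := Subtype.ext h1
    rw [e, mv_mul, mv_negOne, mv, Matrix.mulVec_neg] at this
    rw [← this]
    congr 1

end Framing

/-! ### Decorations transported between the models -/

lemma push_id (d : DecData Mink) : d.push id = d := by
  apply DecData.ext
  · simp [DecData.push]
  · simp [DecData.push]

lemma push_push {E E' E'' : Type} [NormedAddCommGroup E] [NormedSpace ℝ E] [NormedAddCommGroup E']
    [NormedSpace ℝ E'] [NormedAddCommGroup E''] [NormedSpace ℝ E''] {f : E → E'} {g : E' → E''}
    {d : DecData E} (hf : ∀ z ∈ d.line, DifferentiableAt ℝ f z.1)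
    (hg : ∀ z ∈ d.line, DifferentiableAt ℝ g (f z.1)) :
    (d.push f).push g = d.push (g ∘ f) := by
  apply DecData.ext
  · simp [DecData.push, Set.image_image]
  · simp only [DecData.push, Set.image_image]
    refine Set.image_congr fun z hz => ?_
    rw [fderiv_comp _ (hg z hz) (hf z hz)]
    rfl

lemma toDec_hyperboloid (κ : nonzeroSpinors) :
    (hyperboloidChart.framing.spinDec κ).toDec = HMap (GMap (FMap κ)) := by
  rw [toDec_spinDec hyperboloidChart fun _ hx => exists_hyp_eq hx]
  exact push_id _

lemma toDec_disc (κ : nonzeroSpinors) :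
    (discChart.framing.spinDec κ).toDec = IMap (HMap (GMap (FMap κ))) :=
  toDec_spinDec discChart (fun _ hx => exists_hyp_eq hx) κ

lemma toDec_upper (κ : nonzeroSpinors) : (upperChart.framing.spinDec κ).toDec = KMap κ := by
  rw [toDec_spinDec upperChart fun _ hx => exists_hyp_eq hx, KMap, JMap, IMap, push_push]
  · rfl
  · exact fun z hz => discChart.differentiableAt hz.1.1
  · exact fun z hz => (contDiffAt_jMap (n := 1) (iMap_mem hz.1.1)).differentiableAt (by norm_num)

lemma toDec_upper_eq_JMap (κ : nonzeroSpinors) :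
    (upperChart.framing.spinDec κ).toDec = JMap (discChart.framing.spinDec κ).toDec := by
  rw [toDec_upper, toDec_disc, KMap]

lemma toDec_disc_eq_IMap (κ : nonzeroSpinors) :
    (discChart.framing.spinDec κ).toDec = IMap (hyperboloidChart.framing.spinDec κ).toDec := by
  rw [toDec_disc, toDec_hyperboloid]

lemma hor_eq_horosphere {E : Type} [NormedAddCommGroup E] [NormedSpace ℝ E] {M : HypModel E}
    (K : ModelChart M) {κ : nonzeroSpinors} {β : E → ℝ} {p : Mink} (hβ : HoroCut K.φ β p)
    (hp : gMap (fMap κ) = p) : (K.framing.spinDec κ).toDec.hor = M.horosphere β := by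
  rw [← hp] at hβ
  exact (K.framing.horosphere_eq (K.horoRep hβ)).symm

/-! ### The explicit centre, size and direction -/

lemma gMap_fMap_sphere {κ : Fin 2 → ℂ} (h : κ 1 ≠ 0) :
    gMap (fMap κ) = sphereNull (κ 0 / κ 1) (‖κ 1‖ ^ 2)⁻¹ := by
  have hN : Complex.normSq (κ 1) ≠ 0 := by simpa using h
  have e : (κ 0 / κ 1) = (κ 0 * star (κ 1)) * ((Complex.normSq (κ 1))⁻¹ : ℝ) := by
    rw [div_eq_mul_inv, Complex.inv_def, mul_assoc]; rfl
  have er : (κ 0 / κ 1).re = ((κ 0).re * (κ 1).re + (κ 0).im * (κ 1).im) / Complex.normSq (κ 1) := by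
    rw [e, Complex.re_mul_ofReal]; simp [div_eq_mul_inv]
  have ei : (κ 0 / κ 1).im = ((κ 0).im * (κ 1).re - (κ 0).re * (κ 1).im) / Complex.normSq (κ 1) := by
    rw [e, Complex.im_mul_ofReal]; simp [div_eq_mul_inv]; left; ring
  rw [gMap_fMap, sphereNull, er, ei, Complex.normSq_div, ← Complex.normSq_eq_norm_sq]
  ext i
  fin_cases i <;> simp <;> field_simp
  ring

lemma gMap_fMap_plane {κ : Fin 2 → ℂ} (h : κ 1 = 0) :
    gMap (fMap κ) = planeNull (‖κ 0‖ ^ 2) := by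
  rw [gMap_fMap, planeNull, ← Complex.normSq_eq_norm_sq, h]
  ext i
  fin_cases i <;> simp

lemma mem_line_upper {κ : nonzeroSpinors} {q : ℂ × ℝ} (hq : 0 < q.2) {ν : Fin 2 → ℂ}
    (hν : spinorNormSq ν = 1) (h : upMat q *ᵥ ν = κ) :
    (q, ((⟨q.2 * spinorAxis ν 0, q.2 * spinorAxis ν 1⟩ : ℂ), q.2 * spinorAxis ν 2)) ∈
      (upperChart.framing.spinDec κ).toDec.line := by
  have := upperChart.framing.mem_line_of_unit (q := q) hq hν (κ := κ) (by
    rw [← h, mv]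
    congr 1
    exact coe_upSec hq) one_pos
  rwa [one_smul, sum_upper_std] at this

lemma isDescribedBy_spinDec (κ : nonzeroSpinors) :
    IsDescribedBy ((κ : Fin 2 → ℂ) 0) ((κ : Fin 2 → ℂ) 1) (upperChart.framing.spinDec κ).toDec := by
  refine ⟨upperChart.framing.isDecorated κ, fun h => ⟨?_, ?_⟩, fun h => ⟨?_, fun z => ?_⟩⟩
  · exact hor_eq_horosphere upperChart (horoCut_sphere _ (by positivity)) (gMap_fMap_sphere h)
  · set ξ := (κ : Fin 2 → ℂ) 0
    set η := (κ : Fin 2 → ℂ) 1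
    have hn : (0 : ℝ) < ‖η‖ := norm_pos_iff.2 h
    have hnc : (‖η‖ : ℂ) ≠ 0 := by exact_mod_cast hn.ne'
    have hsq : Real.sqrt ((‖η‖ ^ 2)⁻¹) = ‖η‖⁻¹ := by
      rw [Real.sqrt_inv, Real.sqrt_sq hn.le]
    have hN : ‖η‖ ^ 2 = η.re ^ 2 + η.im ^ 2 := by
      rw [← Complex.normSq_eq_norm_sq, Complex.normSq_apply]; ring
    -- At the highest point q, the matrix `upMat q` takes ν = (0, η/|η|) to κ. The axis of ν is i
    -- ν̄₁² in the horizontal plane, and scaling it by the height |η|⁻² gives i η⁻².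
    have := mem_line_upper (κ := κ) (q := (ξ / η, (‖η‖ ^ 2)⁻¹)) (ν := ![0, (‖η‖⁻¹ : ℝ) * η])
      (by positivity) (by
        simp [spinorNormSq, Complex.normSq_eq_norm_sq]
        field_simp
        simp) (by
        ext i
        fin_cases i
        · simp [upMat, hsq, Matrix.vecHead, Matrix.vecTail]
          field_simp
          rfl
        · simp [upMat, hsq, Matrix.vecHead, Matrix.vecTail]
          field_simp
          rfl)
    convert this using 3
    · have e : (η ^ 2)⁻¹ = star (η ^ 2) * (((‖η‖ ^ 2) ^ 2)⁻¹ : ℝ) := by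
        rw [Complex.inv_def, Complex.normSq_eq_norm_sq, norm_pow]; rfl
      rw [e]
      apply Complex.ext
      · rw [← mul_assoc, Complex.re_mul_ofReal]
        simp [spinorAxis, pow_two]
        field_simp
        ring
      · rw [← mul_assoc, Complex.im_mul_ofReal]
        simp [spinorAxis, pow_two]
        field_simp
    · simp [spinorAxis]
  · exact hor_eq_horosphere upperChart horoCut_plane (gMap_fMap_plane h)
  · have h0 : (κ : Fin 2 → ℂ) 0 ≠ 0 := by
      intro h0
      apply κ.2
      ext i
      fin_cases i
      · exact h0
      · exact h
    set ξ := (κ : Fin 2 → ℂ) 0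
    have hn : (0 : ℝ) < ‖ξ‖ := norm_pos_iff.2 h0
    have hnc : (‖ξ‖ : ℂ) ≠ 0 := by exact_mod_cast hn.ne'
    -- At every z the matrix `upMat q` takes ν = (ξ/|ξ|, 0) to κ. Its axis is i ν₀², and the height
    -- |ξ|² turns it into i ξ².
    have := mem_line_upper (κ := κ) (q := (z, ‖ξ‖ ^ 2)) (ν := ![(‖ξ‖⁻¹ : ℝ) * ξ, 0])
      (by positivity) (by
        simp [spinorNormSq, Complex.normSq_eq_norm_sq]
        field_simp
        simp) (by
        ext i
        fin_cases i
        · simp [upMat, Matrix.vecHead]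
          field_simp
          rfl
        · simp [upMat, Matrix.vecHead]
          exact h.symm)
    convert this using 3
    · apply Complex.ext
      · simp [spinorAxis, pow_two]
        field_simp
        ring
      · simp [spinorAxis, pow_two]
        field_simp
    · simp [spinorAxis]

/-! ### Existence of the lifts -/

lemma bracket_add_smul {E : Type} [AddCommGroup E] [Module ℝ E] (p v : E) (a : ℝ) {b : ℝ}
    (hb : 0 < b) : bracket p (a • p + b • v) = bracket p v := by
  refine FlagData.ext rfl ?_ ?_
  · apply le_antisymm
    · refine Submodule.span_le.2 ?_
      rintro x (rfl | rfl)
      · exact Submodule.subset_span (by simp)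
      · exact Submodule.add_mem _ (Submodule.smul_mem _ _ (Submodule.subset_span (by simp)))
          (Submodule.smul_mem _ _ (Submodule.subset_span (by simp)))
    · refine Submodule.span_le.2 ?_
      rintro x (rfl | rfl)
      · exact Submodule.subset_span (by simp)
      · have e : x = b⁻¹ • (a • p + b • x) + (-(b⁻¹ * a)) • p := by
          rw [smul_add, smul_smul, smul_smul, inv_mul_cancel₀ hb.ne']
          module
        have hm : b⁻¹ • (a • p + b • x) + (-(b⁻¹ * a)) • p ∈ Submodule.span ℝ {p, a • p + b • x} :=
          Submodule.add_mem _ (Submodule.smul_mem _ _ (Submodule.subset_span (by simp)))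
            (Submodule.smul_mem _ _ (Submodule.subset_span (by simp)))
        rwa [← e] at hm
  · ext w
    constructor
    · rintro ⟨c, d, hd, rfl⟩
      exact ⟨c + d * a, d * b, mul_pos hd hb, by module⟩
    · rintro ⟨c, d, hd, rfl⟩
      refine ⟨c - d * b⁻¹ * a, d * b⁻¹, by positivity, ?_⟩
      have : d • v = (d * b⁻¹ * b) • v := by rw [inv_mul_cancel_right₀ hb.ne']
      rw [this]
      module

lemma GMap_bracket (S U : Mat) : GMap (bracket S U) = bracket (gMap S) (gMap U) := by
  refine FlagData.ext rfl ?_ ?_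
  · simp [GMap, bracket, Submodule.map_span, Set.image_pair]
  · ext w
    constructor
    · rintro ⟨_, ⟨a, b, hb, rfl⟩, rfl⟩
      exact ⟨a, b, hb, by simp⟩
    · rintro ⟨a, b, hb, rfl⟩
      exact ⟨_, ⟨a, b, hb, rfl⟩, by simp⟩

lemma isMinkFlag_GMap {φ : FlagData Mat} (h : IsHermFlag φ) : IsMinkFlag (GMap φ) := by
  obtain ⟨⟨hS, hdet, htr⟩, U, hU, hadj, hli, hφ⟩ := h
  refine ⟨⟨?_, ?_⟩, gMap U, ?_, ?_, ?_⟩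
  · change mink (gMap φ.pt) (gMap φ.pt) = 0
    rw [mink_gMap hS hS, Matrix.adjugate_mul, hdet]
    simp
  · change 0 < gMap φ.pt 0
    rw [Matrix.trace_fin_two] at htr
    simpa [gMap_apply] using htr
  · change mink (gMap φ.pt) (gMap U) = 0
    rw [mink_gMap hS hU, hadj]
    simp
  · rw [LinearIndependent.pair_iff] at hli ⊢
    intro s t hst
    apply hli
    apply gMap_injOn
    · rw [Matrix.IsHermitian, Matrix.conjTranspose_add, Matrix.conjTranspose_smul,
        Matrix.conjTranspose_smul, hS.eq, hU.eq]
      simp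
    · exact Matrix.isHermitian_zero
    · rw [map_add, map_smul, map_smul, map_zero]
      exact hst
  · conv_lhs => rw [hφ, GMap_bracket]
    rfl

/-- The direction chosen by 𝒵 is purely spatial, and its spatial part is a multiple of the rotated
second axis; this also gives its length. -/
lemma gMap_dfMap_zMap (κ : Fin 2 → ℂ) :
    gMap (dfMap κ (zMap κ)) = (2 : ℝ) • (Fin.cons 0 (spinorAxis κ) : Mink) := by
  rw [gMap_apply]
  simp only [dfMap_apply]
  ext i
  fin_cases i <;> simp [zMap, spinorAxis] <;> ring

lemma spinorAxis_dotProduct (κ : Fin 2 → ℂ) :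
    spinorAxis κ ⬝ᵥ spinorAxis κ = spinorNormSq κ ^ 2 := by
  rw [dotProduct_R3, spinorNormSq, Complex.normSq_apply, Complex.normSq_apply]
  simp [spinorAxis]
  ring

lemma dfMap_isHermitian (κ ν : Fin 2 → ℂ) : (dfMap κ ν).IsHermitian := by
  rw [dfMap_eq, Matrix.IsHermitian, Matrix.conjTranspose_add, Matrix.conjTranspose_vecMulVec,
    Matrix.conjTranspose_vecMulVec, star_star, star_star, add_comm]

/-- For independence, the time coordinate of the direction vanishes and that of f(κ) does not, while
the spatial part of the direction has nonzero length. -/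
lemma isHermFlag_FMap {κ : Fin 2 → ℂ} (h : κ ≠ 0) : IsHermFlag (FMap κ) := by
  have hN := spinorNormSq_pos h
  refine ⟨⟨fMap_isHermitian κ, ?_, ?_⟩, dfMap κ (zMap κ), dfMap_isHermitian _ _, ?_, ?_, rfl⟩
  · change (fMap κ).det = 0
    simp [fMap, Matrix.det_fin_two, Matrix.vecMulVec_apply]
    ring
  · change 0 < (fMap κ).trace.re
    simp only [spinorNormSq, Complex.normSq_apply] at hN
    simpa [fMap, Matrix.trace_fin_two, Matrix.vecMulVec_apply] using hN
  · change ((fMap κ).adjugate * _).trace = 0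
    rw [Matrix.adjugate_fin_two]
    simp [Matrix.trace_fin_two, Matrix.vecMul, dotProduct, Fin.sum_univ_two, dfMap_apply, fMap,
      Matrix.vecMulVec_apply, zMap]
    ring
  · change LinearIndependent ℝ ![fMap κ, _]
    rw [LinearIndependent.pair_iff]
    intro s t hst
    have h1 := congrArg gMap hst
    rw [map_add, map_smul, map_smul, map_zero, gMap_dfMap_zMap, gMap_fMap] at h1
    have hs : s = 0 := by
      have := congrFun h1 0
      simp at this
      exact this.resolve_right hN.ne'
    refine ⟨hs, ?_⟩
    rw [hs] at h1
    have h0 := congrFun h1 1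
    have h2 := congrFun h1 2
    have h3 := congrFun h1 3
    by_contra ht
    have e0 : spinorAxis κ 0 = 0 := by
      simpa [ht, -Fin.cons_succ, show (Fin.cons 0 (spinorAxis κ) : Mink) 1 = spinorAxis κ 0 from rfl] using h0
    have e1 : spinorAxis κ 1 = 0 := by
      simpa [ht, -Fin.cons_succ, show (Fin.cons 0 (spinorAxis κ) : Mink) 2 = spinorAxis κ 1 from rfl] using h2
    have e2 : spinorAxis κ 2 = 0 := by
      simpa [ht, -Fin.cons_succ, show (Fin.cons 0 (spinorAxis κ) : Mink) 3 = spinorAxis κ 2 from rfl] using h3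
    have := spinorAxis_dotProduct κ
    rw [dotProduct_R3, e0, e1, e2] at this
    have : spinorNormSq κ ^ 2 ≠ 0 := by positivity
    simp_all

/-- The spinor with norm `r` and direction `u`. -/
def polarSpinor (r : ℝ) (u : SU2) : Fin 2 → ℂ := (r : ℂ) • mv (toSL u) baseSpinor

lemma spinorNormSq_polarSpinor (r : ℝ) (u : SU2) : spinorNormSq (polarSpinor r u) = r ^ 2 := by
  rw [polarSpinor, spinorNormSq_smul, spinorNormSq_su, baseSpinor_normSq, Complex.normSq_ofReal]
  ring

lemma polarSpinor_ne_zero {r : ℝ} (hr : 0 < r) (u : SU2) : polarSpinor r u ≠ 0 :=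
  ne_zero_of_spinorNormSq (by rw [spinorNormSq_polarSpinor]; positivity)

lemma fMap_apply (κ : Fin 2 → ℂ) (i j : Fin 2) : fMap κ i j = κ i * star (κ j) := rfl

lemma fMap_real_smul (r : ℝ) (κ : Fin 2 → ℂ) : fMap ((r : ℂ) • κ) = (r ^ 2) • fMap κ := by
  ext i j
  rw [Matrix.smul_apply, fMap_apply, fMap_apply]
  apply Complex.ext <;> simp [pow_two] <;> ring

lemma dfMap_real_smul (r : ℝ) (κ : Fin 2 → ℂ) :
    dfMap ((r : ℂ) • κ) (zMap ((r : ℂ) • κ)) = (r ^ 2) • dfMap κ (zMap κ) := by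
  ext i j
  rw [Matrix.smul_apply, dfMap_apply, dfMap_apply]
  fin_cases i <;> fin_cases j <;> apply Complex.ext <;> simp [zMap, pow_two] <;> ring

/-- At κ₀ the matrix f is half of 1 + σ_X; equivariance and real homogeneity of degree 2 do the
rest. This relates spinors to the `ray` condition of spin flags. -/
lemma fMap_polarSpinor (r : ℝ) (u : SU2) :
    fMap (polarSpinor r u) = (r ^ 2 / 2) • ((u : Mat) * (1 + pauli 0) * (u : Mat)ᴴ) := by
  have h0 : (1 + pauli 0 : Mat) = (2 : ℝ) • fMap baseSpinor := by
    have h := sqrtHalf_mul_self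
    ext i j
    rw [Matrix.smul_apply, fMap_apply]
    fin_cases i <;> fin_cases j <;> apply Complex.ext <;>
      simp [baseSpinor, pauli] <;> linarith
  have h1 := fMap_real_smul r (mv (toSL u) baseSpinor)
  rw [← polarSpinor] at h1
  rw [h1, h0, fMap_mv, coe_toSL]
  simp only [Matrix.mul_smul, Matrix.smul_mul, smul_smul]
  congr 1
  ring

/-- Both f and its derivative along 𝒵 scale by r², so the case of unit spinors suffices. This
relates spinors to the `half` condition of spin flags. -/
lemma exists_dfMap_polarSpinor (r : ℝ) (u : SU2) : ∃ b : ℝ,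
    dfMap (polarSpinor r u) (zMap (polarSpinor r u)) =
      b • fMap (polarSpinor r u) + r ^ 2 • ((u : Mat) * pauli 1 * (u : Mat)ᴴ) := by
  have hm : toSL u ∈ Framing.fibre (mv (toSL u) baseSpinor) := rfl
  obtain ⟨b, hb⟩ := exists_dfMap_eq
    (κ := ⟨mv (toSL u) baseSpinor, mv_ne_zero _ baseSpinor_ne_zero⟩) hm
  simp only [spinorNormSq_su, baseSpinor_normSq, one_smul, coe_toSL] at hb
  refine ⟨b, ?_⟩
  have h1 := fMap_real_smul r (mv (toSL u) baseSpinor)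
  rw [← polarSpinor] at h1
  have h2 := dfMap_real_smul r (mv (toSL u) baseSpinor)
  rw [← polarSpinor] at h2
  rw [h2, hb, h1]
  module

/-- The unit spinor in the direction of a nonzero spinor. -/
def unitSpinor (κ : Fin 2 → ℂ) : Fin 2 → ℂ := (((Real.sqrt (spinorNormSq κ))⁻¹ : ℝ) : ℂ) • κ

lemma spinorNormSq_unitSpinor {κ : Fin 2 → ℂ} (h : κ ≠ 0) : spinorNormSq (unitSpinor κ) = 1 := by
  have hN := spinorNormSq_pos h
  rw [unitSpinor, spinorNormSq_smul, Complex.normSq_ofReal, ← mul_inv, Real.mul_self_sqrt hN.le,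
    inv_mul_cancel₀ hN.ne']

lemma polarSpinor_unitSpinor {κ : Fin 2 → ℂ} (h : κ ≠ 0) :
    polarSpinor (Real.sqrt (spinorNormSq κ)) (suOf _ (spinorNormSq_unitSpinor h)) = κ := by
  have hN := Real.sqrt_pos.2 (spinorNormSq_pos h)
  rw [polarSpinor, mv_suOf, unitSpinor, smul_smul, ← Complex.ofReal_mul, mul_inv_cancel₀ hN.ne',
    Complex.ofReal_one, one_smul]

/-- The spin flag of a nonzero spinor. -/
def spinFlagF (κ : nonzeroSpinors) : HermSpinFlag where
  flag := FMap κ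
  lift := suOf _ (spinorNormSq_unitSpinor κ.2)
  isFlag := isHermFlag_FMap κ.2
  ray := by
    have hN := spinorNormSq_pos κ.2
    have hs := Real.sqrt_pos.2 hN
    have h := fMap_polarSpinor (Real.sqrt (spinorNormSq κ)) (suOf _ (spinorNormSq_unitSpinor κ.2))
    rw [polarSpinor_unitSpinor κ.2] at h
    refine ⟨(Real.sqrt (spinorNormSq κ) ^ 2 / 2)⁻¹, by positivity, ?_⟩
    change _ = _ • fMap κ
    rw [h, inv_smul_smul₀ (by positivity)]
  half := by
    have hN := spinorNormSq_pos κ.2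
    have hs := Real.sqrt_pos.2 hN
    obtain ⟨b, h⟩ := exists_dfMap_polarSpinor (Real.sqrt (spinorNormSq κ))
      (suOf _ (spinorNormSq_unitSpinor κ.2))
    rw [polarSpinor_unitSpinor κ.2] at h
    -- These coefficients solve the formula for D f(𝒵κ) for the term u σ_Y u^*.
    refine ⟨-((Real.sqrt (spinorNormSq κ) ^ 2)⁻¹ * b), (Real.sqrt (spinorNormSq κ) ^ 2)⁻¹,
      by positivity, ?_⟩
    rw [h, smul_add, inv_smul_smul₀ (by positivity)]
    module

lemma continuous_spinorNormSq : Continuous spinorNormSq := by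
  unfold spinorNormSq
  exact (Complex.continuous_normSq.comp (continuous_apply 0)).add
    (Complex.continuous_normSq.comp (continuous_apply 1))

lemma continuous_spinFlagF : Continuous spinFlagF := by
  refine continuous_induced_rng.2 (Continuous.prodMk ?_ ?_)
  · change Continuous fun κ : nonzeroSpinors => fMap κ
    have h : Continuous fun κ : nonzeroSpinors => (κ : Fin 2 → ℂ) := continuous_subtype_val
    unfold fMap
    exact h.matrix_vecMulVec (continuous_star.comp h)
  · refine continuous_induced_rng.2 ?_
    have h1 : Continuous fun κ : nonzeroSpinors => (⟨unitSpinor κ, ne_zero_of_spinorNormSq (by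
        rw [spinorNormSq_unitSpinor κ.2]; norm_num)⟩ : nonzeroSpinors) := by
      refine Continuous.subtype_mk ?_ _
      refine Continuous.smul (Complex.continuous_ofReal.comp (Continuous.inv₀
        (Real.continuous_sqrt.comp (continuous_spinorNormSq.comp continuous_subtype_val))
        fun κ => ?_)) continuous_subtype_val
      exact (Real.sqrt_pos.2 (spinorNormSq_pos κ.2)).ne'
    have h2 : Continuous fun B : SL2C => (B : Mat) := continuous_induced_dom
    exact h2.comp (continuous_slOf.comp h1)

/-- The lift of `GMap` to spin flags. -/
def spinFlagG (x : HermSpinFlag) : MinkSpinFlag where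
  flag := GMap x.flag
  lift := x.lift
  isFlag := isMinkFlag_GMap x.isFlag
  ray := by
    obtain ⟨c, hc, h⟩ := x.ray
    exact ⟨c, hc, by rw [h, map_smul]; rfl⟩
  half := ⟨_, x.half, rfl⟩

lemma continuous_spinFlagG : Continuous spinFlagG := by
  have h : Continuous fun x : HermSpinFlag => (x.flag.pt, x.lift) := continuous_induced_dom
  exact continuous_induced_rng.2 ((continuous_gMap.comp h.fst).prodMk h.snd)

/-- The spinor of a spin flag. -/
def flagSpinor (x : MinkSpinFlag) : nonzeroSpinors :=
  ⟨polarSpinor (Real.sqrt (x.flag.pt 0)) x.lift,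
    polarSpinor_ne_zero (Real.sqrt_pos.2 x.isFlag.1.2) _⟩

lemma continuous_flagSpinor : Continuous flagSpinor := by
  have h : Continuous fun x : MinkSpinFlag => (x.flag.pt, x.lift) := continuous_induced_dom
  refine Continuous.subtype_mk ?_ _
  exact (Complex.continuous_ofReal.comp (Real.continuous_sqrt.comp
    ((continuous_apply 0).comp h.fst))).smul
    (continuous_mv (continuous_toSL.comp h.snd) continuous_const)

/-- The lift fixes the ray and the positive half-plane of the flag, and the time coordinate p₀ =
|κ|² fixes the scale, which is why the radius is √p₀. -/
lemma GMap_FMap_flagSpinor (x : MinkSpinFlag) : GMap (FMap (flagSpinor x)) = x.flag := by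
  obtain ⟨hp, v, -, -, hφ⟩ := x.isFlag
  have hp0 := hp.2
  obtain ⟨c, hc, hray⟩ := x.ray
  have hpt : gMap (fMap (flagSpinor x)) = x.flag.pt := by
    have h1 : gMap (fMap (flagSpinor x)) = (x.flag.pt 0 / 2 * c) • x.flag.pt := by
      change gMap (fMap (polarSpinor _ _)) = _
      rw [fMap_polarSpinor, map_smul, hray, Real.sq_sqrt hp0.le, smul_smul]
    have h2 : gMap (fMap (flagSpinor x)) 0 = x.flag.pt 0 := by
      rw [gMap_fMap]
      change spinorNormSq (polarSpinor _ _) = _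
      rw [spinorNormSq_polarSpinor, Real.sq_sqrt hp0.le]
    -- Proportional null vectors with the same nonzero time coordinate are equal.
    have h3 : x.flag.pt 0 / 2 * c = 1 := by
      have := congrFun h1 0
      rw [h2, Pi.smul_apply, smul_eq_mul] at this
      field_simp at this ⊢
      linarith
    rw [h1, h3, one_smul]
  obtain ⟨b, hb⟩ := exists_dfMap_polarSpinor (Real.sqrt (x.flag.pt 0)) x.lift
  have hb' : gMap (dfMap (flagSpinor x) (zMap (flagSpinor x))) =
      b • x.flag.pt + x.flag.pt 0 • gMap ((x.lift : Mat) * pauli 1 * (x.lift : Mat)ᴴ) := by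
    have hpt' : gMap (fMap (polarSpinor (Real.sqrt (x.flag.pt 0)) x.lift)) = x.flag.pt := hpt
    change gMap (dfMap (polarSpinor _ _) (zMap (polarSpinor _ _))) = _
    rw [hb, map_add, map_smul, map_smul, Real.sq_sqrt hp0.le, hpt']
  have hhalf := x.half
  rw [hφ] at hhalf
  obtain ⟨a', b', hb'', hv⟩ := hhalf
  rw [FMap, GMap_bracket, hpt, hb', bracket_add_smul _ _ _ hp0, hv, bracket_add_smul _ _ _ hb'',
    ← hφ]

/-- Continuous lifts of the five maps. -/
lemma areSpinLifts_spinDec : AreSpinLifts spinFlagF spinFlagG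
    (hyperboloidChart.framing.spinDec ∘ flagSpinor)
    (discChart.framing.spinDec ∘ hyperboloidChart.framing.spinDecHomeo.symm)
    (upperChart.framing.spinDec ∘ discChart.framing.spinDecHomeo.symm) where
  contF := continuous_spinFlagF
  contG := continuous_spinFlagG
  contH := hyperboloidChart.framing.continuous_spinDec.comp continuous_flagSpinor
  contI := discChart.framing.continuous_spinDec.comp (Homeomorph.continuous _)
  contJ := upperChart.framing.continuous_spinDec.comp (Homeomorph.continuous _)
  liftF _ := rfl
  liftG _ := rfl
  liftH x := by rw [Function.comp, toDec_hyperboloid, GMap_FMap_flagSpinor]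
  liftI x := by
    obtain ⟨κ, rfl⟩ := hyperboloidChart.framing.spinDec_surjective x
    rw [Function.comp, Framing.spinDecHomeo_symm_spinDec, toDec_disc_eq_IMap]
  liftJ x := by
    obtain ⟨κ, rfl⟩ := discChart.framing.spinDec_surjective x
    rw [Function.comp, Framing.spinDecHomeo_symm_spinDec, toDec_upper_eq_JMap]

/-! ### Uniqueness of the lifts -/

/-- The homeomorphism `κ ↦ -κ`. -/
def negSpinor : nonzeroSpinors ≃ₜ nonzeroSpinors where
  toFun κ := ⟨-κ, fun h => κ.2 (neg_eq_zero.1 h)⟩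
  invFun κ := ⟨-κ, fun h => κ.2 (neg_eq_zero.1 h)⟩
  left_inv _ := Subtype.ext (neg_neg _)
  right_inv _ := Subtype.ext (neg_neg _)
  continuous_toFun := Continuous.subtype_mk continuous_subtype_val.neg _
  continuous_invFun := Continuous.subtype_mk continuous_subtype_val.neg _

lemma spinorAct_negSpinor (A : SL2C) (κ : nonzeroSpinors) :
    spinorAct A (negSpinor κ) = negSpinor (spinorAct A κ) := by
  apply Subtype.ext
  change (A : Mat) *ᵥ (-(κ : Fin 2 → ℂ)) = -((A : Mat) *ᵥ (κ : Fin 2 → ℂ))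
  exact Matrix.mulVec_neg _ _

/-- As κ ≠ -κ, the set where f is the identity is clopen in a connected space. -/
lemma eq_id_or_eq_neg {f : nonzeroSpinors → nonzeroSpinors} (hf : Continuous f)
    (h : ∀ κ, (f κ : Fin 2 → ℂ) = κ ∨ (f κ : Fin 2 → ℂ) = -(κ : Fin 2 → ℂ)) :
    f = id ∨ f = negSpinor := by
  have h' : ∀ κ, f κ = κ ∨ f κ = negSpinor κ := fun κ => (h κ).imp (fun e => Subtype.ext e)
    fun e => Subtype.ext e
  have hne : ∀ κ : nonzeroSpinors, κ ≠ negSpinor κ := fun κ e => by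
    have : (κ : Fin 2 → ℂ) = -κ := congrArg Subtype.val e
    exact κ.2 (self_eq_neg.1 this)
  have hc : IsClopen {κ | f κ = κ} := by
    refine ⟨isClosed_eq hf continuous_id, ?_⟩
    have : {κ | f κ = κ} = {κ | f κ = negSpinor κ}ᶜ := by
      ext κ
      constructor
      · intro e e'
        exact hne κ ((show f κ = κ from e).symm.trans e')
      · intro e
        exact (h' κ).resolve_right e
    rw [this]
    exact (isClosed_eq hf negSpinor.continuous).isOpen_compl
  rcases isClopen_iff.1 hc with e | e
  · right
    funext κ
    refine (h' κ).resolve_left fun e' => ?_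
    have : κ ∈ {κ | f κ = κ} := e'
    rw [e] at this
    exact this
  · left
    funext κ
    have : κ ∈ {κ | f κ = κ} := by rw [e]; trivial
    exact this

lemma AreSpinLifts.continuous_comp {Ft Gt Ht It Jt} (h : AreSpinLifts Ft Gt Ht It Jt) :
    Continuous (Jt ∘ It ∘ Ht ∘ Gt ∘ Ft) :=
  h.contJ.comp (h.contI.comp (h.contH.comp (h.contG.comp h.contF)))

lemma AreSpinLifts.toDec_comp {Ft Gt Ht It Jt} (h : AreSpinLifts Ft Gt Ht It Jt)
    (κ : nonzeroSpinors) : ((Jt ∘ It ∘ Ht ∘ Gt ∘ Ft) κ).toDec = KMap κ := by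
  simp only [Function.comp, h.liftJ, h.liftI, h.liftH, h.liftG, h.liftF, KMap]

/-- Every composite of lifts is the standard one up to sign. -/
lemma eq_spinDec_comp {Kt : nonzeroSpinors → SpinDecHorosphere upper} (hc : Continuous Kt)
    (h : ∀ κ, (Kt κ).toDec = KMap κ) :
    Kt = upperChart.framing.spinDec ∘ id ∨ Kt = upperChart.framing.spinDec ∘ negSpinor := by
  have hK : ∀ κ, Kt κ = upperChart.framing.spinDec (upperChart.framing.spinDecHomeo.symm (Kt κ)) :=
    fun κ => (upperChart.framing.spinDecHomeo.apply_symm_apply (Kt κ)).symm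
  have h1 : Kt = upperChart.framing.spinDec ∘ fun κ => upperChart.framing.spinDecHomeo.symm (Kt κ) :=
    funext hK
  have hf : Continuous fun κ => upperChart.framing.spinDecHomeo.symm (Kt κ) :=
    upperChart.framing.spinDecHomeo.symm.continuous.comp hc
  rcases eq_id_or_eq_neg hf fun κ => upperChart.framing.eq_or_eq_neg_of_toDec (by
      rw [← hK, h, toDec_upper]) with e | e
  · left; rw [h1, e]
  · right; rw [h1, e]

/-! ### Coordinates of decorated horospheres -/

/-- The spatial part of the light-like vector of a spinor. -/
def spinorPos (κ : Fin 2 → ℂ) : R3 :=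
  ![2 * ((κ 0).re * (κ 1).re + (κ 0).im * (κ 1).im),
    2 * ((κ 0).im * (κ 1).re - (κ 0).re * (κ 1).im),
    (κ 0).re ^ 2 + (κ 0).im ^ 2 - (κ 1).re ^ 2 - (κ 1).im ^ 2]

lemma gMap_fMap_eq_cons (κ : Fin 2 → ℂ) :
    gMap (fMap κ) = (Fin.cons (spinorNormSq κ) (spinorPos κ) : Mink) := by
  rw [gMap_fMap]
  ext i
  fin_cases i <;> simp [spinorNormSq, spinorPos, Complex.normSq_apply]
  ring

lemma spinorPos_dotProduct (κ : Fin 2 → ℂ) :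
    spinorPos κ ⬝ᵥ spinorPos κ = spinorNormSq κ ^ 2 := by
  rw [dotProduct_R3, spinorNormSq, Complex.normSq_apply, Complex.normSq_apply]
  simp [spinorPos]
  ring

/-- The coordinates of the decorated horosphere of a spinor. -/
def spinorCoord (κ : Fin 2 → ℂ) : R3 × R3 × ℝ :=
  ((spinorNormSq κ)⁻¹ • spinorPos κ, (spinorNormSq κ)⁻¹ • spinorAxis κ,
    (spinorNormSq κ - 1) / (spinorNormSq κ + 1))

/-- The third coordinate solves (1 + s)/(1 - s) = |κ|². -/
lemma discNull_spinorCoord {κ : Fin 2 → ℂ} (h : κ ≠ 0) :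
    discNull (spinorCoord κ).1 (spinorCoord κ).2.2 = gMap (fMap κ) := by
  have hN := spinorNormSq_pos h
  rw [gMap_fMap_eq_cons]
  simp only [spinorCoord]
  generalize spinorNormSq κ = N at *
  have e1 : (1 + (N - 1) / (N + 1)) / (1 - (N - 1) / (N + 1)) = N := by
    have : 1 - (N - 1) / (N + 1) = 2 / (N + 1) := by field_simp; ring
    rw [this]
    field_simp
    ring
  rw [discNull, e1]
  ext i
  refine Fin.cases ?_ (fun k => ?_) i
  · simp
  · simp [hN.ne']

lemma dotProduct_inv_smul {w : R3} {N : ℝ} (hN : 0 < N) (h : w ⬝ᵥ w = N ^ 2) :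
    (N⁻¹ • w) ⬝ᵥ (N⁻¹ • w) = 1 := by
  rw [smul_dotProduct, dotProduct_smul, h]
  simp only [smul_eq_mul]
  field_simp

lemma spinorCoord_norm {κ : Fin 2 → ℂ} (h : κ ≠ 0) :
    (spinorCoord κ).1 ⬝ᵥ (spinorCoord κ).1 = 1 ∧ (spinorCoord κ).2.1 ⬝ᵥ (spinorCoord κ).2.1 = 1 ∧
      -1 < (spinorCoord κ).2.2 ∧ (spinorCoord κ).2.2 < 1 := by
  have hN := spinorNormSq_pos h
  refine ⟨dotProduct_inv_smul hN (spinorPos_dotProduct κ),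
    dotProduct_inv_smul hN (spinorAxis_dotProduct κ), ?_, ?_⟩
  · change _ < (_ - 1) / (_ + 1)
    rw [lt_div_iff₀ (by linarith)]; linarith
  · change (_ - 1) / (_ + 1) < _
    rw [div_lt_one (by linarith)]; linarith

lemma mv_slOf_zMap (κ : nonzeroSpinors) :
    mv (slOf κ) (zMap baseSpinor) = (((spinorNormSq κ)⁻¹ : ℝ) : ℂ) • zMap κ := by
  have h2 := sqrtHalf_mul_self_complex
  change slMat κ *ᵥ _ = _
  ext i
  fin_cases i <;>
    simp [slMat, zMap, baseSpinor, Matrix.mulVec, dotProduct, Fin.sum_univ_two]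
  · linear_combination (2 * Complex.I * (starRingEnd ℂ) ((κ : Fin 2 → ℂ) 1) / (spinorNormSq κ : ℂ)) * h2
  · linear_combination (-2 * Complex.I * (starRingEnd ℂ) ((κ : Fin 2 → ℂ) 0) / (spinorNormSq κ : ℂ)) * h2

lemma one_eq_fMap_add : (1 : Mat) = fMap baseSpinor + fMap (zMap baseSpinor) := by
  have h := sqrtHalf_mul_self
  ext i j
  rw [Matrix.add_apply, fMap_apply, fMap_apply]
  fin_cases i <;> fin_cases j <;> apply Complex.ext <;>
    simp [baseSpinor, zMap] <;> linarith

lemma gMap_fMap_zMap (κ : Fin 2 → ℂ) :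
    gMap (fMap (zMap κ)) = (Fin.cons (spinorNormSq κ) (-spinorPos κ) : Mink) := by
  rw [gMap_fMap]
  ext i
  fin_cases i <;> simp [spinorNormSq, spinorPos, Complex.normSq_apply, zMap] <;> ring

/-- The identity matrix is f(κ₀) + f(𝒵κ₀), which `slOf κ` takes to f(κ) + |κ|⁻⁴ f(𝒵κ), and f(𝒵κ) is
f(κ) with its spatial part reversed. So the point lies on the line from the origin towards the
centre of the horosphere. -/
lemma hyp_slOf (κ : nonzeroSpinors) : hyp (slOf κ) =
    (Fin.cons ((spinorNormSq κ + (spinorNormSq κ)⁻¹) / 2)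
      (((1 - ((spinorNormSq κ)⁻¹) ^ 2) / 2) • spinorPos κ) : Mink) := by
  have hN := spinorNormSq_pos κ.2
  rw [hyp, conjVec, one_eq_fMap_add, mul_add, add_mul, ← fMap_mv, ← fMap_mv, mv_slOf, mv_slOf_zMap,
    fMap_real_smul, map_add, map_smul, gMap_fMap_eq_cons, gMap_fMap_zMap]
  ext i
  refine Fin.cases ?_ (fun k => ?_) i
  · simp
    field_simp
  · simp
    ring

lemma conjVec_slOf (κ : nonzeroSpinors) : conjVec (slOf κ) (pauli 1) =
    (spinorNormSq κ)⁻¹ • (Fin.cons 0 (spinorAxis κ) : Mink) := by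
  have e : dfMap (κ : Fin 2 → ℂ) ((((spinorNormSq κ)⁻¹ : ℝ) : ℂ) • zMap κ) =
      (spinorNormSq κ)⁻¹ • dfMap κ (zMap κ) := by
    have := dfMap_add_smul κ (zMap κ) (spinorNormSq κ)⁻¹ 0
    simpa using this
  rw [conjVec, ← dfMap_baseSpinor, ← dfMap_mv, mv_slOf, mv_slOf_zMap, e, map_smul,
    gMap_dfMap_zMap, smul_smul, smul_smul]
  congr 1
  ring

/-- The frame of `slOf κ` sits at the point s n, and its second vector is purely spatial. On such a
vector the derivative of the projection divides by 1 + T, which is compensated by the positive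
factor 1 + T. -/
lemma coord_mem_line (κ : nonzeroSpinors) :
    ((spinorCoord κ).2.2 • (spinorCoord κ).1, (spinorCoord κ).2.1) ∈
      (discChart.framing.spinDec κ).toDec.line := by
  have hN := spinorNormSq_pos κ.2
  have hx := hyp_mem (slOf κ)
  have h0 := one_add_ne_zero hx
  have hpos : 0 < 1 + hyp (slOf κ) 0 := by linarith [hx.2]
  refine discChart.framing.mem_line_toDec.2 ⟨slOf κ, Framing.slOf_mem_fibre κ, _, hpos, ?_⟩
  refine Prod.ext ?_ ?_
  · change _ = iMap (hyp (slOf κ))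
    rw [hyp_slOf]
    ext k
    simp [spinorCoord, iMap]
    generalize spinorNormSq (κ : Fin 2 → ℂ) = N at *
    have : 1 + (N + N⁻¹) / 2 = (N + 1) ^ 2 / (2 * N) := by field_simp; ring
    rw [this]
    field_simp
    ring
  · change _ = _ • fderiv ℝ iMap (hyp (slOf κ)) (conjVec (slOf κ) (pauli 1))
    ext k
    rw [Pi.smul_apply, fderiv_iMap h0, conjVec_slOf]
    simp [spinorCoord]
    field_simp

lemma isCoord_spinorCoord (κ : nonzeroSpinors) :
    IsCoord (upperChart.framing.spinDec κ).toDec (spinorCoord κ) := by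
  obtain ⟨h1, h2, h3, h4⟩ := spinorCoord_norm κ.2
  exact ⟨h1, h2, h3, h4, (discChart.framing.spinDec κ).toDec, discChart.framing.isDecorated κ,
    (toDec_upper_eq_JMap κ).symm,
    hor_eq_horosphere discChart (horoCut_disc h1 h4) (discNull_spinorCoord κ.2).symm,
    coord_mem_line κ⟩

lemma jInv_jMap {v : R3} (hv : v ∈ disc.carrier) : jInv (jMap v) = v := by
  conv_lhs => rw [← iMap_iInv hv, jMap_iMap (iInv_mem hv), jInv_upMap (iInv_mem hv)]
  exact iMap_iInv hv

lemma jMap_mem {v : R3} (hv : v ∈ disc.carrier) : jMap v ∈ upper.carrier := by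
  rw [← iMap_iInv hv, jMap_iMap (iInv_mem hv)]
  exact upMap_mem (iInv_mem hv)

lemma isOpen_disc : IsOpen disc.carrier := by
  have : Continuous fun v : R3 => v ⬝ᵥ v := by
    simp_rw [dotProduct_R3]; fun_prop
  exact isOpen_lt this continuous_const

lemma push_eq_self {E : Type} [NormedAddCommGroup E] [NormedSpace ℝ E] {f : E → E} {U : Set E}
    (hU : IsOpen U) (hf : ∀ x ∈ U, f x = x) {d : DecData E} (h1 : d.hor ⊆ U)
    (h2 : ∀ z ∈ d.line, z.1 ∈ U) : d.push f = d := by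
  have hfd : ∀ x ∈ U, fderiv ℝ f x = ContinuousLinearMap.id ℝ E := fun x hx => by
    have : f =ᶠ[nhds x] id := Filter.eventuallyEq_of_mem (hU.mem_nhds hx) hf
    rw [this.fderiv_eq, fderiv_id]
  apply DecData.ext
  · have : Set.EqOn f id d.hor := fun x hx => hf x (h1 hx)
    simp [DecData.push, this.image_eq]
  · have : Set.EqOn (fun z : E × E => (f z.1, fderiv ℝ f z.1 z.2)) id d.line := fun z hz => by
      simp [hf _ (h2 z hz), hfd _ (h2 z hz)]
    simp [DecData.push, this.image_eq]

lemma push_jInv {d : DecData R3} (h : IsDecorated disc d) : (JMap d).push jInv = d := by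
  obtain ⟨β, -, hhor, hline, -⟩ := h
  have h1 : d.hor ⊆ disc.carrier := by
    rw [hhor]; exact fun x hx => hx.1
  have h2 : ∀ z ∈ d.line, z.1 ∈ disc.carrier := fun z hz => h1 (hline z hz)
  rw [JMap, push_push]
  · exact push_eq_self isOpen_disc (fun v hv => jInv_jMap hv) h1 h2
  · exact fun z hz => (contDiffAt_jMap (n := 1) (h2 z hz)).differentiableAt (by norm_num)
  · exact fun z hz => (contDiffAt_jInv (n := 1) (jMap_mem (h2 z hz))).differentiableAt (by norm_num)

lemma eq_of_smul_eq {e e' w : R3} {a b : ℝ} (ha : 0 < a) (hb : 0 < b) (h1 : e ⬝ᵥ e = 1)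
    (h2 : e' ⬝ᵥ e' = 1) (he : e = a • w) (he' : e' = b • w) : e = e' := by
  rw [he, smul_dotProduct, dotProduct_smul, smul_eq_mul, smul_eq_mul] at h1
  rw [he', smul_dotProduct, dotProduct_smul, smul_eq_mul, smul_eq_mul] at h2
  have hw : w ⬝ᵥ w ≠ 0 := by
    rintro h0
    rw [h0] at h1
    simp at h1
  have : a = b := by
    have h3 : a ^ 2 = b ^ 2 := by
      apply mul_right_cancel₀ hw
      linear_combination h1 - h2
    exact (pow_left_inj₀ ha.le hb.le two_ne_zero).1 h3
  rw [he, he', this]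

lemma discNull_injective {n n' : R3} {s s' : ℝ} (h1 : -1 < s) (h2 : s < 1) (h2' : s' < 1)
    (h : discNull n s = discNull n' s') : n = n' ∧ s = s' := by
  have hs : 0 < 1 - s := by linarith
  have hs' : 0 < 1 - s' := by linarith
  have e0 : (1 + s) / (1 - s) = (1 + s') / (1 - s') := by
    have := congrFun h 0
    simpa [discNull] using this
  have hpos : 0 < (1 + s) / (1 - s) := div_pos (by linarith) hs
  refine ⟨?_, ?_⟩
  · ext k
    have := congrFun h k.succ
    simp only [discNull, Pi.smul_apply, Fin.cons_succ, smul_eq_mul, ← e0] at this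
    exact mul_left_cancel₀ hpos.ne' this
  · rw [div_eq_div_iff hs.ne' hs'.ne'] at e0
    linarith

/-- Coordinates are unique: the map to the upper half space is injective on decorated horospheres,
the horosphere fixes its null vector and hence n and s, and a ray contains one unit vector. -/
lemma eq_spinorCoord {κ : nonzeroSpinors} {a : R3 × R3 × ℝ}
    (h : IsCoord (upperChart.framing.spinDec κ).toDec a) : a = spinorCoord κ := by
  obtain ⟨n, e, s⟩ := a
  obtain ⟨hn, he, hs1, hs2, d, hd, hJ, hhor, hl⟩ := h
  simp only at hn he hs1 hs2 hhor hl
  have hd' : d = (discChart.framing.spinDec κ).toDec := by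
    rw [← push_jInv hd, hJ, toDec_upper_eq_JMap, push_jInv (discChart.framing.isDecorated κ)]
  subst hd'
  obtain ⟨κ₁, hκ₁, hp⟩ := exists_gMap_fMap (discNull_mem hn hs1 hs2)
  have hh : (discChart.framing.spinDec ⟨κ₁, hκ₁⟩).toDec.hor =
      disc.horosphere (discHoroFun n s) := hor_eq_horosphere discChart (horoCut_disc hn hs2) hp
  rw [← hh, Framing.hor_toDec, Framing.hor_toDec] at hhor
  obtain ⟨c, hc, hck⟩ := discChart.framing.exists_phase hhor.le
  -- The two spinors differ by a phase, to which f is insensitive.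
  have hp' : gMap (fMap κ) = discNull n s := by
    rw [← hp]
    congr 1
    have hck' : κ₁ = c • (κ : Fin 2 → ℂ) := hck
    rw [hck']
    ext i j
    rw [fMap_apply, fMap_apply]
    have : c * star c = 1 := by
      have := Complex.mul_conj c
      rw [hc] at this
      simpa using this
    simp only [Pi.smul_apply, smul_eq_mul, star_mul']
    linear_combination (-(κ : Fin 2 → ℂ) i * star ((κ : Fin 2 → ℂ) j)) * this
  obtain ⟨h1, h2, h3, h4⟩ := spinorCoord_norm κ.2
  rw [← discNull_spinorCoord κ.2] at hp'
  obtain ⟨rfl, rfl⟩ := discNull_injective h3 h4 hs2 hp'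
  have hl' := coord_mem_line κ
  obtain ⟨B, hB, b, hb, hz⟩ := discChart.framing.mem_line_toDec.1 hl
  obtain ⟨B', hB', b', hb', hz'⟩ := discChart.framing.mem_line_toDec.1 hl'
  obtain ⟨hz1, hz2⟩ := Prod.ext_iff.1 hz
  obtain ⟨hz1', hz2'⟩ := Prod.ext_iff.1 hz'
  have hBB : B = B' := discChart.framing.eq_of_mem_fibre hB hB' (hz1.symm.trans hz1')
  subst hBB
  have : e = (spinorCoord κ).2.1 := eq_of_smul_eq hb hb' he h2 hz2 hz2'
  rw [this]

/-! ### Differentiability of the coordinates -/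

lemma contDiff_coord_re (i : Fin 2) : ContDiff ℝ ∞ fun κ : Fin 2 → ℂ => (κ i).re :=
  Complex.reCLM.contDiff.comp (contDiff_apply ℝ ℂ i)

lemma contDiff_coord_im (i : Fin 2) : ContDiff ℝ ∞ fun κ : Fin 2 → ℂ => (κ i).im :=
  Complex.imCLM.contDiff.comp (contDiff_apply ℝ ℂ i)

lemma contDiff_spinorNormSq : ContDiff ℝ ∞ spinorNormSq := by
  have h0 := contDiff_coord_re 0
  have h1 := contDiff_coord_im 0
  have h2 := contDiff_coord_re 1
  have h3 := contDiff_coord_im 1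
  unfold spinorNormSq
  simp_rw [Complex.normSq_apply]
  fun_prop

lemma contDiff_spinorPos : ContDiff ℝ ∞ spinorPos := by
  have h0 := contDiff_coord_re 0
  have h1 := contDiff_coord_im 0
  have h2 := contDiff_coord_re 1
  have h3 := contDiff_coord_im 1
  refine contDiff_pi.2 fun k => ?_
  fin_cases k <;> simp [spinorPos] <;> fun_prop

lemma contDiff_spinorAxis : ContDiff ℝ ∞ spinorAxis := by
  have h0 := contDiff_coord_re 0
  have h1 := contDiff_coord_im 0
  have h2 := contDiff_coord_re 1
  have h3 := contDiff_coord_im 1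
  refine contDiff_pi.2 fun k => ?_
  fin_cases k <;> simp [spinorAxis] <;> fun_prop

lemma contDiffAt_spinorCoord {κ : Fin 2 → ℂ} (h : κ ≠ 0) : ContDiffAt ℝ ∞ spinorCoord κ := by
  have hN := spinorNormSq_pos h
  have hi : ContDiffAt ℝ ∞ (fun κ => (spinorNormSq κ)⁻¹) κ :=
    contDiff_spinorNormSq.contDiffAt.inv hN.ne'
  refine (hi.smul contDiff_spinorPos.contDiffAt).prodMk
    ((hi.smul contDiff_spinorAxis.contDiffAt).prodMk ?_)
  exact (contDiff_spinorNormSq.contDiffAt.sub contDiffAt_const).div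
    (contDiff_spinorNormSq.contDiffAt.add contDiffAt_const) (by linarith)

lemma hasDerivAt_quadratic (a b c : ℝ) : HasDerivAt (fun t : ℝ => a + t * b + t ^ 2 * c) b 0 := by
  have h1 := ((hasDerivAt_id (0 : ℝ)).mul_const b).const_add a
  have h2 := ((hasDerivAt_id (0 : ℝ)).pow 2).mul_const c
  have := h1.fun_add h2
  simpa using this

/-- The first two columns of the matrix of the frame determine a spinor infinitesimally. -/
lemma eq_zero_of_quadratic {a b c d A B C D : ℝ} (hN : 0 < a ^ 2 + b ^ 2 + c ^ 2 + d ^ 2)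
    (h1 : A * c + a * C + B * d + b * D = 0) (h2 : B * c + b * C - A * d - a * D = 0)
    (h3 : a * A + b * B - c * C - d * D = 0) (h4 : C * d + c * D - A * b - a * B = 0)
    (h5 : a * A - b * B + c * C - d * D = 0) (h6 : A * d + a * D + B * c + b * C = 0) :
    A = 0 ∧ B = 0 ∧ C = 0 ∧ D = 0 := by
  have key : (a ^ 2 + b ^ 2 + c ^ 2 + d ^ 2) * (A ^ 2 + B ^ 2 + C ^ 2 + D ^ 2) =
      -(a * A + b * B + c * C + d * D) ^ 2 - (a * D - d * A + (b * C - c * B)) ^ 2 := by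
    linear_combination (A * c + a * C + B * d + b * D) * h1 + (B * c + b * C - A * d - a * D) * h2 +
      (a * A + b * B - c * C - d * D) * h3 + (C * d + c * D - A * b - a * B) * h4 +
      (a * A - b * B + c * C - d * D) * h5 + (A * d + a * D + B * c + b * C) * h6
  have hle : A ^ 2 + B ^ 2 + C ^ 2 + D ^ 2 ≤ 0 := by
    by_contra hlt
    push Not at hlt
    have := mul_pos hN hlt
    nlinarith [sq_nonneg (a * A + b * B + c * C + d * D), sq_nonneg (a * D - d * A + (b * C - c * B))]
  refine ⟨?_, ?_, ?_, ?_⟩ <;> apply pow_eq_zero_iff two_ne_zero |>.1 <;>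
    nlinarith [sq_nonneg A, sq_nonneg B, sq_nonneg C, sq_nonneg D]

/-- A scalar factor depending on s undoes the normalisation, so a vector in the kernel also
annihilates the derivative of the quadratic map κ ↦ (`spinorPos`, `spinorAxis`). Its six components
give the hypotheses of `eq_zero_of_quadratic`. -/
lemma injective_fderiv_spinorCoord {κ : Fin 2 → ℂ} (h : κ ≠ 0) :
    Function.Injective (fderiv ℝ spinorCoord κ) := by
  rw [injective_iff_map_eq_zero]
  intro δ hδ
  have hN := spinorNormSq_pos h
  -- The factor (1 + s)/(1 - s) recovers |κ|² from the coordinates.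
  let R : R3 × R3 × ℝ → R3 × R3 := fun a =>
    (((1 + a.2.2) / (1 - a.2.2)) • a.1, ((1 + a.2.2) / (1 - a.2.2)) • a.2.1)
  have hR : DifferentiableAt ℝ R (spinorCoord κ) := by
    have h4 : 1 - (spinorCoord κ).2.2 ≠ 0 := by linarith [(spinorCoord_norm h).2.2.2]
    have hq : ContDiffAt ℝ 1 (fun a : R3 × R3 × ℝ => (1 + a.2.2) / (1 - a.2.2)) (spinorCoord κ) :=
      ContDiffAt.div (by fun_prop) (by fun_prop) h4
    exact ((hq.smul contDiffAt_fst).prodMk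
      (hq.smul (contDiffAt_fst.comp _ contDiffAt_snd))).differentiableAt (by norm_num)
  have hRT : (R ∘ spinorCoord) =ᶠ[nhds κ] fun κ => (spinorPos κ, spinorAxis κ) := by
    filter_upwards [isOpen_compl_singleton.mem_nhds h] with κ' h'
    have hN' := spinorNormSq_pos h'
    have e1 : (1 + (spinorCoord κ').2.2) / (1 - (spinorCoord κ').2.2) = spinorNormSq κ' := by
      simp only [spinorCoord]
      generalize spinorNormSq κ' = N at *
      have : 1 - (N - 1) / (N + 1) = 2 / (N + 1) := by field_simp; ring
      rw [this]
      field_simp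
      ring
    simp only [Function.comp, R, e1]
    simp [spinorCoord, smul_smul, hN'.ne']
  have hT : DifferentiableAt ℝ spinorCoord κ :=
    (contDiffAt_spinorCoord h).differentiableAt (by simp)
  have hQ : HasFDerivAt (fun κ => (spinorPos κ, spinorAxis κ))
      ((fderiv ℝ R (spinorCoord κ)).comp (fderiv ℝ spinorCoord κ)) κ :=
    (hR.hasFDerivAt.comp κ hT.hasFDerivAt).congr_of_eventuallyEq hRT.symm
  have hline := (hQ.hasLineDerivAt δ)
  rw [HasLineDerivAt, ContinuousLinearMap.comp_apply, hδ, map_zero] at hline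
  have hfst : ∀ k, HasDerivAt (fun t : ℝ => spinorPos (κ + t • δ) k) 0 0 := fun k =>
    hasDerivAt_pi.1 hline.fst k
  have hsnd : ∀ k, HasDerivAt (fun t : ℝ => spinorAxis (κ + t • δ) k) 0 0 := fun k =>
    hasDerivAt_pi.1 hline.snd k
  -- Along κ + tδ each component is a quadratic polynomial in t, whose linear coefficient must
  -- vanish.
  have key : ∀ {f : ℝ → ℝ} (a b c : ℝ), HasDerivAt f 0 0 → (∀ t, f t = a + t * b + t ^ 2 * c) →
      b = 0 := by
    intro f a b c hf he
    have : f = fun t => a + t * b + t ^ 2 * c := funext he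
    rw [this] at hf
    exact (hasDerivAt_quadratic a b c).unique hf
  have k1 := key (spinorPos κ 0)
    (2 * ((δ 0).re * (κ 1).re + (κ 0).re * (δ 1).re + (δ 0).im * (κ 1).im + (κ 0).im * (δ 1).im))
    (spinorPos δ 0) (hfst 0) (fun t => by simp [spinorPos]; ring)
  have k2 := key (spinorPos κ 1)
    (2 * ((δ 0).im * (κ 1).re + (κ 0).im * (δ 1).re - (δ 0).re * (κ 1).im - (κ 0).re * (δ 1).im))
    (spinorPos δ 1) (hfst 1) (fun t => by simp [spinorPos]; ring)
  have k3 := key (spinorPos κ 2)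
    (2 * ((κ 0).re * (δ 0).re + (κ 0).im * (δ 0).im - (κ 1).re * (δ 1).re - (κ 1).im * (δ 1).im))
    (spinorPos δ 2) (hfst 2) (fun t => by simp [spinorPos]; ring)
  have k4 := key (spinorAxis κ 0)
    (2 * ((δ 1).re * (κ 1).im + (κ 1).re * (δ 1).im - (δ 0).re * (κ 0).im - (κ 0).re * (δ 0).im))
    (spinorAxis δ 0) (hsnd 0) (fun t => by simp [spinorAxis]; ring)
  have k5 := key (spinorAxis κ 1)
    (2 * ((κ 0).re * (δ 0).re - (κ 0).im * (δ 0).im + (κ 1).re * (δ 1).re - (κ 1).im * (δ 1).im))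
    (spinorAxis δ 1) (hsnd 1) (fun t => by simp [spinorAxis]; ring)
  have k6 := key (spinorAxis κ 2)
    (2 * ((δ 0).re * (κ 1).im + (κ 0).re * (δ 1).im + (δ 0).im * (κ 1).re + (κ 0).im * (δ 1).re))
    (spinorAxis δ 2) (hsnd 2) (fun t => by simp [spinorAxis]; ring)
  rw [spinorNormSq, Complex.normSq_apply, Complex.normSq_apply] at hN
  obtain ⟨e1, e2, e3, e4⟩ := eq_zero_of_quadratic (a := (κ 0).re) (b := (κ 0).im) (c := (κ 1).re)
    (d := (κ 1).im) (A := (δ 0).re) (B := (δ 0).im) (C := (δ 1).re) (D := (δ 1).im) (by nlinarith)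
    (by linarith) (by linarith) (by linarith) (by linarith) (by linarith) (by linarith)
  ext i
  fin_cases i
  · exact Complex.ext e1 e2
  · exact Complex.ext e3 e4

/-! ### Immersions have smooth local left inverses -/

/-- Compose f with a linear left inverse P of its derivative: P ∘ f has derivative the identity, so
the inverse function theorem applies and (P ∘ f)⁻¹ ∘ P is the left inverse. -/
lemma exists_contDiffAt_leftInverse {E G : Type*} [NormedAddCommGroup E] [NormedSpace ℝ E]
    [FiniteDimensional ℝ E] [NormedAddCommGroup G] [NormedSpace ℝ G] [FiniteDimensional ℝ G]
    {f : E → G} {a : E} (hf : ContDiffAt ℝ ∞ f a) (hinj : Function.Injective (fderiv ℝ f a)) :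
    ∃ S : G → E, ContDiffAt ℝ ∞ S (f a) ∧ ∀ᶠ x in nhds a, S (f x) = x := by
  have := FiniteDimensional.complete ℝ E
  obtain ⟨P, hP⟩ := LinearMap.exists_leftInverse_of_injective (fderiv ℝ f a : E →ₗ[ℝ] G)
    (LinearMap.ker_eq_bot.2 hinj)
  let P' : G →L[ℝ] E := LinearMap.toContinuousLinearMap P
  have hg : ContDiffAt ℝ ∞ (P' ∘ f) a := P'.contDiff.contDiffAt.comp a hf
  have hd : HasFDerivAt (P' ∘ f) ((ContinuousLinearEquiv.refl ℝ E : E ≃L[ℝ] E) : E →L[ℝ] E) a := by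
    have h1 := P'.hasFDerivAt.comp a (hf.differentiableAt (by simp)).hasFDerivAt
    convert h1 using 1
    ext x
    exact (LinearMap.congr_fun hP x).symm
  have hn : (∞ : ℕ∞ω) ≠ 0 := by simp
  refine ⟨hg.localInverse hd hn ∘ P', ?_, ?_⟩
  · exact (hg.to_localInverse hd hn).comp (f a) P'.contDiff.contDiffAt
  · exact (hg.hasStrictFDerivAt' hd hn).eventually_left_inverse

/-- The same statement read in a chart: near x the chart itself is a smooth function of f. -/
lemma exists_leftInverse_of_mfderiv {E G X : Type*} [NormedAddCommGroup E] [NormedSpace ℝ E]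
    [FiniteDimensional ℝ E] [NormedAddCommGroup G] [NormedSpace ℝ G] [FiniteDimensional ℝ G]
    [TopologicalSpace X] [ChartedSpace E X] {f : X → G} {x : X}
    (hf : ContMDiffAt 𝓘(ℝ, E) 𝓘(ℝ, G) ∞ f x)
    (hinj : Function.Injective (mfderiv 𝓘(ℝ, E) 𝓘(ℝ, G) f x)) :
    ∃ S : G → E, ContDiffAt ℝ ∞ S (f x) ∧ ∀ᶠ y in nhds x, S (f y) = extChartAt 𝓘(ℝ, E) x y := by
  have hm : MDifferentiableAt 𝓘(ℝ, E) 𝓘(ℝ, G) f x := hf.mdifferentiableAt (by simp)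
  rw [hm.mfderiv] at hinj
  have h1 := (contMDiffAt_iff.1 hf).2
  simp only [modelWithCornersSelf_coe, Set.range_id, contDiffWithinAt_univ,
    extChartAt_model_space_eq_id, PartialEquiv.refl_coe, Function.id_comp] at h1
  simp only [modelWithCornersSelf_coe, Set.range_id, fderivWithin_univ, writtenInExtChartAt,
    extChartAt_model_space_eq_id, PartialEquiv.refl_coe, Function.id_comp] at hinj
  obtain ⟨S, hS, hev⟩ := exists_contDiffAt_leftInverse h1 hinj
  have hx : f ((extChartAt 𝓘(ℝ, E) x).symm (extChartAt 𝓘(ℝ, E) x x)) = f x := by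
    rw [extChartAt_to_inv]
  refine ⟨S, by rw [← hx]; exact hS, ?_⟩
  filter_upwards [(continuousAt_extChartAt (I := 𝓘(ℝ, E)) x).eventually hev,
    extChartAt_source_mem_nhds (I := 𝓘(ℝ, E)) x] with y hy hys
  rw [← hy, Function.comp, (extChartAt 𝓘(ℝ, E) x).left_inv hys]

/-! ### The smooth structure -/

/-- The homeomorphism of nonzero spinors with spin-decorated horospheres in the upper half space. -/
abbrev upperHomeo : nonzeroSpinors ≃ₜ SpinDecHorosphere upper := upperChart.framing.spinDecHomeo

lemma isCoord_iff (x : SpinDecHorosphere upper) (a : R3 × R3 × ℝ) :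
    IsCoord x.toDec a ↔ a = spinorCoord (upperHomeo.symm x) := by
  obtain ⟨κ, rfl⟩ := upperHomeo.surjective x
  rw [upperHomeo.symm_apply_apply]
  constructor
  · intro h
    exact eq_spinorCoord h
  · rintro rfl
    exact isCoord_spinorCoord κ

lemma contMDiff_negSpinor :
    ContMDiff 𝓘(ℝ, Fin 2 → ℂ) 𝓘(ℝ, Fin 2 → ℂ) ∞ negSpinor := by
  rw [← ContMDiff.subtypeVal_comp_iff]
  intro κ
  have h0 : ContDiffAt ℝ ∞ (fun κ : Fin 2 → ℂ => -κ) (κ : Fin 2 → ℂ) := contDiff_neg.contDiffAt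
  exact contMDiffAt_subtype_iff.2 h0.contMDiffAt

/-- The diffeomorphism `κ ↦ -κ`. -/
def negDiffeo : Diffeomorph 𝓘(ℝ, Fin 2 → ℂ) 𝓘(ℝ, Fin 2 → ℂ) nonzeroSpinors nonzeroSpinors ∞ where
  toEquiv := negSpinor.toEquiv
  contMDiff_toFun := contMDiff_negSpinor
  contMDiff_invFun := contMDiff_negSpinor

section

variable [ChartedSpace (EuclideanSpace ℝ (Fin 4)) (SpinDecHorosphere upper)]

/-- The coordinates Θ must be `spinorCoord` of the spinor. Near each point the spinor is S ∘ Θ, with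
S a smooth left inverse of the immersion `spinorCoord`. -/
lemma IsSmoothStructure.contMDiff_symm (h : IsSmoothStructure) :
    ContMDiff 𝓘(ℝ, EuclideanSpace ℝ (Fin 4)) 𝓘(ℝ, Fin 2 → ℂ) ∞ upperHomeo.symm := by
  obtain ⟨-, Θ, hΘ, hsm, -⟩ := h
  have hΘ' : Θ = fun x => spinorCoord (upperHomeo.symm x) := funext fun x => (isCoord_iff x _).1 (hΘ x)
  rw [← ContMDiff.subtypeVal_comp_iff]
  intro x
  have hne : (upperHomeo.symm x : Fin 2 → ℂ) ≠ 0 := (upperHomeo.symm x).2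
  obtain ⟨S, hS, hev⟩ := exists_contDiffAt_leftInverse (contDiffAt_spinorCoord hne)
    (injective_fderiv_spinorCoord hne)
  have hΘx : Θ x = spinorCoord (upperHomeo.symm x) := congrFun hΘ' x
  have h1 : ContMDiffAt 𝓘(ℝ, EuclideanSpace ℝ (Fin 4)) 𝓘(ℝ, Fin 2 → ℂ) ∞ (S ∘ Θ) x := by
    refine ContMDiffAt.comp x (ContDiffAt.contMDiffAt ?_) (hsm x)
    rw [hΘx]; exact hS
  refine h1.congr_of_eventuallyEq ?_
  have hc : ContinuousAt (Subtype.val ∘ upperHomeo.symm) x :=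
    (continuous_subtype_val.comp upperHomeo.symm.continuous).continuousAt
  filter_upwards [hc.eventually hev] with y hy
  rw [Function.comp, Function.comp, hΘ']
  exact hy.symm

/-- In the opposite direction, a chart of the target is a smooth function S of Θ, and on spinors Θ
is `spinorCoord`, so the map in charts is S ∘ `spinorCoord`. -/
lemma IsSmoothStructure.contMDiff (h : IsSmoothStructure) :
    ContMDiff 𝓘(ℝ, Fin 2 → ℂ) 𝓘(ℝ, EuclideanSpace ℝ (Fin 4)) ∞ upperHomeo := by
  obtain ⟨-, Θ, hΘ, hsm, hinj⟩ := h
  intro κ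
  rw [contMDiffAt_iff_target]
  refine ⟨upperHomeo.continuous.continuousAt, ?_⟩
  obtain ⟨S, hS, hev⟩ := exists_leftInverse_of_mfderiv (hsm (upperHomeo κ)) (hinj (upperHomeo κ))
  have hΘκ : ∀ κ, Θ (upperHomeo κ) = spinorCoord κ := fun κ => by
    rw [(isCoord_iff _ _).1 (hΘ _), upperHomeo.symm_apply_apply]
  have h1 : ContMDiffAt 𝓘(ℝ, Fin 2 → ℂ) 𝓘(ℝ, EuclideanSpace ℝ (Fin 4)) ∞
      (fun κ : nonzeroSpinors => S (spinorCoord κ)) κ := by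
    rw [hΘκ] at hS
    have h0 : ContDiffAt ℝ ∞ (fun κ => S (spinorCoord κ)) (κ : Fin 2 → ℂ) :=
      hS.comp (κ : Fin 2 → ℂ) (contDiffAt_spinorCoord κ.2)
    exact contMDiffAt_subtype_iff.2 h0.contMDiffAt
  refine h1.congr_of_eventuallyEq ?_
  filter_upwards [upperHomeo.continuous.continuousAt.eventually hev] with y hy
  rw [Function.comp, ← hy, hΘκ]

/-- The diffeomorphism of nonzero spinors with spin-decorated horospheres. -/
def upperDiffeo (h : IsSmoothStructure) : Diffeomorph 𝓘(ℝ, Fin 2 → ℂ)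
    𝓘(ℝ, EuclideanSpace ℝ (Fin 4)) nonzeroSpinors (SpinDecHorosphere upper) ∞ where
  toEquiv := upperHomeo.toEquiv
  contMDiff_toFun := h.contMDiff
  contMDiff_invFun := h.contMDiff_symm

end

lemma finrank_spinors : Module.finrank ℝ (Fin 2 → ℂ) = Module.finrank ℝ (EuclideanSpace ℝ (Fin 4)) := by
  rw [finrank_euclideanSpace_fin, Module.finrank_pi_fintype]
  simp [Complex.finrank_real_complex]

/-- A linear isomorphism of the space of spinors with `ℝ⁴`. -/
def spinorEquiv : (Fin 2 → ℂ) ≃L[ℝ] EuclideanSpace ℝ (Fin 4) :=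
  ContinuousLinearEquiv.ofFinrankEq finrank_spinors

/-- The global chart of the space of spin-decorated horospheres. -/
def spinorChart (x : SpinDecHorosphere upper) : EuclideanSpace ℝ (Fin 4) :=
  spinorEquiv (upperHomeo.symm x)

lemma isOpenEmbedding_spinorChart : Topology.IsOpenEmbedding spinorChart :=
  spinorEquiv.toHomeomorph.isOpenEmbedding.comp
    (nonzeroSpinors.isOpenEmbedding'.comp upperHomeo.symm.isOpenEmbedding)

instance : Nonempty (SpinDecHorosphere upper) := ⟨upperHomeo ⟨baseSpinor, baseSpinor_ne_zero⟩⟩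

/-- The homeomorphism with nonzero spinors, followed by a linear isomorphism with ℝ⁴, is a single
global chart; in it the coordinates are the immersion `spinorCoord`. -/
lemma exists_isSmoothStructure :
    ∃ _ : ChartedSpace (EuclideanSpace ℝ (Fin 4)) (SpinDecHorosphere upper), IsSmoothStructure := by
  have he := isOpenEmbedding_spinorChart
  let _ : ChartedSpace (EuclideanSpace ℝ (Fin 4)) (SpinDecHorosphere upper) :=
    he.singletonChartedSpace
  have hm : IsManifold 𝓘(ℝ, EuclideanSpace ℝ (Fin 4)) ∞ (SpinDecHorosphere upper) :=
    he.isManifold_singleton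
  have hm1 : IsManifold 𝓘(ℝ, EuclideanSpace ℝ (Fin 4)) 1 (SpinDecHorosphere upper) :=
    he.isManifold_singleton
  have hΘ : (fun x => spinorCoord (upperHomeo.symm x)) =
      (spinorCoord ∘ spinorEquiv.symm) ∘ spinorChart := by
    funext x
    simp [spinorChart]
  have hne : ∀ x, spinorEquiv.symm (spinorChart x) ≠ 0 := fun x => by
    rw [spinorChart, spinorEquiv.symm_apply_apply]
    exact (upperHomeo.symm x).2
  have h1 : ContMDiff 𝓘(ℝ, EuclideanSpace ℝ (Fin 4)) 𝓘(ℝ, EuclideanSpace ℝ (Fin 4)) ∞ spinorChart :=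
    contMDiff_isOpenEmbedding he
  have h2 : ∀ x, ContDiffAt ℝ ∞ (spinorCoord ∘ spinorEquiv.symm) (spinorChart x) := fun x =>
    (contDiffAt_spinorCoord (hne x)).comp _ spinorEquiv.symm.contDiff.contDiffAt
  refine ⟨inferInstance, hm, fun x => spinorCoord (upperHomeo.symm x),
    fun x => (isCoord_iff x _).2 rfl, ?_, fun x => ?_⟩
  · rw [hΘ]
    intro x
    exact ((h2 x).contMDiffAt).comp x (h1 x)
  · rw [hΘ, mfderiv_comp x ((h2 x).contMDiffAt.mdifferentiableAt (by simp))
      ((h1 x).mdifferentiableAt (by simp)), mfderiv_eq_fderiv]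
    -- The global chart is the extended chart at every point, so its derivative is invertible.
    have hi : Function.Injective (mfderiv 𝓘(ℝ, EuclideanSpace ℝ (Fin 4))
        𝓘(ℝ, EuclideanSpace ℝ (Fin 4)) spinorChart x) :=
      (isInvertible_mfderiv_extChartAt (I := 𝓘(ℝ, EuclideanSpace ℝ (Fin 4)))
        (mem_extChartAt_source x)).injective
    have hT : Function.Injective
        (fderiv ℝ (spinorCoord ∘ spinorEquiv.symm) (spinorChart x)) := by
      rw [fderiv_comp _ ((contDiffAt_spinorCoord (hne x)).differentiableAt (by simp))
        spinorEquiv.symm.differentiableAt, spinorEquiv.symm.fderiv]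
      exact (injective_fderiv_spinorCoord (hne x)).comp spinorEquiv.symm.injective
    exact hT.comp hi

end SpinorHoro

end

/-! ### The theorem -/

theorem theorem1p1 :
    (∃ Ft Gt Ht It Jt, AreSpinLifts Ft Gt Ht It Jt) ∧
    (∃ _ : ChartedSpace (EuclideanSpace ℝ (Fin 4)) (SpinDecHorosphere upper),
      IsSmoothStructure) ∧
    ∀ (Ft : nonzeroSpinors → HermSpinFlag) (Gt : HermSpinFlag → MinkSpinFlag)
      (Ht : MinkSpinFlag → SpinDecHorosphere hyperboloid)
      (It : SpinDecHorosphere hyperboloid → SpinDecHorosphere disc)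
      (Jt : SpinDecHorosphere disc → SpinDecHorosphere upper)
      (Kt : nonzeroSpinors → SpinDecHorosphere upper),
      AreSpinLifts Ft Gt Ht It Jt → Kt = Jt ∘ It ∘ Ht ∘ Gt ∘ Ft →
      (∀ [ChartedSpace (EuclideanSpace ℝ (Fin 4)) (SpinDecHorosphere upper)], IsSmoothStructure →
        ∃ Φ : Diffeomorph 𝓘(ℝ, Fin 2 → ℂ) 𝓘(ℝ, EuclideanSpace ℝ (Fin 4))
          nonzeroSpinors (SpinDecHorosphere upper) ∞, ⇑Φ = Kt) ∧
      (∀ (A : SL2C) (κ : nonzeroSpinors) (y : SpinDecHorosphere upper),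
        HoroAct A (Kt κ) y ↔ y = Kt (spinorAct A κ)) ∧
      (∀ κ : nonzeroSpinors, (Kt κ).toDec = KMap κ ∧
        IsDescribedBy ((κ : Fin 2 → ℂ) 0) ((κ : Fin 2 → ℂ) 1) (Kt κ).toDec) := by
  refine ⟨⟨_, _, _, _, _, areSpinLifts_spinDec⟩, exists_isSmoothStructure, ?_⟩
  intro Ft Gt Ht It Jt Kt hl hK
  have hdec : ∀ κ, (Kt κ).toDec = KMap κ := fun κ => by rw [hK]; exact hl.toDec_comp κ
  have hc : Continuous Kt := by rw [hK]; exact hl.continuous_comp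
  refine ⟨?_, ?_, fun κ => ⟨hdec κ, ?_⟩⟩
  · intro _ hs
    rcases eq_spinDec_comp hc hdec with e | e
    · exact ⟨upperDiffeo hs, e.symm⟩
    · exact ⟨negDiffeo.trans (upperDiffeo hs), e.symm⟩
  · intro A κ y
    rcases eq_spinDec_comp hc hdec with e | e
    · rw [e]
      exact upperChart.framing.horoAct_spinDec A κ y
    -- The choice of sign is harmless, as negation commutes with the linear action on spinors.
    · rw [e, Function.comp, Function.comp, upperChart.framing.horoAct_spinDec, spinorAct_negSpinor]
  · rw [hdec, ← toDec_upper]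
    exact isDescribedBy_spinDec κ
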